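/- Let $p$ be a prime, $K$ a finite extension of $\mathbb Q_p$ with absolute value $|\cdot|$, extended to an algebraic closure $\bar K$, and let $f\in K(x)$ be a rational map of degree $d$ with $1\le d<p$ and good reduction: $f=P/Q$ with $P,Q\in\mathcal O_K[x]$ whose reductions $\tilde P,\tilde Q$ are coprime and satisfy $\max(\deg\tilde P,\deg\tilde Q)=d$. Then $f$ acts on $\mathbb P^1(\bar K)$. Write $\tilde x$ for the reduction of $x\in\mathbb P^1(\bar K)$, and let $|x-y|$ denote the spherical distance on $\mathbb P^1(\bar K)$ (so $|x-y|<1$ if and only if $\tilde x=\tilde y$; it is the usual distance for integral $x,y$). A *branch* for $f$ over $K$ is a sequence $(\alpha_n)_{n\ge0}$ in $\mathbb P^1(\bar K)$ with $\alpha_0\in\mathbb P^1(K)$ and $f(\alpha_{n+1})=\alpha_n$ for all $n$; $\alpha_0$ is its *base point*. Its *branch representation* is the homomorphism $\mathrm{Gal}(\bar K/K)\to\mathrm{Aut}(T)$, where $T$ is the tree formed by the Galois orbit of the branch. It is *infinitely ramified* if for no finite extension $L/K$ in $\bar K$ its restriction to $\mathrm{Gal}(\bar K/L)$ is trivial on inertia.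 A point is *pre-critical* if one of its forward iterates $f^k(x)$, $k\ge0$, is a critical point of $f$. The *dynamical incidence graph* $\mathfrak C$ has as vertices the pre-critical closed points of $\mathbb P^1_K$, a directed edge $P\to Q$ when $f(P)=Q$, and an undirected edge between distinct $P$ and $Q$ whose closures in $\mathbb P^1_{\mathcal O_K}$ meet on the special fiber. A *directed cycle* is a cycle that traverses directed edges in their direction and contains at least one directed edge. Consider the conditions (a) $\mathfrak C$ has a directed cycle; (b) for every $\epsilon>0$ there are $\alpha\in K$ and a critical point $c$ of $f$ with $|\alpha-c|<\epsilon$ such that some branch with base point $\alpha$ is infinitely ramified; (c) some branch representation for $f$ is infinitely ramified. Then (b) implies (c) and (c) implies (a), and if (R) every critical point $c$ of $f$ whose reduction is periodic under the reduction of $f$ lies in $\mathbb P^1(K)$, then (a), (b) and (c) are equivalent. Moreover, let $(\alpha_n)$ be any infinitely ramified branch. There is a sequence $(\gamma_n)_{n\ge 0}$ of pre-critical points with $f(\gamma_{n+1})=\gamma_n$ and $|\alpha_n-\gamma_n|<1$ for all $n$, and under (R) it can be chosen with $\gamma_0\in\mathbb P^1(K)$, i.e. as a branch over $K$. The sequence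 of reductions $(\tilde\alpha_n)$ is periodic; let $m$ be its exact period. Then $f^m$, expanded as a power series $f^m(\alpha_0+t)-\alpha_0$ in $t$ (in the coordinate $1/x$ if $\tilde\alpha_0=\infty$), has integral coefficients and a finite Weierstrass degree $e$ (the index of the first coefficient that is a unit). For all sufficiently large $n$, $K(\alpha_{n+m})/K(\alpha_n)$ is a totally ramified extension of degree $e$ (with $K(\infty)=K$), and the ramification index of $K(\alpha_n)/K$ has the order of growth of $e^{n/m}$: for some constants $C_1,C_2>0$ it lies between $C_1e^{n/m}$ and $C_2e^{n/m}$ for all large $n$. Finally, let $c\in\mathbb P^1(K)$ be a critical point of $f$ that is not periodic, and suppose that some $\alpha\in\mathbb P^1(K)$ with $|\alpha-c|<1$ is the base point of an infinitely ramified branch. Then $c$ itself is the base point of an infinitely ramified branch. -/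

import Mathlib

open Filter Topology Polynomial

noncomputable section

namespace Arboreal

/-! ### Absolute value, ring of integers and residue field

`F` is an algebraic extension of `ℚ_[p]`; it is used for `F = K`, a `p`-adic field, and for
`F = AlgebraicClosure K`. -/

section Valuation

variable (p : ℕ) [Fact p.Prime] {F : Type*} [Field F] [Algebra ℚ_[p] F]

/-- The unique absolute value on `F` extending the `p`-adic absolute value of `ℚ_[p]`. -/
def absv (x : F) : ℝ := spectralNorm ℚ_[p] F x

theorem absv_one : absv p (1 : F) = 1 := spectralNorm_one

theorem absv_zero : absv p (0 : F) = 0 := spectralNorm_zero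

theorem absv_nonneg (x : F) : 0 ≤ absv p x := spectralNorm_nonneg x

/-- The spherical (chordal) distance on `ℙ¹(F)`. It is `|x - y|` for integral `x` and `y`. -/
def sphDist : OnePoint F → OnePoint F → ℝ
  | OnePoint.infty, OnePoint.infty => 0
  | OnePoint.infty, OnePoint.some y => 1 / max 1 (absv p y)
  | OnePoint.some x, OnePoint.infty => 1 / max 1 (absv p x)
  | OnePoint.some x, OnePoint.some y =>
      absv p (x - y) / (max 1 (absv p x) * max 1 (absv p y))

variable [Algebra.IsAlgebraic ℚ_[p] F]

theorem absv_mul (x y : F) : absv p (x * y) = absv p x * absv p y :=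
  map_mul (spectralMulAlgNorm ℚ_[p] F) x y

theorem absv_neg (x : F) : absv p (-x) = absv p x :=
  spectralNorm_neg (Algebra.IsAlgebraic.isAlgebraic x)

theorem absv_add_le (x y : F) : absv p (x + y) ≤ max (absv p x) (absv p y) :=
  isNonarchimedean_spectralNorm x y

theorem absv_inv (x : F) : absv p x⁻¹ = (absv p x)⁻¹ := by
  rcases eq_or_ne x 0 with rfl | hx
  · simp [absv_zero]
  · refine eq_inv_of_mul_eq_one_left ?_
    rw [← absv_mul, inv_mul_cancel₀ hx, absv_one]

variable (F) in
/-- The ring of integers `{x | |x| ≤ 1}` of `F`. -/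
def intRing : ValuationSubring F where
  carrier := {x | absv p x ≤ 1}
  mul_mem' {x y} hx hy := by
    change absv p x ≤ 1 at hx; change absv p y ≤ 1 at hy; change absv p (x * y) ≤ 1
    rw [absv_mul]
    exact mul_le_one₀ hx (absv_nonneg p y) hy
  one_mem' := (absv_one p).le
  add_mem' {x y} hx hy := (absv_add_le p x y).trans (max_le hx hy)
  zero_mem' := by simp [absv_zero]
  neg_mem' {x} hx := by simpa [absv_neg] using hx
  mem_or_inv_mem' x := by
    change absv p x ≤ 1 ∨ absv p x⁻¹ ≤ 1
    rw [absv_inv]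
    rcases le_total (absv p x) 1 with h | h
    · exact Or.inl h
    · exact Or.inr (inv_le_one_of_one_le₀ h)

open Classical in
/-- The reduction map from `ℙ¹(F)` to the points of `ℙ¹` over the residue field of `F`. The
projective line over a field is the field together with the point `∞`; non-integral elements and
`∞` reduce to `∞`. -/
def red : OnePoint F → OnePoint (IsLocalRing.ResidueField (intRing p F))
  | OnePoint.infty => OnePoint.infty
  | OnePoint.some x =>
      if hx : x ∈ intRing p F then
        OnePoint.some (IsLocalRing.residue (intRing p F) ⟨x, hx⟩)
      else OnePoint.infty

end Valuation

/-! ### Rational maps on the projective line -/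

section RationalMap

variable {K : Type*} [Field K]

/-- The degree of a rational map. -/
def ratDegree (f : RatFunc K) : ℕ := max f.num.natDegree f.denom.natDegree

/-- The self-map of `ℙ¹(L)` defined by a rational function over `K`, for an extension `L / K`. -/
def evalP1 (L : Type*) [Field L] [Algebra K L] [DecidableEq L] (f : RatFunc K) :
    OnePoint L → OnePoint L
  | OnePoint.infty =>
      if algebraMap K L (f.denom.coeff (ratDegree f)) = 0 then OnePoint.infty
      else OnePoint.some (algebraMap K L (f.num.coeff (ratDegree f)) /
        algebraMap K L (f.denom.coeff (ratDegree f)))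
  | OnePoint.some x =>
      if aeval x f.denom = 0 then OnePoint.infty
      else OnePoint.some (aeval x f.num / aeval x f.denom)

/-- The critical points of `f`: the zeros of the Wronskian of numerator and denominator, which is
up to sign the numerator of the derivative of `f` and of `1 / f`. At `∞` the same
condition is imposed at `y = 0` in the chart `y = 1 / x`, where `f` is the quotient of the
reversed polynomials. -/
def IsCritical (L : Type*) [Field L] [Algebra K L] (f : RatFunc K) : OnePoint L → Prop
  | OnePoint.infty =>
      aeval (0 : L) (wronskian (f.num.reflect (ratDegree f)) (f.denom.reflect (ratDegree f))) = 0
  | OnePoint.some x => aeval x (wronskian f.num f.denom) = 0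

/-- Composition `f ∘ g` of rational functions. -/
def ratComp (f g : RatFunc K) : RatFunc K := f.eval RatFunc.C g

/-- The `m`-th iterate of `f` as a rational function. -/
def ratIter (f : RatFunc K) : ℕ → RatFunc K
  | 0 => RatFunc.X
  | m + 1 => ratComp f (ratIter f m)

/-- The map `f` in the coordinate `y = 1 / x`, that is, `y ↦ 1 / f (1 / y)`. -/
def ratFlip (f : RatFunc K) : RatFunc K := (ratComp f RatFunc.X⁻¹)⁻¹

/-- The Laurent expansion in `t` of `g (a + t) - a`. -/
def expandAt (g : RatFunc K) (a : K) : LaurentSeries K :=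
  ((ratComp g (RatFunc.X + RatFunc.C a) - RatFunc.C a : RatFunc K) : LaurentSeries K)

end RationalMap

section Padic

variable (p : ℕ) [Fact p.Prime] {K : Type*} [Field K] [Algebra ℚ_[p] K]

/-- `s` is a power series with integral coefficients and of (finite) Weierstrass degree `e`, i.e.
`e` is the index of the first coefficient that is a unit. -/
def HasWeierstrassDegree (s : LaurentSeries K) (e : ℕ) : Prop :=
  (∀ i : ℤ, i < 0 → s.coeff i = 0) ∧ (∀ i : ℤ, absv p (s.coeff i) ≤ 1) ∧
    (∀ i : ℤ, i < e → absv p (s.coeff i) < 1) ∧ absv p (s.coeff e) = 1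

/-- The Weierstrass degree of `f ^ m`, expanded as a power series around `x ∈ ℙ¹(K)`, is `e`.
For a point reducing to `∞` the expansion is made in the coordinate `1 / x`. -/
def HasLocalWeierstrassDegree (f : RatFunc K) (m : ℕ) (x : OnePoint K) (e : ℕ) : Prop :=
  match x with
  | OnePoint.infty => HasWeierstrassDegree p (expandAt (ratIter (ratFlip f) m) 0) e
  | OnePoint.some a =>
      (absv p a ≤ 1 → HasWeierstrassDegree p (expandAt (ratIter f m) a) e) ∧
      (1 < absv p a → HasWeierstrassDegree p (expandAt (ratIter (ratFlip f) m) a⁻¹) e)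

/-- Good reduction: `f = P / Q` with integral `P`, `Q` whose reductions are coprime and still
define a map of the same degree. -/
def HasGoodReduction [Algebra.IsAlgebraic ℚ_[p] K] (f : RatFunc K) : Prop :=
  ∃ (P Q : (intRing p K)[X]) (a : K), a ≠ 0 ∧
    P.map (intRing p K).subtype = C a * f.num ∧
    Q.map (intRing p K).subtype = C a * f.denom ∧
    IsCoprime (P.map (IsLocalRing.residue (intRing p K)))
      (Q.map (IsLocalRing.residue (intRing p K))) ∧
    max (P.map (IsLocalRing.residue (intRing p K))).natDegree
      (Q.map (IsLocalRing.residue (intRing p K))).natDegree = ratDegree f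

end Padic

/-! ### Dynamics over the algebraic closure -/

section Dynamics

variable {K : Type*} [Field K]

/-- `ℙ¹` of the algebraic closure of `K`. -/
abbrev P1bar (K : Type*) [Field K] := OnePoint (AlgebraicClosure K)

/-- The absolute Galois group of `K`. -/
abbrev GalBar (K : Type*) [Field K] := AlgebraicClosure K ≃ₐ[K] AlgebraicClosure K

/-- The inclusion of `ℙ¹(K)` in `ℙ¹` of the algebraic closure. -/
def toBar (x : OnePoint K) : P1bar K := OnePoint.map (algebraMap K (AlgebraicClosure K)) x

/-- The Galois action on `ℙ¹` of the algebraic closure. -/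
def gal (σ : GalBar K) (x : P1bar K) : P1bar K := OnePoint.map σ x

theorem gal_one (x : P1bar K) : gal 1 x = x := by
  cases x <;> rfl

theorem gal_mul (σ τ : GalBar K) (x : P1bar K) : gal (σ * τ) x = gal σ (gal τ x) := by
  cases x <;> rfl

theorem gal_inv_gal (σ : GalBar K) (x : P1bar K) : gal σ⁻¹ (gal σ x) = x := by
  rw [← gal_mul, inv_mul_cancel, gal_one]

open Classical in
/-- The self-map of `ℙ¹` of the algebraic closure defined by `f`. -/
def mapBar (f : RatFunc K) : P1bar K → P1bar K := evalP1 (AlgebraicClosure K) f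

/-- `x` is critical for `f`. -/
def IsCrit (f : RatFunc K) (x : P1bar K) : Prop := IsCritical (AlgebraicClosure K) f x

/-- `x` lies in the pre-critical locus, the union of the supports of the ramification divisors of
all iterates of `f`: some `f ^ k (x)`, with `k ≥ 0`, is critical. -/
def IsPreCrit (f : RatFunc K) (x : P1bar K) : Prop := ∃ k : ℕ, IsCrit f ((mapBar f)^[k] x)

/-- A sequence with `f (a (n + 1)) = a n`, with no condition on the field of definition of
`a 0`. -/
def IsBackwardOrbit (f : RatFunc K) (a : ℕ → P1bar K) : Prop :=
  ∀ n, mapBar f (a (n + 1)) = a n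

/-- A branch for `f` over `K` with base point `x ∈ ℙ¹(K)`. -/
def IsBranchOver (f : RatFunc K) (x : OnePoint K) (a : ℕ → P1bar K) : Prop :=
  a 0 = toBar x ∧ IsBackwardOrbit f a

/-! ### The branch representation -/

/-- The vertices of the tree formed by the Galois orbit of the branch `a`: at level `n`, the
conjugates of `a n`. -/
abbrev TreeNode (a : ℕ → P1bar K) := {v : ℕ × P1bar K // ∃ σ : GalBar K, v.2 = gal σ (a v.1)}

/-- The tree formed by the Galois orbit of the branch `a`: the conjugates of the branch are paths
in the tree. -/
def branchTree (a : ℕ → P1bar K) : SimpleGraph (TreeNode a) :=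
  SimpleGraph.fromRel fun u v =>
    v.1.1 = u.1.1 + 1 ∧ ∃ σ : GalBar K, u.1.2 = gal σ (a u.1.1) ∧ v.1.2 = gal σ (a v.1.1)

/-- The action of a Galois element on the vertices. -/
def nodePerm (a : ℕ → P1bar K) (τ : GalBar K) : Equiv.Perm (TreeNode a) where
  toFun v := ⟨(v.1.1, gal τ v.1.2), by
    obtain ⟨σ, hσ⟩ := v.2
    exact ⟨τ * σ, by rw [gal_mul, ← hσ]⟩⟩
  invFun v := ⟨(v.1.1, gal τ⁻¹ v.1.2), by
    obtain ⟨σ, hσ⟩ := v.2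
    exact ⟨τ⁻¹ * σ, by rw [gal_mul, ← hσ]⟩⟩
  left_inv v := by
    apply Subtype.ext
    simp [gal_inv_gal]
  right_inv v := by
    apply Subtype.ext
    have := gal_inv_gal τ⁻¹ v.1.2
    rw [inv_inv] at this
    simp [this]

theorem nodePerm_adj (a : ℕ → P1bar K) (τ : GalBar K) {u v : TreeNode a}
    (h : (branchTree a).Adj u v) : (branchTree a).Adj (nodePerm a τ u) (nodePerm a τ v) := by
  rw [branchTree, SimpleGraph.fromRel_adj] at h ⊢
  refine ⟨fun he => h.1 ((nodePerm a τ).injective he), ?_⟩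
  rcases h.2 with ⟨hl, σ, hu, hv⟩ | ⟨hl, σ, hu, hv⟩
  · exact Or.inl ⟨hl, τ * σ, by simp [nodePerm, gal_mul, ← hu], by simp [nodePerm, gal_mul, ← hv]⟩
  · exact Or.inr ⟨hl, τ * σ, by simp [nodePerm, gal_mul, ← hu], by simp [nodePerm, gal_mul, ← hv]⟩

theorem nodePerm_mul (a : ℕ → P1bar K) (σ τ : GalBar K) (v : TreeNode a) :
    nodePerm a (σ * τ) v = nodePerm a σ (nodePerm a τ v) := by
  apply Subtype.ext
  simp [nodePerm, gal_mul]

theorem nodePerm_one (a : ℕ → P1bar K) (v : TreeNode a) : nodePerm a 1 v = v := by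
  apply Subtype.ext
  simp [nodePerm, gal_one]

/-- The branch representation: the homomorphism from the absolute Galois group to the automorphism
group of the tree formed by the Galois orbit of the branch. -/
def branchRep (a : ℕ → P1bar K) : GalBar K →* (branchTree a ≃g branchTree a) where
  toFun τ :=
    { toEquiv := nodePerm a τ
      map_rel_iff' := by
        intro u v
        refine ⟨fun h => ?_, nodePerm_adj a τ⟩
        have h' := nodePerm_adj a τ⁻¹ h
        rw [← nodePerm_mul, ← nodePerm_mul, inv_mul_cancel, nodePerm_one, nodePerm_one] at h'
        exact h' }
  map_one' := by
    apply RelIso.ext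
    intro v
    exact nodePerm_one a v
  map_mul' σ τ := by
    apply RelIso.ext
    intro v
    exact nodePerm_mul a σ τ v

end Dynamics

/-! ### Ramification -/

section Ramification

variable (p : ℕ) [Fact p.Prime] {K : Type*} [Field K] [Algebra ℚ_[p] K]
  [FiniteDimensional ℚ_[p] K]

theorem algebraic_bar : Algebra.IsAlgebraic ℚ_[p] (AlgebraicClosure K) :=
  Algebra.IsAlgebraic.trans ℚ_[p] K (AlgebraicClosure K)

/-- The elements of the absolute Galois group of `L` that lie in the inertia group of `L`, i.e.
act trivially on the residue field of the algebraic closure. -/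
def IsInertial (L : IntermediateField K (AlgebraicClosure K)) (σ : GalBar K) : Prop :=
  σ ∈ L.fixingSubgroup ∧
    ∀ x : AlgebraicClosure K, absv p x ≤ 1 → absv p (σ x - x) < 1

/-- The restriction of the branch representation to the absolute Galois group of `L` is
unramified, i.e. trivial on inertia. -/
def IsUnramifiedOver (L : IntermediateField K (AlgebraicClosure K)) (a : ℕ → P1bar K) : Prop :=
  ∀ σ : GalBar K, IsInertial p L σ → branchRep a σ = 1

/-- The branch representation becomes unramified over no finite extension of `K`. -/
def IsInfinitelyRamified (a : ℕ → P1bar K) : Prop :=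
  ¬ ∃ L : IntermediateField K (AlgebraicClosure K),
    FiniteDimensional K L ∧ IsUnramifiedOver p L a

/-- The value group `|L ∖ {0}|`. -/
def valueGroup (L : IntermediateField K (AlgebraicClosure K)) : Subgroup ℝˣ :=
  haveI := algebraic_bar p (K := K)
  { carrier := {u | ∃ x ∈ L, absv p x = (u : ℝ)}
    mul_mem' := by
      rintro u v ⟨x, hx, hu⟩ ⟨y, hy, hv⟩
      exact ⟨x * y, L.mul_mem hx hy, by rw [absv_mul, hu, hv, Units.val_mul]⟩
    one_mem' := ⟨1, L.one_mem, by rw [absv_one, Units.val_one]⟩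
    inv_mem' := by
      rintro u ⟨x, hx, hu⟩
      exact ⟨x⁻¹, L.inv_mem hx, by rw [absv_inv, hu, Units.val_inv_eq_inv_val]⟩ }

/-- The ramification index of `M / L`: the index of the value groups. -/
def ramIndex (L M : IntermediateField K (AlgebraicClosure K)) : ℕ :=
  (valueGroup p L).relIndex (valueGroup p M)

/-- `M / L` is a field extension of degree `e` with ramification index `e`. -/
def IsTotallyRamifiedOfDegree (L M : IntermediateField K (AlgebraicClosure K)) (e : ℕ) : Prop :=
  L ≤ M ∧ 0 < e ∧ L.relfinrank M = e ∧ ramIndex p L M = e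

/-- The field of definition `K(x)` of a point `x` of `ℙ¹`, with `K(∞) = K`. -/
def fieldOf : P1bar K → IntermediateField K (AlgebraicClosure K)
  | OnePoint.infty => ⊥
  | OnePoint.some x => IntermediateField.adjoin K {x}

/-- The reduction map on `ℙ¹` of the algebraic closure. -/
def redBar (x : P1bar K) :
    haveI := algebraic_bar p (K := K)
    OnePoint (IsLocalRing.ResidueField (intRing p (AlgebraicClosure K))) :=
  haveI := algebraic_bar p (K := K)
  red p x

/-- The reduction of the sequence `a` is purely periodic with exact period `m`. -/
def HasExactResidualPeriod (a : ℕ → P1bar K) (m : ℕ) : Prop :=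
  IsLeast {k : ℕ | 0 < k ∧ ∀ n, redBar p (a (n + k)) = redBar p (a n)} m

/-! ### The dynamical incidence graph -/

variable (K) in
/-- Galois conjugacy of points. -/
def galSetoid : Setoid (P1bar K) where
  r x y := ∃ σ : GalBar K, gal σ x = y
  iseqv :=
    { refl := fun x => ⟨1, gal_one x⟩
      symm := by
        rintro x y ⟨σ, rfl⟩
        exact ⟨σ⁻¹, gal_inv_gal σ x⟩
      trans := by
        rintro x y z ⟨σ, rfl⟩ ⟨τ, rfl⟩
        exact ⟨τ * σ, gal_mul τ σ x⟩ }

variable (K) in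
/-- The closed points of `ℙ¹` over `K`, as Galois orbits of geometric points. -/
abbrev ClosedPoint := Quotient (galSetoid K)

/-- The closed point below a geometric point. -/
def closedPt (x : P1bar K) : ClosedPoint K := Quotient.mk (galSetoid K) x

/-- The vertices of the pre-critical dynamical incidence graph: the closed points in the support
of the pre-critical divisor. -/
abbrev IncidenceVertex (f : RatFunc K) :=
  {P : ClosedPoint K // ∃ x, closedPt x = P ∧ IsPreCrit f x}

/-- A directed edge from `P` to `Q`: `f (P) = Q`. -/
def DirectedEdge (f : RatFunc K) (P Q : IncidenceVertex f) : Prop :=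
  ∃ x, closedPt x = P.1 ∧ closedPt (mapBar f x) = Q.1

/-- An undirected edge between the distinct points `P` and `Q`: their closures in `ℙ¹` over the
ring of integers meet on the special fiber. -/
def UndirectedEdge (f : RatFunc K) (P Q : IncidenceVertex f) : Prop :=
  P ≠ Q ∧ ∃ x y, closedPt x = P.1 ∧ closedPt y = Q.1 ∧ redBar p x = redBar p y

/-- The pre-critical dynamical incidence graph has a directed cycle: a cycle, with directed edges
traversed along their direction, that contains at least one directed edge. The addition `i + 1` is
cyclic in `Fin (k + 1)`; for `k = 0` the cycle is a directed loop. -/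
def HasDirectedCycle (f : RatFunc K) : Prop :=
  ∃ (k : ℕ) (v : Fin (k + 1) → IncidenceVertex f), Function.Injective v ∧
    (∀ i, DirectedEdge f (v i) (v (i + 1)) ∨ UndirectedEdge p f (v i) (v (i + 1))) ∧
    ∃ i, DirectedEdge f (v i) (v (i + 1))

/-- Arbitrarily close to critical points there are base points in `K` with an infinitely ramified
branch. -/
def HasInfRamifiedNearCritical (f : RatFunc K) : Prop :=
  ∀ ε : ℝ, 0 < ε → ∃ (α : K) (c : P1bar K), IsCrit f c ∧
    sphDist p (toBar (OnePoint.some α)) c < ε ∧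
    ∃ a, IsBranchOver f (OnePoint.some α) a ∧ IsInfinitelyRamified p a

/-- Some branch representation is infinitely ramified. -/
def HasInfRamifiedBranch (f : RatFunc K) : Prop :=
  ∃ (x : OnePoint K) (a : ℕ → P1bar K), IsBranchOver f x a ∧ IsInfinitelyRamified p a

/-- Every critical point of `f` whose reduction is periodic is defined over `K`. -/
def PeriodicCriticalRational (f : RatFunc K) : Prop :=
  ∀ c : P1bar K, IsCrit f c →
    (∃ k : ℕ, 0 < k ∧ redBar p ((mapBar f)^[k] c) = redBar p c) →
    ∃ x : OnePoint K, toBar x = c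

end Ramification

end Arboreal

end

/-!
A rational map `f` with good reduction does not increase spherical distances, and more precisely
satisfies a product formula: the distance of `f y` to a point `w` is the product of the distances of
`y` to the preimages of `w` (`GoodMap`, `GoodPair.goodMap`). Hence `f` maps residue discs onto
residue discs with a well-defined local degree (`LocDeg`), and local degrees multiply under
composition. As the degree is less than `p`, the reduction is separable, and the local degree is at
least `2` exactly on the discs that contain a critical point (`GoodPair.exists_critical_of_integral`
and `GoodPair.two_le_ldeg`, collected in `TameMap`).

*Dynamics on a periodic disc.* Let `h` map a residue disc to itself with local degree `e ≥ 2`, and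
let `b` be a point of the disc. There is a radius `r < 1` such that `h` is contracting on the closed
disc of radius `r` around `b`, and raises the distance to `b` to the power `e` outside of it
(`EscapeRadius`). A backward orbit of `h` therefore either stays within the radius, and is then
unique (`EscapeRadius.eq_of_backward`), or the distances to `b` of its points are eventually
successive `e`-th roots of each other (`EscapeRadius.dichotomy`). Unless `b` is fixed, some backward
orbit of `b` escapes (`EscapeRadius.exists_escaping`).

*Ramification.* Value groups of finite extensions of `K` are discrete, and a point fixed by the
inertia group of `L` has its distances to rational points in the value group of `L`
(`sphDist_mem_valueGroup_of_inertia`). The latter is the fact that the maximal unramified extension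
does not enlarge the value group; it is derived from the linear independence of characters of the
roots of unity of order prime to `p` (`exists_absv_eq_of_mem_adjoin_roots`). So a branch that
escapes from a rational point `b` is infinitely ramified (`isInfinitelyRamified_of_roots`).
Conversely, inertia moves points only within their residue discs, so a branch that eventually meets
only discs on which `f` is injective is not infinitely ramified (`frequently_two_le_ldeg`). An
infinitely ramified branch thus meets the disc of one of the finitely many critical points
infinitely often, which makes its reduction periodic (`TameMap.exists_residualPeriod`). All its
discs contain rational points, because `f` is defined over `K`. If the branch stayed within the
radius of contraction around one of these, it would agree with its conjugates; so it escapes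
(`TameMap.exists_roots`). The distances `δ n` of its points to the rational points satisfy
`δ n = δ (n + m) ^ e`. The index of the subgroup generated by `δ n` in the value group of `K(a n)` does not
increase when `n` grows by `m`, since `K(a (n + m)) / K(a n)` has degree at most `e`, and it becomes
stationary exactly when these extensions are totally ramified of degree `e`
(`TameMap.ramification`). The Weierstrass degree of `f ^ m` is the local degree
(`TameMap.hasLocalWeierstrassDegree`).

*Cycles.* The discs of an infinitely ramified branch form a cycle that contains a critical point,
and taking preimages of this point in the discs of the branch yields the pre-critical points and a
closed path in the incidence graph (`TameMap.exists_preCrit_orbit`, `TameMap.hasDirectedCycle`). In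
the other direction, walking along a directed cycle shows that some critical point `c` lies in a
periodic disc, up to Galois conjugation, which is eliminated by repeating the walk
(`TameMap.exists_crit_periodic`). If `c` is rational, then each rational point of its disc that the
return map does not fix is the base point of an escaping, hence infinitely ramified, branch
(`LocDeg.exists_infinitelyRamified`); as at most one point of the disc is fixed, there are such
points arbitrarily close to `c`.
-/

noncomputable section

set_option linter.unusedSectionVars false

namespace Arboreal

/-! ### The absolute value -/

section AbsoluteValue

variable (p : ℕ) [Fact p.Prime] {F : Type*} [Field F] [Algebra ℚ_[p] F]
  [Algebra.IsAlgebraic ℚ_[p] F]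

theorem absv_eq_zero {x : F} : absv p x = 0 ↔ x = 0 :=
  ⟨fun h => eq_zero_of_map_spectralNorm_eq_zero h (Algebra.IsAlgebraic.isAlgebraic x),
    fun h => h ▸ absv_zero p⟩

theorem absv_pos {x : F} (hx : x ≠ 0) : 0 < absv p x :=
  lt_of_le_of_ne (absv_nonneg p x) fun h => hx ((absv_eq_zero p).1 h.symm)

variable (F) in
/-- `absv` as a bundled absolute value. -/
def absVal : AbsoluteValue F ℝ where
  toFun := absv p
  map_mul' := absv_mul p
  nonneg' := absv_nonneg p
  eq_zero' _ := absv_eq_zero p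
  add_le' x y := (absv_add_le p x y).trans
    (max_le_add_of_nonneg (absv_nonneg p x) (absv_nonneg p y))

@[simp] theorem absVal_apply (x : F) : absVal p F x = absv p x := rfl

theorem isNonarchimedean_absVal : IsNonarchimedean (absVal p F) := absv_add_le p

theorem absv_pow (x : F) (n : ℕ) : absv p (x ^ n) = absv p x ^ n := map_pow (absVal p F) x n

theorem absv_div (x y : F) : absv p (x / y) = absv p x / absv p y := map_div₀ (absVal p F) x y

theorem absv_sub_comm (x y : F) : absv p (x - y) = absv p (y - x) := by
  rw [← absv_neg, neg_sub]

theorem absv_sub_le (x y : F) : absv p (x - y) ≤ max (absv p x) (absv p y) := by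
  rw [sub_eq_add_neg, ← absv_neg p y]; exact absv_add_le p x (-y)

theorem absv_add_lt {x y : F} {r : ℝ} (hx : absv p x < r) (hy : absv p y < r) :
    absv p (x + y) < r := (absv_add_le p x y).trans_lt (max_lt hx hy)

theorem absv_sub_lt {x y : F} {r : ℝ} (hx : absv p x < r) (hy : absv p y < r) :
    absv p (x - y) < r := (absv_sub_le p x y).trans_lt (max_lt hx hy)

theorem absv_add_eq_of_lt {x y : F} (h : absv p y < absv p x) : absv p (x + y) = absv p x := by
  refine le_antisymm ((absv_add_le p x y).trans (max_le le_rfl h.le)) ?_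
  by_contra! h'
  have := absv_sub_lt p h' h
  rw [add_sub_cancel_right] at this
  exact lt_irrefl _ this

theorem absv_sub_eq_of_lt {x y : F} (h : absv p y < absv p x) : absv p (x - y) = absv p x := by
  rw [sub_eq_add_neg]; exact absv_add_eq_of_lt p (by rwa [absv_neg])

theorem absv_sum_le {ι : Type*} (s : Finset ι) (g : ι → F) {r : ℝ} (hr : 0 ≤ r)
    (h : ∀ i ∈ s, absv p (g i) ≤ r) : absv p (∑ i ∈ s, g i) ≤ r := by
  classical
  induction s using Finset.induction_on with
  | empty => simpa [absv_zero] using hr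
  | insert a s ha ih =>
    rw [Finset.sum_insert ha]
    exact (absv_add_le p _ _).trans (max_le (h a (Finset.mem_insert_self a s))
      (ih fun i hi => h i (Finset.mem_insert_of_mem hi)))

theorem absv_sum_lt {ι : Type*} (s : Finset ι) (g : ι → F) {r : ℝ} (hr : 0 < r)
    (h : ∀ i ∈ s, absv p (g i) < r) : absv p (∑ i ∈ s, g i) < r := by
  classical
  induction s using Finset.induction_on with
  | empty => simpa [absv_zero] using hr
  | insert a s ha ih =>
    rw [Finset.sum_insert ha]
    exact absv_add_lt p (h a (Finset.mem_insert_self a s))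
      (ih fun i hi => h i (Finset.mem_insert_of_mem hi))

theorem absv_natCast_le_one (n : ℕ) : absv p (n : F) ≤ 1 := by
  induction n with
  | zero => simp [absv_zero]
  | succ n ih =>
    rw [Nat.cast_succ]
    exact (absv_add_le p _ _).trans (max_le ih (absv_one p).le)

theorem absv_padic (x : ℚ_[p]) : absv p (algebraMap ℚ_[p] F x) = ‖x‖ := spectralNorm_extends x

theorem absv_prime_lt_one : absv p (p : F) < 1 := by
  have := absv_padic (F := F) p (p : ℚ_[p])
  rw [map_natCast] at this
  rw [this]
  exact Padic.norm_p_lt_one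

theorem absv_prime_pos : 0 < absv p (p : F) := by
  have := absv_padic (F := F) p (p : ℚ_[p])
  rw [map_natCast] at this
  rw [this]
  exact norm_pos_iff.2 (by exact_mod_cast (Fact.out : p.Prime).ne_zero)

theorem absv_natCast_eq_one {n : ℕ} (hn : n.Coprime p) : absv p (n : F) = 1 := by
  have := absv_padic (F := F) p (n : ℚ_[p])
  rw [map_natCast] at this
  rw [this]
  exact Padic.norm_natCast_eq_one_iff.2 hn.symm

theorem absv_algebraMap {E : Type*} [Field E] [Algebra ℚ_[p] E] [Algebra F E]
    [IsScalarTower ℚ_[p] F E] (x : F) : absv p (algebraMap F E x) = absv p x :=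
  (spectralNorm.eq_of_tower x).symm

theorem absv_algEquiv (σ : F ≃ₐ[ℚ_[p]] F) (x : F) : absv p (σ x) = absv p x :=
  (spectralNorm_eq_of_equiv σ x).symm

/-- An algebraically closed `F` has elements of absolute value arbitrarily close to `1`. -/
theorem exists_absv_between [IsAlgClosed F] {r : ℝ} (hr : r < 1) :
    ∃ t : F, r < absv p t ∧ absv p t < 1 := by
  have h0 := absv_prime_pos (F := F) p
  have h1 := absv_prime_lt_one (F := F) p
  -- some `n`-th root of `p` has absolute value above `r`
  obtain ⟨n, hn⟩ : ∃ n : ℕ, 0 < n ∧ max r 0 ^ n < absv p (p : F) := by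
    obtain ⟨n, hn⟩ := exists_pow_lt_of_lt_one h0 (max_lt hr one_pos)
    rcases Nat.eq_zero_or_pos n with rfl | h
    · simp only [pow_zero] at hn; exact absurd hn (not_lt.2 h1.le)
    · exact ⟨n, h, hn⟩
  obtain ⟨t, ht⟩ := IsAlgClosed.exists_pow_nat_eq (p : F) hn.1
  have hp := absv_pow p t n
  rw [ht] at hp
  refine ⟨t, ?_, ?_⟩
  · by_contra! h
    have : absv p t ^ n ≤ max r 0 ^ n :=
      pow_le_pow_left₀ (absv_nonneg p t) (h.trans (le_max_left _ _)) n
    linarith [hn.2]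
  · by_contra! h
    have := one_le_pow₀ h (n := n)
    linarith

/-- An algebraically closed `F` has infinitely many absolute values below `1` and close to `1`. -/
theorem exists_absv_between_notMem [IsAlgClosed F] (s : Finset ℝ) {r : ℝ} (hr : r < 1) :
    ∃ t : F, r < absv p t ∧ absv p t < 1 ∧ absv p t ∉ s := by
  classical
  induction s using Finset.induction_on generalizing r with
  | empty =>
    obtain ⟨t, h1, h2⟩ := exists_absv_between (F := F) p hr
    exact ⟨t, h1, h2, by simp⟩
  | insert a s ha ih =>
    by_cases h : a < 1
    · obtain ⟨t, h1, h2, h3⟩ := ih (max_lt hr h)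
      refine ⟨t, (le_max_left _ _).trans_lt h1, h2, ?_⟩
      rw [Finset.mem_insert, not_or]
      exact ⟨((le_max_right _ _).trans_lt h1).ne', h3⟩
    · obtain ⟨t, h1, h2, h3⟩ := ih hr
      refine ⟨t, h1, h2, ?_⟩
      rw [Finset.mem_insert, not_or]
      exact ⟨(h2.trans_le (not_lt.1 h)).ne, h3⟩

end AbsoluteValue

/-! ### The spherical distance -/

section Sphere

variable (p : ℕ) [Fact p.Prime] {F : Type*} [Field F] [Algebra ℚ_[p] F]

/-- The first homogeneous coordinate. -/
def hx : OnePoint F → F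
  | OnePoint.infty => 1
  | OnePoint.some x => x

/-- The second homogeneous coordinate, `0` at infinity and `1` elsewhere. -/
def hy : OnePoint F → F
  | OnePoint.infty => 0
  | OnePoint.some _ => 1

/-- The norm of the vector `(hx x, hy x)` of homogeneous coordinates. -/
def hnorm (x : OnePoint F) : ℝ := max (absv p (hy x)) (absv p (hx x))

@[simp] theorem hx_some (x : F) : hx (OnePoint.some x) = x := rfl
@[simp] theorem hy_some (x : F) : hy (OnePoint.some x) = 1 := rfl
@[simp] theorem hx_infty : hx (OnePoint.infty : OnePoint F) = 1 := rfl
@[simp] theorem hy_infty : hy (OnePoint.infty : OnePoint F) = 0 := rfl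

theorem hnorm_some (x : F) : hnorm p (OnePoint.some x) = max 1 (absv p x) := by
  simp [hnorm, absv_one]

theorem hnorm_infty : hnorm p (OnePoint.infty : OnePoint F) = 1 := by
  simp [hnorm, absv_one, absv_zero]

theorem one_le_hnorm (x : OnePoint F) : 1 ≤ hnorm p x := by
  induction x using OnePoint.rec with
  | infty => rw [hnorm_infty]
  | coe x => rw [hnorm_some]; exact le_max_left _ _

theorem hnorm_pos (x : OnePoint F) : 0 < hnorm p x := one_pos.trans_le (one_le_hnorm p x)

variable [Algebra.IsAlgebraic ℚ_[p] F]

theorem sphDist_eq (x y : OnePoint F) :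
    sphDist p x y = absv p (hx x * hy y - hx y * hy x) / (hnorm p x * hnorm p y) := by
  induction x using OnePoint.rec <;> induction y using OnePoint.rec <;>
    simp only [sphDist, hnorm_infty, hnorm_some, hx_some, hx_infty, hy_some, hy_infty] <;>
    simp [absv_zero, absv_one, absv_neg]

theorem sphDist_nonneg (x y : OnePoint F) : 0 ≤ sphDist p x y := by
  rw [sphDist_eq]
  exact div_nonneg (absv_nonneg p _) (mul_pos (hnorm_pos p x) (hnorm_pos p y)).le

theorem sphDist_comm (x y : OnePoint F) : sphDist p x y = sphDist p y x := by
  rw [sphDist_eq, sphDist_eq, absv_sub_comm, mul_comm (hnorm p x)]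

@[simp] theorem sphDist_self (x : OnePoint F) : sphDist p x x = 0 := by
  rw [sphDist_eq, sub_self, absv_zero, zero_div]

theorem sphDist_eq_zero {x y : OnePoint F} : sphDist p x y = 0 ↔ x = y := by
  refine ⟨fun h => ?_, fun h => h ▸ sphDist_self p x⟩
  rw [sphDist_eq, div_eq_zero_iff, absv_eq_zero] at h
  rcases h with h | h
  · induction x using OnePoint.rec <;> induction y using OnePoint.rec <;> simp at h ⊢
    exact sub_eq_zero.1 h
  · exact absurd h (mul_pos (hnorm_pos p x) (hnorm_pos p y)).ne'

theorem sphDist_pos {x y : OnePoint F} (h : x ≠ y) : 0 < sphDist p x y :=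
  lt_of_le_of_ne (sphDist_nonneg p x y) fun h' => h ((sphDist_eq_zero p).1 h'.symm)

theorem absv_hx_le (x : OnePoint F) : absv p (hx x) ≤ hnorm p x := le_max_right _ _
theorem absv_hy_le (x : OnePoint F) : absv p (hy x) ≤ hnorm p x := le_max_left _ _

theorem sphDist_le_one (x y : OnePoint F) : sphDist p x y ≤ 1 := by
  rw [sphDist_eq, div_le_one (mul_pos (hnorm_pos p x) (hnorm_pos p y))]
  refine (absv_sub_le p _ _).trans (max_le ?_ ?_) <;> rw [absv_mul]
  · exact mul_le_mul (absv_hx_le p x) (absv_hy_le p y) (absv_nonneg p _) (hnorm_pos p x).le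
  · rw [mul_comm (hnorm p x)]
    exact mul_le_mul (absv_hx_le p y) (absv_hy_le p x) (absv_nonneg p _) (hnorm_pos p y).le

/-- The strong triangle inequality, by the Plücker relation between three vectors of the plane. -/
theorem sphDist_tri (x y z : OnePoint F) :
    sphDist p x z ≤ max (sphDist p x y) (sphDist p y z) := by
  have hX := hnorm_pos p x
  have hY := hnorm_pos p y
  have hZ := hnorm_pos p z
  -- multiply by the coordinate of `y` of largest absolute value
  have key : ∀ c : F, absv p c = hnorm p y →
      (∃ a b : F, absv p a ≤ hnorm p x ∧ absv p b ≤ hnorm p z ∧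
      c * (hx x * hy z - hx z * hy x) =
        a * (hx y * hy z - hx z * hy y) + b * (hx x * hy y - hx y * hy x)) →
      sphDist p x z ≤ max (sphDist p x y) (sphDist p y z) := by
    rintro c hc ⟨a, b, ha, hb, h⟩
    have h1 : absv p (c * (hx x * hy z - hx z * hy x)) ≤
        max (hnorm p x * (sphDist p y z * (hnorm p y * hnorm p z)))
          (hnorm p z * (sphDist p x y * (hnorm p x * hnorm p y))) := by
      rw [h]
      refine (absv_add_le p _ _).trans (max_le_max ?_ ?_) <;> rw [absv_mul, sphDist_eq,
        div_mul_cancel₀ _ (by positivity)]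
      · exact mul_le_mul_of_nonneg_right ha (absv_nonneg p _)
      · exact mul_le_mul_of_nonneg_right hb (absv_nonneg p _)
    rw [absv_mul, hc] at h1
    rw [sphDist_eq p x z, div_le_iff₀ (by positivity)]
    refine le_of_mul_le_mul_left (h1.trans (le_of_eq ?_)) hY
    rw [max_comm, max_mul_of_nonneg _ _ (by positivity : 0 ≤ hnorm p x * hnorm p z),
      mul_max_of_nonneg _ _ hY.le]
    congr 1 <;> ring
  rcases le_total (absv p (hy y)) (absv p (hx y)) with h | h
  · exact key (hx y) (max_eq_right h).symm ⟨hx x, hx z, absv_hx_le p x, absv_hx_le p z, by ring⟩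
  · exact key (hy y) (max_eq_left h).symm ⟨hy x, hy z, absv_hy_le p x, absv_hy_le p z, by ring⟩

theorem sphDist_lt_trans {x y z : OnePoint F} {r : ℝ} (h1 : sphDist p x y < r)
    (h2 : sphDist p y z < r) : sphDist p x z < r :=
  (sphDist_tri p x y z).trans_lt (max_lt h1 h2)

theorem sphDist_le_trans {x y z : OnePoint F} {r : ℝ} (h1 : sphDist p x y ≤ r)
    (h2 : sphDist p y z ≤ r) : sphDist p x z ≤ r :=
  (sphDist_tri p x y z).trans (max_le h1 h2)

theorem sphDist_eq_of_lt {x y z : OnePoint F} (h : sphDist p y z < sphDist p x y) :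
    sphDist p x z = sphDist p x y := by
  refine le_antisymm ((sphDist_tri p x y z).trans (max_le le_rfl h.le)) ?_
  by_contra! h'
  have := sphDist_lt_trans p h' (sphDist_comm p y z ▸ h)
  exact lt_irrefl _ this

/-- Two points lie in the same residue disc, that is, at spherical distance less than `1`. -/
def SameDisc (x y : OnePoint F) : Prop := sphDist p x y < 1

variable {p}

theorem SameDisc.refl (x : OnePoint F) : SameDisc p x x := by simp [SameDisc]
theorem SameDisc.symm {x y : OnePoint F} (h : SameDisc p x y) : SameDisc p y x := by
  rwa [SameDisc, sphDist_comm]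
theorem SameDisc.trans {x y z : OnePoint F} (h : SameDisc p x y) (h' : SameDisc p y z) :
    SameDisc p x z := sphDist_lt_trans p h h'

theorem sphDist_eq_one_of_not {x y : OnePoint F} (h : ¬ SameDisc p x y) : sphDist p x y = 1 :=
  le_antisymm (sphDist_le_one p x y) (not_lt.1 h)

variable (p)

theorem sphDist_some_some {x y : F} (hx : absv p x ≤ 1) (hy : absv p y ≤ 1) :
    sphDist p (OnePoint.some x) (OnePoint.some y) = absv p (x - y) := by
  simp [sphDist, hx, hy]

theorem residue_eq_zero_iff (x : intRing p F) :
    IsLocalRing.residue (intRing p F) x = 0 ↔ absv p (x : F) < 1 := by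
  rw [IsLocalRing.residue_eq_zero_iff, IsLocalRing.mem_maximalIdeal, mem_nonunits_iff,
    ← not_iff_not, not_not, not_lt]
  constructor
  · intro h
    obtain ⟨z, hz⟩ := h.exists_right_inv
    have h0 : (x : F) * (z : F) = 1 := congrArg Subtype.val hz
    have h1 : absv p (x : F) * absv p (z : F) = 1 := by rw [← absv_mul, h0, absv_one]
    have h2 : absv p (z : F) ≤ 1 := z.2
    nlinarith [absv_nonneg p (x : F)]
  · intro h
    have hne : (x : F) ≠ 0 := fun h0 => by rw [h0, absv_zero] at h; linarith
    have hi : (x : F)⁻¹ ∈ intRing p F := by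
      change absv p (x : F)⁻¹ ≤ 1
      rw [absv_inv]; exact inv_le_one_of_one_le₀ h
    exact IsUnit.of_mul_eq_one ⟨(x : F)⁻¹, hi⟩ (Subtype.ext (mul_inv_cancel₀ hne))

theorem red_eq_iff (x y : OnePoint F) : red p x = red p y ↔ SameDisc p x y := by
  have key : ∀ x : F, 1 < absv p x → x ∉ intRing p F := fun x hx h => not_lt.2 h hx
  have key' : ∀ x : F, absv p x ≤ 1 → x ∈ intRing p F := fun x hx => hx
  have far : ∀ x : F, SameDisc p (OnePoint.infty : OnePoint F) (OnePoint.some x) ↔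
      1 < absv p x := by
    intro x
    change 1 / max 1 (absv p x) < 1 ↔ _
    rw [div_lt_one (by positivity)]
    simp
  have ifar : ∀ x : F, red p (OnePoint.infty : OnePoint F) = red p (OnePoint.some x) ↔
      1 < absv p x := by
    intro x
    by_cases h : 1 < absv p x
    · simp [red, h, key x h]
    · simp [red, h, key' x (not_lt.1 h)]
  induction x using OnePoint.rec with
  | infty =>
    induction y using OnePoint.rec with
    | infty => simp [SameDisc.refl]
    | coe y => rw [far, ifar]
  | coe x =>
    induction y using OnePoint.rec with
    | infty => rw [eq_comm, ifar, ← far]; exact ⟨SameDisc.symm, SameDisc.symm⟩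
    | coe y =>
      by_cases hX : 1 < absv p x
      · have e := (ifar x).2 hX
        have e' := (far x).2 hX
        change red p (OnePoint.some x) = _ ↔ SameDisc p (OnePoint.some x) _
        rw [← e, ifar, ← far]
        exact ⟨fun h => e'.symm.trans h, fun h => e'.trans h⟩
      by_cases hY : 1 < absv p y
      · have e := (ifar y).2 hY
        have e' := (far y).2 hY
        change _ = red p (OnePoint.some y) ↔ SameDisc p _ (OnePoint.some y)
        rw [← e, eq_comm]
        refine (ifar x).trans ((far x).symm.trans ?_)
        exact ⟨fun h => h.symm.trans e', fun h => (h.trans e'.symm).symm⟩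
      rw [not_lt] at hX hY
      rw [SameDisc, sphDist_some_some p hX hY]
      simp only [red, key' x hX, key' y hY, dif_pos]
      rw [OnePoint.some_eq_iff, ← sub_eq_zero, ← map_sub, residue_eq_zero_iff]
      rfl

open Classical in
/-- The involution `x ↦ 1 / x` of the projective line. -/
def pinv : OnePoint F → OnePoint F
  | OnePoint.infty => OnePoint.some 0
  | OnePoint.some x => if x = 0 then OnePoint.infty else OnePoint.some x⁻¹

theorem pinv_infty : pinv (OnePoint.infty : OnePoint F) = OnePoint.some 0 := rfl
theorem pinv_zero : pinv (OnePoint.some (0 : F)) = OnePoint.infty := if_pos rfl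
theorem pinv_some {x : F} (h : x ≠ 0) : pinv (OnePoint.some x) = OnePoint.some x⁻¹ := if_neg h

theorem pinv_pinv (x : OnePoint F) : pinv (pinv x) = x := by
  induction x using OnePoint.rec with
  | infty => rw [pinv_infty, pinv_zero]
  | coe x =>
    rcases eq_or_ne x 0 with rfl | h
    · exact (congrArg pinv pinv_zero).trans pinv_infty
    · exact (congrArg pinv (pinv_some h)).trans
        ((pinv_some (inv_ne_zero h)).trans (by rw [inv_inv]))

theorem exists_pinv_coords (x : OnePoint F) : ∃ c : F, c ≠ 0 ∧ hx (pinv x) = c * hy x ∧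
    hy (pinv x) = c * hx x := by
  induction x using OnePoint.rec with
  | infty => exact ⟨1, one_ne_zero, by simp [pinv_infty], by simp [pinv_infty]⟩
  | coe x =>
    by_cases h : x = 0
    · subst h
      refine ⟨1, one_ne_zero, ?_, ?_⟩
      · exact (congrArg hx pinv_zero).trans (by simp)
      · exact (congrArg hy pinv_zero).trans (by simp)
    · refine ⟨x⁻¹, inv_ne_zero h, ?_, ?_⟩
      · exact (congrArg hx (pinv_some h)).trans (by simp)
      · exact (congrArg hy (pinv_some h)).trans (by simp [h])

theorem sphDist_pinv_pinv (x y : OnePoint F) : sphDist p (pinv x) (pinv y) = sphDist p x y := by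
  obtain ⟨c, hc, h1, h2⟩ := exists_pinv_coords x
  obtain ⟨d, hd, h3, h4⟩ := exists_pinv_coords y
  have hn : hnorm p (pinv x) = absv p c * hnorm p x := by
    rw [hnorm, hnorm, h1, h2, absv_mul, absv_mul,
      ← mul_max_of_nonneg _ _ (absv_nonneg p c), max_comm]
  have hn' : hnorm p (pinv y) = absv p d * hnorm p y := by
    rw [hnorm, hnorm, h3, h4, absv_mul, absv_mul,
      ← mul_max_of_nonneg _ _ (absv_nonneg p d), max_comm]
  have hc' := absv_pos p hc
  have hd' := absv_pos p hd
  have hX := hnorm_pos p x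
  have hY := hnorm_pos p y
  rw [sphDist_eq, sphDist_eq, hn, hn', h1, h2, h3, h4,
    show c * hy x * (d * hx y) - d * hy y * (c * hx x) =
      -(c * d * (hx x * hy y - hx y * hy x)) by ring, absv_neg, absv_mul, absv_mul]
  field_simp

/-- Up to inversion, every point is integral. -/
theorem integral_or_pinv_integral (x : OnePoint F) : (∃ a : F, absv p a ≤ 1 ∧ x = OnePoint.some a) ∨
    ∃ a : F, absv p a < 1 ∧ x = pinv (OnePoint.some a) := by
  induction x using OnePoint.rec with
  | infty => exact Or.inr ⟨0, by simp [absv_zero], pinv_zero.symm⟩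
  | coe x =>
    rcases le_or_gt (absv p x) 1 with h | h
    · exact Or.inl ⟨x, h, rfl⟩
    · have h0 : x ≠ 0 := fun h0 => by rw [h0, absv_zero] at h; linarith
      refine Or.inr ⟨x⁻¹, ?_, ?_⟩
      · rw [absv_inv]; exact inv_lt_one_of_one_lt₀ h
      · rw [pinv_some (inv_ne_zero h0), inv_inv]

/-- Every residue disc contains points at distance arbitrarily close to `1` from its center. -/
theorem exists_sphDist_between [IsAlgClosed F] (x : OnePoint F) {r : ℝ} (hr : r < 1) :
    ∃ y, r < sphDist p x y ∧ sphDist p x y < 1 := by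
  have key : ∀ a : F, absv p a ≤ 1 →
      ∃ y, r < sphDist p (OnePoint.some a) y ∧ sphDist p (OnePoint.some a) y < 1 := by
    intro a ha
    obtain ⟨t, h1, h2⟩ := exists_absv_between (F := F) p hr
    refine ⟨OnePoint.some (a - t), ?_⟩
    rw [sphDist_some_some p ha ((absv_sub_le p _ _).trans (max_le ha h2.le)), sub_sub_cancel]
    exact ⟨h1, h2⟩
  rcases integral_or_pinv_integral p x with ⟨a, ha, rfl⟩ | ⟨a, ha, rfl⟩
  · exact key a ha
  · obtain ⟨y, h⟩ := key a ha.le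
    exact ⟨pinv y, by rwa [sphDist_pinv_pinv]⟩

end Sphere

/-! ### Local degrees on residue discs -/

section LocalDegree

variable (p : ℕ) [Fact p.Prime] {F : Type*} [Field F] [Algebra ℚ_[p] F]
  [Algebra.IsAlgebraic ℚ_[p] F]

/-- The product of the distances from `y` to the points of `Z`. -/
def distProd (Z : Multiset (OnePoint F)) (y : OnePoint F) : ℝ := (Z.map (sphDist p y)).prod

@[simp] theorem distProd_zero (y : OnePoint F) : distProd p 0 y = 1 := by simp [distProd]

@[simp] theorem distProd_cons (z : OnePoint F) (Z : Multiset (OnePoint F)) (y : OnePoint F) :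
    distProd p (z ::ₘ Z) y = sphDist p y z * distProd p Z y := by simp [distProd]

theorem distProd_nonneg (Z : Multiset (OnePoint F)) (y : OnePoint F) : 0 ≤ distProd p Z y := by
  induction Z using Multiset.induction_on with
  | empty => simp
  | cons z Z ih => rw [distProd_cons]; exact mul_nonneg (sphDist_nonneg p y z) ih

theorem distProd_le_one (Z : Multiset (OnePoint F)) (y : OnePoint F) : distProd p Z y ≤ 1 := by
  induction Z using Multiset.induction_on with
  | empty => simp
  | cons z Z ih =>
    rw [distProd_cons]; exact mul_le_one₀ (sphDist_le_one p y z) (distProd_nonneg p Z y) ih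

theorem distProd_le_of_mem {Z : Multiset (OnePoint F)} {z : OnePoint F} (hz : z ∈ Z)
    (y : OnePoint F) : distProd p Z y ≤ sphDist p y z := by
  obtain ⟨Z', rfl⟩ := Multiset.exists_cons_of_mem hz
  rw [distProd_cons]
  exact mul_le_of_le_one_right (sphDist_nonneg p y z) (distProd_le_one p Z' y)

theorem distProd_eq_zero_iff {Z : Multiset (OnePoint F)} {y : OnePoint F} :
    distProd p Z y = 0 ↔ y ∈ Z := by
  induction Z using Multiset.induction_on with
  | empty => simp
  | cons z Z ih => rw [distProd_cons, mul_eq_zero, ih, sphDist_eq_zero, Multiset.mem_cons]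

theorem distProd_eq_pow {Z : Multiset (OnePoint F)} {y : OnePoint F} {r : ℝ}
    (h : ∀ z ∈ Z, sphDist p y z = r) : distProd p Z y = r ^ Z.card := by
  rw [distProd, Multiset.map_congr rfl h, Multiset.map_const', Multiset.prod_replicate]

theorem distProd_le_pow {Z : Multiset (OnePoint F)} {y : OnePoint F} {r : ℝ}
    (h : ∀ z ∈ Z, sphDist p y z ≤ r) : distProd p Z y ≤ r ^ Z.card := by
  induction Z using Multiset.induction_on with
  | empty => simp
  | cons z Z ih =>
    have hz := h z (Multiset.mem_cons_self z Z)
    rw [distProd_cons, Multiset.card_cons, pow_succ']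
    exact mul_le_mul hz (ih fun z' hz' => h z' (Multiset.mem_cons_of_mem hz'))
      (distProd_nonneg p Z y) ((sphDist_nonneg p y z).trans hz)

open Classical in
/-- The points of `Z` outside the residue disc of `y` do not contribute to `distProd p Z y`. -/
theorem distProd_filter (Z : Multiset (OnePoint F)) {x y : OnePoint F} (hy : SameDisc p y x) :
    distProd p (Z.filter fun z => SameDisc p z x) y = distProd p Z y := by
  induction Z using Multiset.induction_on with
  | empty => simp
  | cons z Z ih =>
    by_cases hz : SameDisc p z x
    · rw [Multiset.filter_cons_of_pos (p := fun z => SameDisc p z x) Z hz, distProd_cons,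
        distProd_cons, ih]
    · rw [Multiset.filter_cons_of_neg (p := fun z => SameDisc p z x) Z hz, distProd_cons, ih,
        sphDist_eq_one_of_not fun h => hz (h.symm.trans hy), one_mul]

theorem exists_lt_one_bound (Z : Multiset (OnePoint F)) (x : OnePoint F)
    (h : ∀ z ∈ Z, SameDisc p z x) : ∃ r : ℝ, 0 ≤ r ∧ r < 1 ∧ ∀ z ∈ Z, sphDist p x z ≤ r := by
  induction Z using Multiset.induction_on with
  | empty => exact ⟨0, le_rfl, one_pos, by simp⟩
  | cons z Z ih =>
    obtain ⟨r, h0, h1, h2⟩ := ih fun z' hz' => h z' (Multiset.mem_cons_of_mem hz')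
    refine ⟨max r (sphDist p x z), le_max_of_le_left h0,
      max_lt h1 (h z (Multiset.mem_cons_self z Z)).symm, fun z' hz' => ?_⟩
    rcases Multiset.mem_cons.1 hz' with rfl | hz'
    · exact le_max_right _ _
    · exact (h2 z' hz').trans (le_max_left _ _)

theorem distProd_eq_pow_of_lt {Z : Multiset (OnePoint F)} {x y : OnePoint F} {r : ℝ}
    (h : ∀ z ∈ Z, sphDist p x z ≤ r) (hy : r < sphDist p y x) :
    distProd p Z y = sphDist p y x ^ Z.card :=
  distProd_eq_pow p fun z hz => sphDist_eq_of_lt p ((h z hz).trans_lt hy)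

theorem exists_lt_one_pow_ge {s : ℝ} (h0 : 0 ≤ s) (h1 : s < 1) {n : ℕ} (hn : n ≠ 0) :
    ∃ r : ℝ, 0 ≤ r ∧ r < 1 ∧ s ≤ r ^ n :=
  ⟨s ^ (n⁻¹ : ℝ), Real.rpow_nonneg h0 _, Real.rpow_lt_one h0 h1 (by positivity),
    (Real.rpow_inv_natCast_pow h0 hn).ge⟩

/-- A self-map `f` of the projective line is a good map of degree `d` if the distance from `f y` to
any point `w` is the product of the distances from `y` to `d` points, the preimages of `w` with
multiplicities. It is the property of rational maps with good reduction on which their metric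
dynamics depends. -/
def GoodMap (f : OnePoint F → OnePoint F) (d : ℕ) : Prop :=
  ∀ w, ∃ Z : Multiset (OnePoint F), Z.card = d ∧ ∀ y, sphDist p (f y) w = distProd p Z y

/-- The map `h` has local degree `e` on the residue disc of `x`: on it, the distance from `h y` to a
point `w` in the residue disc of `h x` is the product of the distances from `y` to `e` points of
the residue disc of `x`. -/
def LocDeg (h : OnePoint F → OnePoint F) (x : OnePoint F) (e : ℕ) : Prop :=
  ∀ w, SameDisc p w (h x) → ∃ Z : Multiset (OnePoint F), Z.card = e ∧
    (∀ z ∈ Z, SameDisc p z x) ∧ ∀ y, SameDisc p y x → sphDist p (h y) w = distProd p Z y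

variable {p} {f g h : OnePoint F → OnePoint F} {d e e' : ℕ} {x y z w : OnePoint F}

theorem GoodMap.sphDist_le (hf : GoodMap p f d) (x y : OnePoint F) :
    sphDist p (f x) (f y) ≤ sphDist p x y := by
  obtain ⟨Z, -, hZ⟩ := hf (f y)
  have hy : y ∈ Z := by rw [← distProd_eq_zero_iff p, ← hZ, sphDist_self]
  rw [hZ]
  exact distProd_le_of_mem p hy x

theorem GoodMap.sameDisc (hf : GoodMap p f d) (hxy : SameDisc p x y) : SameDisc p (f x) (f y) :=
  (hf.sphDist_le x y).trans_lt hxy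

theorem GoodMap.sameDisc_iterate (hf : GoodMap p f d) (n : ℕ) (hxy : SameDisc p x y) :
    SameDisc p (f^[n] x) (f^[n] y) := by
  induction n with
  | zero => exact hxy
  | succ n ih =>
    rw [Function.iterate_succ_apply', Function.iterate_succ_apply']
    exact hf.sameDisc ih

theorem LocDeg.sameDisc (hh : LocDeg p h x e) (hy : SameDisc p y x) : SameDisc p (h y) (h x) := by
  obtain ⟨Z, -, -, hZ'⟩ := hh (h x) (SameDisc.refl _)
  have hx : x ∈ Z := by
    rw [← distProd_eq_zero_iff p, ← hZ' x (SameDisc.refl _), sphDist_self]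
  rw [SameDisc, hZ' y hy]
  exact (distProd_le_of_mem p hx y).trans_lt hy

theorem LocDeg.congr (hh : LocDeg p h x e) (hy : SameDisc p y x) : LocDeg p h y e := by
  intro w hw
  obtain ⟨Z, h1, h2, h3⟩ := hh w (hw.trans (hh.sameDisc hy))
  exact ⟨Z, h1, fun z hz => (h2 z hz).trans hy.symm, fun u hu => h3 u (hu.trans hy)⟩

theorem LocDeg.pos (hh : LocDeg p h x e) : 1 ≤ e := by
  obtain ⟨Z, h1, -, hZ'⟩ := hh (h x) (SameDisc.refl _)
  have hx : x ∈ Z := by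
    rw [← distProd_eq_zero_iff p, ← hZ' x (SameDisc.refl _), sphDist_self]
  rw [← h1]
  exact Multiset.card_pos_iff_exists_mem.2 ⟨x, hx⟩

theorem LocDeg.exists_preimage (hh : LocDeg p h x e) (hw : SameDisc p w (h x)) :
    ∃ z, SameDisc p z x ∧ h z = w := by
  obtain ⟨Z, h1, h2, h3⟩ := hh w hw
  obtain ⟨z, hz⟩ := Multiset.card_pos_iff_exists_mem.1 (h1 ▸ hh.pos)
  refine ⟨z, h2 z hz, ?_⟩
  rw [← sphDist_eq_zero p, h3 z (h2 z hz), distProd_eq_zero_iff]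
  exact hz

/-- A map of local degree `1` is injective on the residue disc. -/
theorem LocDeg.injective_of_one (hh : LocDeg p h x 1) (hy : SameDisc p y x) (hz : SameDisc p z x)
    (hyz : h y = h z) : y = z := by
  obtain ⟨Z, h1, -, h3⟩ := hh (h z) (hh.sameDisc hz)
  obtain ⟨u, rfl⟩ := Multiset.card_eq_one.1 h1
  have hy' : y ∈ ({u} : Multiset (OnePoint F)) := by
    rw [← distProd_eq_zero_iff p, ← h3 y hy, hyz, sphDist_self]
  have hz' : z ∈ ({u} : Multiset (OnePoint F)) := by
    rw [← distProd_eq_zero_iff p, ← h3 z hz, sphDist_self]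
  rw [Multiset.mem_singleton.1 hy', Multiset.mem_singleton.1 hz']

theorem LocDeg.fiber_subset (hh : LocDeg p h x e) (hw : SameDisc p w (h x)) :
    ∃ Z : Multiset (OnePoint F), Z.card = e ∧ ∀ y, SameDisc p y x → h y = w → y ∈ Z := by
  obtain ⟨Z, h1, -, h3⟩ := hh w hw
  refine ⟨Z, h1, fun y hy hyw => ?_⟩
  rw [← distProd_eq_zero_iff p, ← h3 y hy, hyw, sphDist_self]

theorem pow_eq_pow_of_lt_one {r : ℝ} (h0 : 0 < r) (h1 : r < 1) (h : r ^ e = r ^ e') : e = e' := by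
  rcases lt_trichotomy e e' with h' | h' | h'
  · exact absurd h (pow_lt_pow_right_of_lt_one₀ h0 h1 h').ne'
  · exact h'
  · exact absurd h (pow_lt_pow_right_of_lt_one₀ h0 h1 h').ne

variable [IsAlgClosed F]

/-- The local degree can be read off from points close to the boundary of the residue disc. -/
theorem LocDeg.unique (h1 : LocDeg p h x e) (h2 : LocDeg p h x e') : e = e' := by
  obtain ⟨Z, rfl, a2, a3⟩ := h1 (h x) (SameDisc.refl _)
  obtain ⟨Z', rfl, b2, b3⟩ := h2 (h x) (SameDisc.refl _)
  obtain ⟨r, r0, r1, r2⟩ := exists_lt_one_bound p (Z + Z') x fun z hz =>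
    (Multiset.mem_add.1 hz).elim (a2 z) (b2 z)
  obtain ⟨y, hy1, hy2⟩ := exists_sphDist_between p x r1
  rw [sphDist_comm] at hy1 hy2
  have := (a3 y hy2).symm.trans (b3 y hy2)
  rw [distProd_eq_pow_of_lt p (fun z hz => r2 z (Multiset.mem_add.2 (Or.inl hz))) hy1,
    distProd_eq_pow_of_lt p (fun z hz => r2 z (Multiset.mem_add.2 (Or.inr hz))) hy1] at this
  exact pow_eq_pow_of_lt_one (r0.trans_lt hy1) hy2 this

open Classical in
/-- The local degree on a residue disc is the number of preimages, in this disc, of one point of the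
image disc. It has to be shown that all points of the image disc have equally many. -/
theorem GoodMap.locDeg_filter (hf : GoodMap p f d) (x : OnePoint F)
    {Z : Multiset (OnePoint F)}
    (hZ' : ∀ y, sphDist p (f y) (f x) = distProd p Z y) :
    LocDeg p f x (Z.filter fun z => SameDisc p z x).card := by
  intro w hw
  obtain ⟨Z₁, c1, c2⟩ := hf w
  refine ⟨Z₁.filter fun z => SameDisc p z x, ?_, fun z hz => (Multiset.mem_filter.1 hz).2,
    fun y hy => (c2 y).trans (distProd_filter p Z₁ hy).symm⟩
  obtain ⟨r, r0, r1, r2⟩ := exists_lt_one_bound p ((Z₁.filter fun z => SameDisc p z x) +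
    Z.filter fun z => SameDisc p z x) x fun z hz =>
    (Multiset.mem_add.1 hz).elim (fun h => (Multiset.mem_filter.1 h).2)
      (fun h => (Multiset.mem_filter.1 h).2)
  -- compare the two products at a point so close to the boundary that its image is farther from
  -- `w` and `f x` than these are from each other
  obtain ⟨s, s0, s1, s2⟩ := exists_lt_one_pow_ge (sphDist_nonneg p w (f x)) hw (Nat.succ_ne_zero d)
  obtain ⟨y, hy1, hy2⟩ := exists_sphDist_between p x (max_lt r1 s1)
  rw [sphDist_comm] at hy1 hy2
  have hr := (le_max_left r s).trans_lt hy1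
  have hs := (le_max_right r s).trans_lt hy1
  have hy0 := r0.trans_lt hr
  have e1 := c2 y
  rw [← distProd_filter p Z₁ hy2,
    distProd_eq_pow_of_lt p (fun z hz => r2 z (Multiset.mem_add.2 (Or.inl hz))) hr] at e1
  have e2 := hZ' y
  rw [← distProd_filter p Z hy2,
    distProd_eq_pow_of_lt p (fun z hz => r2 z (Multiset.mem_add.2 (Or.inr hz))) hr] at e2
  have hlt : sphDist p w (f x) < sphDist p (f y) w := by
    rw [e1]
    calc sphDist p w (f x) ≤ s ^ (d + 1) := s2
      _ < sphDist p y x ^ (d + 1) := pow_lt_pow_left₀ hs s0 (Nat.succ_ne_zero d)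
      _ ≤ _ := pow_le_pow_of_le_one hy0.le hy2.le
        ((Multiset.card_le_card (Multiset.filter_le _ _)).trans (by omega))
  have := sphDist_eq_of_lt p hlt
  rw [e1, e2] at this
  exact (pow_eq_pow_of_lt_one hy0 hy2 this).symm

open Classical in
theorem GoodMap.exists_locDeg (hf : GoodMap p f d) (x : OnePoint F) :
    ∃ e, e ≤ d ∧ LocDeg p f x e := by
  obtain ⟨Z, h1, h2⟩ := hf (f x)
  exact ⟨_, h1 ▸ Multiset.card_le_card (Multiset.filter_le _ _), hf.locDeg_filter x h2⟩

/-- The chain rule: local degrees of composed maps multiply. -/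
theorem LocDeg.comp (hh : LocDeg p h x e) (hg : LocDeg p g (h x) e') :
    LocDeg p (g ∘ h) x (e' * e) := by
  classical
  intro w hw
  obtain ⟨Z, h1, h2, h3⟩ := hg w hw
  choose! φ a1 a2 a3 using hh
  refine ⟨Z.bind φ, ?_, ?_, ?_⟩
  · rw [Multiset.card_bind, Multiset.map_congr rfl (f := Multiset.card ∘ φ) (g := fun _ => e)
      fun z hz => a1 z (h2 z hz),
      Multiset.map_const', Multiset.sum_replicate, h1, smul_eq_mul]
  · intro z hz
    obtain ⟨z', hz', hz⟩ := Multiset.mem_bind.1 hz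
    exact a2 z' (h2 z' hz') z hz
  · intro y hy
    have hyx : SameDisc p (h y) (h x) := by
      have e1 := a3 (h x) (SameDisc.refl _) x (SameDisc.refl _)
      rw [sphDist_self, eq_comm, distProd_eq_zero_iff] at e1
      rw [SameDisc, a3 (h x) (SameDisc.refl _) y hy]
      exact (distProd_le_of_mem p e1 y).trans_lt hy
    rw [Function.comp_apply, h3 _ hyx, distProd, distProd, Multiset.map_bind, Multiset.prod_bind]
    exact congrArg Multiset.prod (Multiset.map_congr rfl fun z hz => a3 z (h2 z hz) y hy)

variable (p) in
open Classical in
/-- The local degree of `f` on the residue disc of `x`. -/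
def ldeg (f : OnePoint F → OnePoint F) (x : OnePoint F) : ℕ :=
  if h : ∃ e, LocDeg p f x e then h.choose else 0

theorem GoodMap.ldeg_spec (hf : GoodMap p f d) (x : OnePoint F) : LocDeg p f x (ldeg p f x) := by
  obtain ⟨e, -, he⟩ := hf.exists_locDeg x
  have h : ∃ e, LocDeg p f x e := ⟨e, he⟩
  rw [ldeg, dif_pos h]
  exact h.choose_spec

theorem GoodMap.ldeg_pos (hf : GoodMap p f d) (x : OnePoint F) : 0 < ldeg p f x :=
  (hf.ldeg_spec x).pos

theorem GoodMap.ldeg_congr (hf : GoodMap p f d) (h : SameDisc p x y) :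
    ldeg p f x = ldeg p f y :=
  (hf.ldeg_spec x).unique ((hf.ldeg_spec y).congr h)

variable (p) in
/-- The local degree of the iterate `f^[m]` on the residue disc of `x`, by the chain rule. -/
def iterDeg (f : OnePoint F → OnePoint F) (m : ℕ) (x : OnePoint F) : ℕ :=
  ∏ i ∈ Finset.range m, ldeg p f (f^[i] x)

theorem GoodMap.locDeg_iterate (hf : GoodMap p f d) (m : ℕ) (x : OnePoint F) :
    LocDeg p f^[m] x (iterDeg p f m x) := by
  induction m with
  | zero =>
    intro w hw
    refine ⟨{w}, by simp [iterDeg], by simpa using hw, fun y _ => by simp [distProd]⟩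
  | succ m ih =>
    rw [iterDeg, Finset.prod_range_succ, mul_comm, Function.iterate_succ']
    exact ih.comp (hf.ldeg_spec _)

theorem LocDeg.iterate (hh : LocDeg p h x e) (hx : SameDisc p (h x) x) (k : ℕ) :
    LocDeg p h^[k] x (e ^ k) ∧ SameDisc p (h^[k] x) x := by
  induction k with
  | zero =>
    refine ⟨fun w hw => ⟨{w}, by simp, by simpa using hw, fun y _ => by simp [distProd]⟩,
      SameDisc.refl x⟩
  | succ k ih =>
    rw [pow_succ', Function.iterate_succ', Function.comp_apply]
    exact ⟨ih.1.comp (hh.congr ih.2), (hh.sameDisc ih.2).trans hx⟩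

/-- Along a cycle of residue discs, the local degree of the first-return map is constant. -/
theorem GoodMap.iterDeg_apply (hf : GoodMap p f d) {m : ℕ} (hx : SameDisc p (f^[m] x) x) :
    iterDeg p f m (f x) = iterDeg p f m x := by
  have h1 : iterDeg p f m (f x) * ldeg p f x = iterDeg p f (m + 1) x := by
    rw [iterDeg, iterDeg, Finset.prod_range_succ']
    simp [Function.iterate_succ_apply]
  rw [iterDeg, iterDeg, Finset.prod_range_succ, hf.ldeg_congr hx] at h1
  exact Nat.eq_of_mul_eq_mul_right (hf.ldeg_pos x) h1

theorem GoodMap.ldeg_le_iterDeg (hf : GoodMap p f d) {m i : ℕ} (hi : i < m) :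
    ldeg p f (f^[i] x) ≤ iterDeg p f m x :=
  Nat.le_of_dvd (Finset.prod_pos fun _ _ => hf.ldeg_pos _)
    (Finset.dvd_prod_of_mem (fun i => ldeg p f (f^[i] x)) (Finset.mem_range.2 hi))

end LocalDegree

/-! ### Contraction and escape on a residue disc mapped to itself -/

section Contraction

variable (p : ℕ) [Fact p.Prime] {F : Type*} [Field F] [Algebra ℚ_[p] F]
  [Algebra.IsAlgebraic ℚ_[p] F]

/-- The dynamics of `h` on the residue disc of `b` in terms of the closed disc of radius `r` around
`b`: it is stable under `h` and `h` is contracting on it, while outside of it `h` raises the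
distance to `b` to the power `e`. -/
structure EscapeRadius (h : OnePoint F → OnePoint F) (b : OnePoint F) (e : ℕ) (r : ℝ) : Prop where
  nonneg : 0 ≤ r
  lt_one : r < 1
  stable : ∀ y, sphDist p y b ≤ r → sphDist p (h y) b ≤ r
  escape : ∀ y, SameDisc p y b → r < sphDist p y b → sphDist p (h y) b = sphDist p y b ^ e
  contract : ∀ y z, sphDist p y b ≤ r → sphDist p z b ≤ r →
    sphDist p (h y) (h z) ≤ r * sphDist p y z

variable {p} {h : OnePoint F → OnePoint F} {b : OnePoint F} {e : ℕ} {r : ℝ}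

/-- Local degree at least `2` makes a map of a residue disc to itself contracting on any disc that
contains the preimages of `h b`, because the distance `h y` to `h z` is then a product of at least
two distances, one of which is the distance from `y` to `z`. -/
theorem LocDeg.exists_escapeRadius (hh : LocDeg p h b e) (he : 2 ≤ e) (hb : SameDisc p (h b) b) :
    ∃ r, EscapeRadius p h b e r := by
  obtain ⟨Z, z1, z2, z3⟩ := hh (h b) (SameDisc.refl _)
  obtain ⟨r₁, a0, a1, a2⟩ := exists_lt_one_bound p Z b z2
  obtain ⟨r₂, b0, b1, b2⟩ := exists_lt_one_pow_ge (sphDist_nonneg p (h b) b) hb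
    (by omega : e ≠ 0)
  set r := max r₁ r₂ with hr
  have r0 : 0 ≤ r := le_max_of_le_left a0
  have r1 : r < 1 := max_lt a1 b1
  have hZ : ∀ z ∈ Z, sphDist p b z ≤ r := fun z hz => (a2 z hz).trans (le_max_left _ _)
  have hre : r ^ e ≤ r := by
    calc r ^ e ≤ r ^ 1 := pow_le_pow_of_le_one r0 r1.le (by omega)
      _ = r := pow_one r
  have hbb : sphDist p (h b) b ≤ r ^ e := b2.trans (pow_le_pow_left₀ b0 (le_max_right _ _) e)
  have hout : ∀ y, SameDisc p y b → r < sphDist p y b →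
      sphDist p (h y) (h b) = sphDist p y b ^ e := fun y hy hy' => by
    rw [z3 y hy, distProd_eq_pow_of_lt p hZ hy', z1]
  have hin : ∀ y, sphDist p y b ≤ r → sphDist p (h y) (h b) ≤ r ^ e := fun y hy => by
    rw [z3 y (hy.trans_lt r1), ← z1]
    exact distProd_le_pow p fun z hz => sphDist_le_trans p hy (hZ z hz)
  refine ⟨r, r0, r1, fun y hy => ?_, fun y hy hy' => ?_, fun y z hy hz => ?_⟩
  · exact sphDist_le_trans p ((hin y hy).trans hre) (hbb.trans hre)
  · rw [← hout y hy hy']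
    refine sphDist_eq_of_lt p (hbb.trans_lt ?_)
    rw [hout y hy hy']
    exact pow_lt_pow_left₀ hy' r0 (by omega)
  · obtain ⟨Z', y1, y2, y3⟩ := hh (h z) (hh.sameDisc (hz.trans_lt r1))
    have hzZ : z ∈ Z' := by
      rw [← distProd_eq_zero_iff p, ← y3 z (hz.trans_lt r1), sphDist_self]
    -- all preimages of `h z` lie in the disc, and there is a second one besides `z`
    have hall : ∀ u ∈ Z', sphDist p u b ≤ r := by
      intro u hu
      by_contra! hu'
      have e1 : h u = h z := by
        rw [← sphDist_eq_zero p, y3 u (y2 u hu), distProd_eq_zero_iff]; exact hu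
      have e2 := hout u (y2 u hu) hu'
      rw [e1] at e2
      exact absurd (hin z hz) (not_le.2 (e2 ▸ pow_lt_pow_left₀ hu' r0 (by omega)))
    obtain ⟨Z'', rfl⟩ := Multiset.exists_cons_of_mem hzZ
    obtain ⟨u, hu⟩ := Multiset.card_pos_iff_exists_mem.1
      (show 0 < Z''.card by rw [Multiset.card_cons] at y1; omega)
    rw [y3 y (hy.trans_lt r1), distProd_cons, mul_comm]
    refine mul_le_mul_of_nonneg_right ((distProd_le_of_mem p hu y).trans ?_) (sphDist_nonneg p y z)
    exact sphDist_le_trans p hy (sphDist_comm p b u ▸ hall u (Multiset.mem_cons_of_mem hu))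

namespace EscapeRadius

theorem contract_iterate (H : EscapeRadius p h b e r) (k : ℕ) {y z : OnePoint F}
    (hy : sphDist p y b ≤ r) (hz : sphDist p z b ≤ r) :
    sphDist p (h^[k] y) (h^[k] z) ≤ r ^ k := by
  induction k generalizing y z with
  | zero => simpa using sphDist_le_one p y z
  | succ k ih =>
    have hst : ∀ k, ∀ y, sphDist p y b ≤ r → sphDist p (h^[k] y) b ≤ r := by
      intro k
      induction k with
      | zero => exact fun y hy => hy
      | succ k ih => intro y hy; rw [Function.iterate_succ_apply]; exact ih _ (H.stable y hy)
    rw [Function.iterate_succ_apply', Function.iterate_succ_apply', pow_succ']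
    exact (H.contract _ _ (hst k y hy) (hst k z hz)).trans
      (mul_le_mul_of_nonneg_left (ih hy hz) H.nonneg)

/-- Two backward orbits that stay inside the escape radius agree. -/
theorem eq_of_backward (H : EscapeRadius p h b e r) {c c' : ℕ → OnePoint F}
    (hc : ∀ n, h (c (n + 1)) = c n) (hc' : ∀ n, h (c' (n + 1)) = c' n)
    (hr : ∀ n, sphDist p (c n) b ≤ r) (hr' : ∀ n, sphDist p (c' n) b ≤ r) (n : ℕ) :
    c n = c' n := by
  have it : ∀ {c : ℕ → OnePoint F}, (∀ n, h (c (n + 1)) = c n) →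
      ∀ k n, h^[k] (c (n + k)) = c n := by
    intro c hc k
    induction k with
    | zero => intro n; rfl
    | succ k ih => intro n; rw [Function.iterate_succ_apply, ← add_assoc, hc, ih]
  rw [← sphDist_eq_zero p]
  refine le_antisymm (ge_of_tendsto' (tendsto_pow_atTop_nhds_zero_of_lt_one H.nonneg H.lt_one)
    fun k => ?_) (sphDist_nonneg p _ _)
  rw [← it hc k n, ← it hc' k n]
  exact H.contract_iterate k (hr _) (hr' _)

/-- Distinct fixed points cannot lie in the same residue disc. -/
theorem eq_of_fixed (H : EscapeRadius p h b e r) (hb : h b = b) {y : OnePoint F} (he : 2 ≤ e)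
    (hy : SameDisc p y b) (hyf : h y = y) : y = b := by
  rw [← sphDist_eq_zero p]
  by_contra hne
  have h0 : 0 < sphDist p y b := lt_of_le_of_ne (sphDist_nonneg p y b) (Ne.symm hne)
  rcases le_or_gt (sphDist p y b) r with hr | hr
  · have := H.contract y b hr (by simpa using H.nonneg)
    rw [hyf, hb] at this
    nlinarith [H.lt_one]
  · have := H.escape y hy hr
    rw [hyf] at this
    have h2 : sphDist p y b ^ e < sphDist p y b ^ 1 :=
      pow_lt_pow_right_of_lt_one₀ h0 hy (by omega)
    rw [pow_one] at h2
    linarith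

/-- A backward orbit in the residue disc either stays inside the escape radius, or from some index
on the distances to `b` are the successive `e`-th roots of each other. -/
theorem dichotomy (H : EscapeRadius p h b e r) {c : ℕ → OnePoint F}
    (hc : ∀ n, h (c (n + 1)) = c n) (hd : ∀ n, SameDisc p (c n) b) :
    (∀ n, sphDist p (c n) b ≤ r) ∨ ∃ N, ∀ n, N ≤ n →
      r < sphDist p (c n) b ∧ sphDist p (c n) b = sphDist p (c (n + 1)) b ^ e := by
  by_cases hr : ∀ n, sphDist p (c n) b ≤ r
  · exact Or.inl hr
  push Not at hr
  obtain ⟨N, hN⟩ := hr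
  have hgt : ∀ n, N ≤ n → r < sphDist p (c n) b := by
    intro n hn
    induction n, hn using Nat.le_induction with
    | base => exact hN
    | succ n hn ih =>
      by_contra! h'
      exact absurd (hc n ▸ H.stable _ h') (not_le.2 ih)
  refine Or.inr ⟨N, fun n hn => ⟨hgt n hn, ?_⟩⟩
  rw [← H.escape _ (hd (n + 1)) (hgt (n + 1) (by omega)), hc]

/-- If `b` is not fixed, some backward orbit that starts at `b` escapes. For otherwise all `e ^ k`
preimages of `b` under `h^[k]` would lie within the escape radius, so that `h^[k] b` would tend to
`b`; but its distance to `b` does not depend on `k`. -/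
theorem exists_escaping [IsAlgClosed F] (H : EscapeRadius p h b e r) (hh : LocDeg p h b e)
    (he : 2 ≤ e) (hbb : SameDisc p (h b) b) (hb : h b ≠ b) :
    ∃ c : ℕ → OnePoint F, c 0 = b ∧ (∀ n, h (c (n + 1)) = c n) ∧ (∀ n, SameDisc p (c n) b) ∧
      ∃ n, r < sphDist p (c n) b := by
  have hs0 : 0 < sphDist p (h b) b := sphDist_pos p hb
  obtain ⟨k, z, hz, hzk, hzr⟩ : ∃ k z, SameDisc p z b ∧ h^[k] z = b ∧ r < sphDist p z b := by
    by_contra! hcon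
    have hbr : sphDist p b b ≤ r := by simpa using H.nonneg
    -- by contraction the steps of the orbit of `b` get shorter than the first one
    have hconst : ∀ k, sphDist p (h^[k + 1] b) b = sphDist p (h b) b ∧
        sphDist p (h^[k + 1] b) b ≤ r := by
      intro k
      induction k with
      | zero => exact ⟨rfl, H.stable b hbr⟩
      | succ k ih =>
        have h1 := H.contract (h^[k + 1] b) b ih.2 hbr
        rw [← Function.iterate_succ_apply' h, ih.1] at h1
        refine ⟨?_, ?_⟩
        · rw [sphDist_comm, sphDist_comm p (h b) b]
          refine sphDist_eq_of_lt p ?_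
          rw [sphDist_comm p b, sphDist_comm p (h b) (h^[k + 1 + 1] b)]
          refine h1.trans_lt ?_
          nlinarith [H.lt_one]
        · rw [Function.iterate_succ_apply']
          exact H.stable _ ih.2
    -- the number `e ^ (k + 1)` of preimages is at least `k + 1`
    have hle : ∀ k, sphDist p (h b) b ≤ r ^ (k + 1) := by
      intro k
      obtain ⟨h1, h2⟩ := hh.iterate hbb (k + 1)
      obtain ⟨Z, z1, z2, z3⟩ := h1 b h2.symm
      rw [← (hconst k).1, z3 b (SameDisc.refl b)]
      refine (distProd_le_pow p fun z hz => ?_).trans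
        (pow_le_pow_of_le_one H.nonneg H.lt_one.le (z1 ▸ (Nat.lt_pow_self (by omega)).le))
      rw [sphDist_comm]
      refine hcon (k + 1) z (z2 z hz) ?_
      rw [← sphDist_eq_zero p, z3 z (z2 z hz), distProd_eq_zero_iff]
      exact hz
    have := ge_of_tendsto' ((tendsto_add_atTop_iff_nat 1).2
      (tendsto_pow_atTop_nhds_zero_of_lt_one H.nonneg H.lt_one)) hle
    linarith
  -- run through the orbit of `z` backwards, and continue with arbitrary preimages in the disc
  have hpre : ∀ w, SameDisc p w b → ∃ z, SameDisc p z b ∧ h z = w := fun w hw =>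
    hh.exists_preimage (hw.trans hbb.symm)
  choose! g g1 g2 using hpre
  have hg : ∀ n, SameDisc p (g^[n] z) b := by
    intro n
    induction n with
    | zero => exact hz
    | succ n ih => rw [Function.iterate_succ_apply']; exact g1 _ ih
  have hd : ∀ n, SameDisc p (h^[n] z) b := by
    intro n
    induction n with
    | zero => exact hz
    | succ n ih => rw [Function.iterate_succ_apply']; exact (hh.sameDisc ih).trans hbb
  refine ⟨fun n => if n ≤ k then h^[k - n] z else g^[n - k] z, ?_, ?_, ?_, k, ?_⟩
  · simpa using hzk
  · intro n
    by_cases hn : n + 1 ≤ k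
    · simp only [if_pos hn, if_pos (show n ≤ k by omega), ← Function.iterate_succ_apply' h]
      congr 1
      omega
    · simp only [if_neg hn]
      by_cases hn' : n ≤ k
      · obtain rfl : n = k := by omega
        simp only [le_refl, if_true, Nat.sub_self, Nat.add_sub_cancel_left,
          Function.iterate_one, Function.iterate_zero_apply]
        exact g2 z hz
      · simp only [if_neg hn', show n + 1 - k = (n - k) + 1 by omega, Function.iterate_succ_apply']
        exact g2 _ (hg _)
  · intro n
    by_cases hn : n ≤ k
    · simp only [if_pos hn]; exact hd _
    · simp only [if_neg hn]; exact hg _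
  · simpa using hzr

end EscapeRadius

end Contraction

/-! ### The Gauss norm and the product formula for binary forms -/

section GaussNorm

variable (p : ℕ) [Fact p.Prime] {F : Type*} [Field F] [Algebra ℚ_[p] F]
  [Algebra.IsAlgebraic ℚ_[p] F]

/-- The Gauss norm, the largest absolute value of a coefficient. -/
def gaussN (A : F[X]) : ℝ := A.gaussNorm (absVal p F) 1

theorem le_gaussN (A : F[X]) (i : ℕ) : absv p (A.coeff i) ≤ gaussN p A := by
  simpa [gaussN] using A.le_gaussNorm (absVal p F) zero_le_one i

theorem exists_eq_gaussN (A : F[X]) : ∃ i, gaussN p A = absv p (A.coeff i) := by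
  simpa [gaussN] using A.exists_eq_gaussNorm (absVal p F) 1

theorem gaussN_nonneg (A : F[X]) : 0 ≤ gaussN p A := A.gaussNorm_nonneg _ zero_le_one

theorem gaussN_mul (A B : F[X]) : gaussN p (A * B) = gaussN p A * gaussN p B :=
  gaussNorm_mul (isNonarchimedean_absVal p) one_pos A B

theorem gaussN_C (a : F) : gaussN p (C a) = absv p a := gaussNorm_C _ _ _

theorem gaussN_le_iff {A : F[X]} {r : ℝ} : gaussN p A ≤ r ↔ ∀ i, absv p (A.coeff i) ≤ r := by
  refine ⟨fun h i => (le_gaussN p A i).trans h, fun h => ?_⟩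
  obtain ⟨i, hi⟩ := exists_eq_gaussN p A
  exact hi ▸ h i

theorem gaussN_sub_le (A B : F[X]) : gaussN p (A - B) ≤ max (gaussN p A) (gaussN p B) := by
  rw [gaussN_le_iff]
  intro i
  rw [coeff_sub]
  exact (absv_sub_le p _ _).trans (max_le_max (le_gaussN p A i) (le_gaussN p B i))

theorem gaussN_neg (A : F[X]) : gaussN p (-A) = gaussN p A := by
  refine le_antisymm ?_ ?_ <;> rw [gaussN_le_iff] <;> intro i
  · rw [coeff_neg, absv_neg]; exact le_gaussN p A i
  · rw [← absv_neg, ← coeff_neg]; exact le_gaussN p (-A) i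

theorem gaussN_derivative_le (A : F[X]) : gaussN p (derivative A) ≤ gaussN p A := by
  rw [gaussN_le_iff]
  intro i
  rw [coeff_derivative, absv_mul]
  refine (mul_le_of_le_one_right (absv_nonneg p _) ?_).trans (le_gaussN p A (i + 1))
  exact_mod_cast absv_natCast_le_one (F := F) p (i + 1)

theorem gaussN_wronskian_le (A B : F[X]) : gaussN p (wronskian A B) ≤ gaussN p A * gaussN p B := by
  rw [wronskian]
  refine (gaussN_sub_le p _ _).trans (max_le ?_ ?_) <;> rw [gaussN_mul]
  · exact mul_le_mul_of_nonneg_left (gaussN_derivative_le p B) (gaussN_nonneg p A)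
  · exact mul_le_mul_of_nonneg_right (gaussN_derivative_le p A) (gaussN_nonneg p B)

theorem gaussN_X_sub_C (a : F) : gaussN p (X - C a) = hnorm p (OnePoint.some a) := by
  rw [hnorm_some]
  refine le_antisymm ((gaussN_le_iff p).2 fun i => ?_) (max_le ?_ ?_)
  · rw [coeff_sub, coeff_X, coeff_C]
    rcases i with _ | _ | i
    · simp [absv_neg]
    · simp [absv_one]
    · simp [absv_zero]
  · have h := le_gaussN p (X - C a) 1
    rwa [coeff_sub, coeff_X_one, coeff_C_succ, sub_zero, absv_one] at h
  · have h := le_gaussN p (X - C a) 0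
    rwa [coeff_sub, coeff_X_zero, coeff_C_zero, zero_sub, absv_neg] at h

theorem gaussN_X : gaussN p (X : F[X]) = 1 := by
  have := gaussN_X_sub_C p (0 : F)
  simpa [hnorm_some, absv_zero] using this

theorem gaussN_reflect {A : F[X]} {N : ℕ} : gaussN p (reflect N A) = gaussN p A := by
  have key : ∀ A : F[X], gaussN p (reflect N A) ≤ gaussN p A := fun A => by
    rw [gaussN_le_iff]
    intro i
    rw [coeff_reflect]
    exact le_gaussN p A _
  refine le_antisymm (key A) ?_
  have := key (reflect N A)
  rwa [reflect_reflect] at this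

theorem absv_eval_le (A : F[X]) {a : F} (ha : absv p a ≤ 1) : absv p (A.eval a) ≤ gaussN p A := by
  rw [eval_eq_sum, Polynomial.sum]
  refine absv_sum_le p _ _ (gaussN_nonneg p A) fun i _ => ?_
  rw [absv_mul, absv_pow]
  exact (mul_le_of_le_one_right (absv_nonneg p _) (pow_le_one₀ (absv_nonneg p a) ha)).trans
    (le_gaussN p A i)

/-- A polynomial with integral coefficients is constant on residue discs modulo the maximal
ideal. -/
theorem absv_eval_sub_lt (A : F[X]) (hA : gaussN p A ≤ 1) {a b : F} (ha : absv p a ≤ 1)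
    (hab : absv p (b - a) < 1) : absv p (A.eval b - A.eval a) < 1 := by
  obtain ⟨S, hS⟩ := X_sub_C_dvd_sub_C_eval (p := A) (a := a)
  have hb : absv p b ≤ 1 := by
    rw [← sub_add_cancel b a]; exact (absv_add_le p _ _).trans (max_le hab.le ha)
  have hn : gaussN p S ≤ 1 := by
    have h1 : gaussN p (X - C a) * gaussN p S ≤ 1 := by
      rw [← gaussN_mul, ← hS]
      exact (gaussN_sub_le p _ _).trans (max_le hA (by
        rw [gaussN_C]; exact (absv_eval_le p A ha).trans hA))
    rw [gaussN_X_sub_C, hnorm_some, max_eq_left ha, one_mul] at h1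
    exact h1
  have : A.eval b - A.eval a = (b - a) * S.eval b := by
    have := congrArg (eval b) hS
    simpa using this
  rw [this, absv_mul]
  have h2 := (absv_eval_le p S hb).trans hn
  nlinarith [absv_nonneg p (b - a), absv_nonneg p (S.eval b)]

/-- The value at the point `x` of the binary form of degree `N` that `A` dehomogenizes. -/
def heval (N : ℕ) (A : F[X]) : OnePoint F → F
  | OnePoint.infty => A.coeff N
  | OnePoint.some x => A.eval x

@[simp] theorem heval_infty (N : ℕ) (A : F[X]) : heval N A OnePoint.infty = A.coeff N := rfl
@[simp] theorem heval_some (N : ℕ) (A : F[X]) (x : F) :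
    heval N A (OnePoint.some x) = A.eval x := rfl

theorem heval_pinv (N : ℕ) (x : OnePoint F) : ∃ c : F, c ≠ 0 ∧ ∀ A : F[X], A.natDegree ≤ N →
    heval N A x = c * heval N (reflect N A) (pinv x) := by
  induction x using OnePoint.rec with
  | infty =>
    refine ⟨1, one_ne_zero, fun A _ => ?_⟩
    rw [pinv_infty, heval_some, ← coeff_zero_eq_eval_zero, coeff_reflect]
    simp [revAt_le]
  | coe x =>
    by_cases h : x = 0
    · subst h
      refine ⟨1, one_ne_zero, fun A _ => ?_⟩
      rw [show pinv ((0 : F) : OnePoint F) = OnePoint.infty from pinv_zero, heval_infty,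
        coeff_reflect, revAt_le le_rfl, Nat.sub_self, one_mul, coeff_zero_eq_eval_zero]
      rfl
    · refine ⟨x ^ N, pow_ne_zero N h, fun A hA => ?_⟩
      rw [show pinv (x : OnePoint F) = OnePoint.some x⁻¹ from pinv_some h, heval_some]
      let _ := invertibleOfNonzero h
      have := eval₂_reflect_mul_pow (RingHom.id F) x N A hA
      rw [invOf_eq_inv, mul_comm] at this
      exact this.symm

/-- The zeros of the binary form of degree `N` that `A` dehomogenizes, with multiplicities. -/
def formRoots (N : ℕ) (A : F[X]) : Multiset (OnePoint F) :=
  A.roots.map OnePoint.some + Multiset.replicate (N - A.natDegree) OnePoint.infty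

variable [IsAlgClosed F]

theorem card_formRoots {N : ℕ} {A : F[X]} (hN : A.natDegree ≤ N) : (formRoots N A).card = N := by
  rw [formRoots, Multiset.card_add, Multiset.card_map, Multiset.card_replicate,
    ← (IsAlgClosed.splits A).natDegree_eq_card_roots]
  omega

/-- The product formula: up to normalization, the absolute value of a binary form at `x` is the
product of the distances from `x` to the zeros of the form. -/
theorem absv_heval {N : ℕ} {A : F[X]} (hN : A.natDegree ≤ N) (x : OnePoint F) :
    absv p (heval N A x) = gaussN p A * hnorm p x ^ N * distProd p (formRoots N A) x := by
  have hs := (IsAlgClosed.splits A).eq_prod_roots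
  have hcard := (IsAlgClosed.splits A).natDegree_eq_card_roots
  have hdist : ∀ Z : Multiset F, ∀ y, distProd p (Z.map OnePoint.some + Multiset.replicate
      (N - A.natDegree) OnePoint.infty) y = distProd p (Z.map OnePoint.some) y *
        sphDist p y OnePoint.infty ^ (N - A.natDegree) := by
    intro Z y
    simp [distProd]
  have hg : ∀ Z : Multiset F, gaussN p (Z.map fun a => X - C a).prod =
      (Z.map fun a => hnorm p (OnePoint.some a)).prod := by
    intro Z
    induction Z using Multiset.induction_on with
    | empty => simpa [absv_one] using gaussN_C p (1 : F)
    | cons a Z ih => rw [Multiset.map_cons, Multiset.prod_cons, gaussN_mul, ih, gaussN_X_sub_C,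
        Multiset.map_cons, Multiset.prod_cons]
  have hpos : ∀ Z : Multiset F, 0 < (Z.map fun a => hnorm p (OnePoint.some a)).prod := by
    intro Z
    induction Z using Multiset.induction_on with
    | empty => simp
    | cons a Z ih => rw [Multiset.map_cons, Multiset.prod_cons]; exact mul_pos (hnorm_pos p _) ih
  have hgA : gaussN p A = absv p A.leadingCoeff *
      (A.roots.map fun a => hnorm p (OnePoint.some a)).prod := by
    conv_lhs => rw [hs]
    rw [gaussN_mul, gaussN_C, hg]
  rw [formRoots, hdist, hgA]
  induction x using OnePoint.rec with
  | infty =>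
    rw [heval_infty, sphDist_self, hnorm_infty, one_pow, mul_one]
    rcases hN.lt_or_eq with h | h
    · rw [coeff_eq_zero_of_natDegree_lt h, absv_zero, zero_pow (by omega), mul_zero, mul_zero]
    · rw [h, Nat.sub_self, pow_zero, mul_one, ← h, mul_assoc]
      have : ∀ Z : Multiset F, (Z.map fun a => hnorm p (OnePoint.some a)).prod *
          distProd p (Z.map OnePoint.some) OnePoint.infty = 1 := by
        intro Z
        induction Z using Multiset.induction_on with
        | empty => simp
        | cons a Z ih =>
          rw [Multiset.map_cons, Multiset.prod_cons, Multiset.map_cons, distProd_cons,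
            mul_mul_mul_comm, ih, mul_one, sphDist_eq]
          simp [absv_one, hnorm_infty, (hnorm_pos p (OnePoint.some a)).ne']
      rw [this, mul_one]
      rfl
  | coe t =>
    have h1 : absv p (heval N A (OnePoint.some t)) = absv p A.leadingCoeff *
        absv p ((A.roots.map fun a => t - a).prod) := by
      rw [heval_some]
      conv_lhs => rw [hs]
      rw [eval_mul, eval_C, absv_mul, eval_multiset_prod, Multiset.map_map]
      simp
    have h2 : ∀ Z : Multiset F, absv p ((Z.map fun a => t - a).prod) =
        (Z.map fun a => hnorm p (OnePoint.some a)).prod * hnorm p (OnePoint.some t) ^ Z.card *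
          distProd p (Z.map OnePoint.some) (OnePoint.some t) := by
      intro Z
      induction Z using Multiset.induction_on with
      | empty => simp [absv_one]
      | cons a Z ih =>
        have hd : absv p (t - a) = sphDist p (OnePoint.some t) (OnePoint.some a) *
            (hnorm p (OnePoint.some t) * hnorm p (OnePoint.some a)) := by
          rw [sphDist_eq, div_mul_cancel₀ _ (mul_pos (hnorm_pos p _) (hnorm_pos p _)).ne']
          simp
        rw [Multiset.map_cons, Multiset.prod_cons, absv_mul, ih, hd, Multiset.map_cons,
          Multiset.prod_cons, Multiset.map_cons, distProd_cons, Multiset.card_cons, pow_succ]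
        ring
    have h3 : sphDist p (OnePoint.some t) OnePoint.infty = (hnorm p (OnePoint.some t))⁻¹ := by
      rw [sphDist_eq]; simp [absv_neg, absv_one, hnorm_infty]
    change absv p (heval N A (OnePoint.some t)) = _ * hnorm p (OnePoint.some t) ^ N *
      (distProd p (A.roots.map OnePoint.some) (OnePoint.some t) *
        sphDist p (OnePoint.some t) OnePoint.infty ^ (N - A.natDegree))
    have h4 := (hnorm_pos p (OnePoint.some t)).ne'
    rw [h1, h2, h3, ← hcard]
    have h5 : hnorm p (OnePoint.some t) ^ N = hnorm p (OnePoint.some t) ^ A.natDegree *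
        hnorm p (OnePoint.some t) ^ (N - A.natDegree) := by
      rw [← pow_add]; congr 1; omega
    rw [h5, inv_pow]
    field_simp

end GaussNorm

/-! ### Maps with good reduction -/

section GoodPair

variable (p : ℕ) [Fact p.Prime] {F : Type*} [Field F] [Algebra ℚ_[p] F]
  [Algebra.IsAlgebraic ℚ_[p] F]

/-- Numerator and denominator of a map of degree `d` with good and separable reduction: integral
polynomials without common zero at any integral point or at infinity modulo the maximal ideal,
whose Wronskian is not zero modulo the maximal ideal. -/
structure GoodPair (P Q : F[X]) (d : ℕ) : Prop where
  deg_le : P.natDegree ≤ d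
  deg_le' : Q.natDegree ≤ d
  gauss_le : gaussN p P ≤ 1
  gauss_le' : gaussN p Q ≤ 1
  eval_ge : ∀ a : F, absv p a ≤ 1 → 1 ≤ max (absv p (P.eval a)) (absv p (Q.eval a))
  top_ge : 1 ≤ max (absv p (P.coeff d)) (absv p (Q.coeff d))
  wronskian_ge : 1 ≤ gaussN p (wronskian P Q)

open Classical in
/-- The map of the projective line given by the binary forms of degree `d` that `P` and `Q`
dehomogenize. -/
def homMap (d : ℕ) (P Q : F[X]) (x : OnePoint F) : OnePoint F :=
  if heval d Q x = 0 then OnePoint.infty else OnePoint.some (heval d P x / heval d Q x)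

variable {p} {P Q : F[X]} {d : ℕ}

theorem X_mul_wronskian_reflect (hP : P.natDegree ≤ d) (hQ : Q.natDegree ≤ d) :
    X * wronskian (reflect d P) (reflect d Q) = -reflect (d + d) (X * wronskian P Q) := by
  have key : ∀ A : F[X], A.natDegree ≤ d →
      X * derivative (reflect d A) = C (d : F) * reflect d A - reflect d (X * derivative A) := by
    intro A hA
    ext k
    rw [coeff_sub, coeff_C_mul, coeff_reflect, coeff_reflect]
    have hX : ∀ B : F[X], ∀ k, (X * derivative B).coeff k = k * B.coeff k := by
      intro B k
      cases k with
      | zero => simp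
      | succ k => rw [coeff_X_mul, coeff_derivative]; push_cast; ring
    rw [hX, hX, coeff_reflect]
    rcases le_or_gt k d with hk | hk
    · rw [revAt_le hk, Nat.cast_sub hk]; ring
    · rw [revAt_eq_self_of_lt hk, coeff_eq_zero_of_natDegree_lt (hA.trans_lt hk)]; ring
  have hdeg : ∀ A : F[X], A.natDegree ≤ d → (X * derivative A).natDegree ≤ d := by
    intro A hA
    rcases Nat.eq_zero_or_pos A.natDegree with h | h
    · rw [natDegree_eq_zero.1 h |>.choose_spec.symm]; simp
    · refine natDegree_mul_le.trans ?_
      have := natDegree_derivative_lt h.ne'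
      rw [natDegree_X]
      omega
  have e1 : X * wronskian P Q = P * (X * derivative Q) - X * derivative P * Q := by
    rw [wronskian]; ring
  have e2 : X * wronskian (reflect d P) (reflect d Q) = reflect d P * (X * derivative (reflect d Q))
      - X * derivative (reflect d P) * reflect d Q := by
    rw [wronskian]; ring
  rw [e1, e2, key P hP, key Q hQ, reflect_sub, reflect_mul P _ hP (hdeg Q hQ),
    reflect_mul _ Q (hdeg P hP) hQ]
  ring

/-- The inversion `x ↦ 1 / x` relates the critical points of a map and of the map read off at
infinity. -/
theorem wronskian_eval_inv (hP : P.natDegree ≤ d) (hQ : Q.natDegree ≤ d) {z : F} (hz : z ≠ 0)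
    (h : (wronskian (reflect d P) (reflect d Q)).eval z = 0) : (wronskian P Q).eval z⁻¹ = 0 := by
  have h1 := congrArg (eval z) (X_mul_wronskian_reflect hP hQ)
  have hdeg : (X * wronskian P Q).natDegree ≤ d + d := by
    by_cases hW : wronskian P Q = 0
    · simp [hW]
    · refine natDegree_mul_le.trans ?_
      have := natDegree_wronskian_lt_add hW
      rw [natDegree_X]
      omega
  let _ := invertibleOfNonzero (inv_ne_zero hz)
  have h2 := eval₂_reflect_mul_pow (RingHom.id F) z⁻¹ (d + d) _ hdeg
  rw [invOf_eq_inv, inv_inv] at h2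
  change eval z _ * _ = eval z⁻¹ _ at h2
  rw [eval_mul, h, mul_zero, eval_neg, eq_comm, neg_eq_zero] at h1
  rw [h1, zero_mul, eval_mul, eval_X, eq_comm, mul_eq_zero] at h2
  exact h2.resolve_left (inv_ne_zero hz)

theorem GoodPair.reflected (h : GoodPair p P Q d) :
    GoodPair p (reflect d P) (reflect d Q) d where
  deg_le := natDegree_reflect_le.trans (max_le le_rfl h.deg_le)
  deg_le' := natDegree_reflect_le.trans (max_le le_rfl h.deg_le')
  gauss_le := (gaussN_reflect p).trans_le h.gauss_le
  gauss_le' := (gaussN_reflect p).trans_le h.gauss_le'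
  eval_ge := by
    intro a ha
    rcases ha.lt_or_eq with ha' | ha'
    · have key : ∀ A : F[X], gaussN p A ≤ 1 → 1 ≤ absv p (A.coeff d) →
          1 ≤ absv p ((reflect d A).eval a) := by
        intro A hA h1
        have h2 := absv_eval_sub_lt p (reflect d A) ((gaussN_reflect p).trans_le hA)
          (a := 0) (b := a) (by simp [absv_zero]) (by simpa using ha')
        rw [← coeff_zero_eq_eval_zero, coeff_reflect, revAt_le (Nat.zero_le d), Nat.sub_zero] at h2
        have h3 := absv_add_eq_of_lt p (h2.trans_le h1)
        rw [add_sub_cancel] at h3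
        rwa [h3]
      rcases le_max_iff.1 h.top_ge with h1 | h1
      · exact (key P h.gauss_le h1).trans (le_max_left _ _)
      · exact (key Q h.gauss_le' h1).trans (le_max_right _ _)
    · have h0 : a ≠ 0 := fun h0 => by rw [h0, absv_zero] at ha'; exact zero_ne_one ha'
      let _ := invertibleOfNonzero (inv_ne_zero h0)
      have key : ∀ A : F[X], A.natDegree ≤ d →
          absv p ((reflect d A).eval a) = absv p (A.eval a⁻¹) := by
        intro A hA
        have h2 := eval₂_reflect_mul_pow (RingHom.id F) a⁻¹ d _ hA
        rw [invOf_eq_inv, inv_inv] at h2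
        change eval a _ * _ = eval a⁻¹ _ at h2
        rw [← h2, absv_mul, absv_pow, absv_inv, ha', inv_one, one_pow, mul_one]
      rw [key P h.deg_le, key Q h.deg_le']
      exact h.eval_ge a⁻¹ (by rw [absv_inv, ha', inv_one])
  top_ge := by
    rw [coeff_reflect, coeff_reflect, revAt_le le_rfl, Nat.sub_self, coeff_zero_eq_eval_zero,
      coeff_zero_eq_eval_zero]
    exact h.eval_ge 0 (by simp [absv_zero])
  wronskian_ge := by
    have h1 := congrArg (gaussN p) (X_mul_wronskian_reflect h.deg_le h.deg_le')
    rw [gaussN_mul, gaussN_X, one_mul, gaussN_neg, gaussN_reflect, gaussN_mul, gaussN_X,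
      one_mul] at h1
    rw [h1]
    exact h.wronskian_ge

theorem homMap_pinv (h : GoodPair p P Q d) (x : OnePoint F) :
    homMap d P Q (pinv x) = homMap d (reflect d P) (reflect d Q) x := by
  obtain ⟨c, hc, h1⟩ := heval_pinv d (pinv x)
  rw [homMap, homMap, h1 Q h.deg_le', h1 P h.deg_le, pinv_pinv, mul_div_mul_left _ _ hc]
  by_cases h0 : heval d (reflect d Q) x = 0
  · rw [if_pos h0, if_pos (by rw [h0, mul_zero])]
  · rw [if_neg h0, if_neg (mul_ne_zero hc h0)]

theorem GoodPair.max_heval (h : GoodPair p P Q d) (x : OnePoint F) :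
    max (absv p (heval d P x)) (absv p (heval d Q x)) = hnorm p x ^ d := by
  have key : ∀ {P Q : F[X]}, GoodPair p P Q d → ∀ a : F, absv p a ≤ 1 →
      max (absv p (P.eval a)) (absv p (Q.eval a)) = 1 := fun h a ha =>
    le_antisymm (max_le ((absv_eval_le p _ ha).trans h.gauss_le)
      ((absv_eval_le p _ ha).trans h.gauss_le')) (h.eval_ge a ha)
  induction x using OnePoint.rec with
  | infty =>
    rw [hnorm_infty, one_pow]
    exact le_antisymm (max_le ((le_gaussN p P d).trans h.gauss_le)
      ((le_gaussN p Q d).trans h.gauss_le')) h.top_ge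
  | coe t =>
    rw [hnorm_some]
    rcases le_or_gt (absv p t) 1 with ht | ht
    · rw [max_eq_left ht, one_pow]; exact key h t ht
    · have h0 : t ≠ 0 := fun h0 => by rw [h0, absv_zero] at ht; linarith
      let _ := invertibleOfNonzero h0
      have hk : ∀ A : F[X], A.natDegree ≤ d → absv p (heval d A (OnePoint.some t)) =
          absv p ((reflect d A).eval t⁻¹) * absv p t ^ d := by
        intro A hA
        have h2 := eval₂_reflect_mul_pow (RingHom.id F) t d _ hA
        rw [invOf_eq_inv] at h2
        change eval t⁻¹ _ * _ = eval t _ at h2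
        rw [heval_some, ← h2, absv_mul, absv_pow]
      change max (absv p (heval d P (OnePoint.some t))) (absv p (heval d Q (OnePoint.some t))) = _
      rw [hk P h.deg_le, hk Q h.deg_le', ← max_mul_of_nonneg _ _ (pow_nonneg (absv_nonneg p t) d),
        key h.reflected t⁻¹ (by rw [absv_inv]; exact inv_le_one_of_one_le₀ ht.le), one_mul,
        max_eq_right ht.le]

variable (P Q) in
/-- The polynomial whose zeros are the preimages of `w` under `P / Q`. -/
def fiberPoly (w : OnePoint F) : F[X] := C (hy w) * P - C (hx w) * Q

theorem heval_fiberPoly (w x : OnePoint F) :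
    heval d (fiberPoly P Q w) x = hy w * heval d P x - hx w * heval d Q x := by
  induction x using OnePoint.rec <;> simp [fiberPoly, heval]

theorem GoodPair.natDegree_fiberPoly (h : GoodPair p P Q d) (w : OnePoint F) :
    (fiberPoly P Q w).natDegree ≤ d :=
  (natDegree_sub_le _ _).trans (max_le ((natDegree_C_mul_le _ _).trans h.deg_le)
    ((natDegree_C_mul_le _ _).trans h.deg_le'))

theorem wronskian_fiberPoly_left (w : OnePoint F) :
    wronskian (fiberPoly P Q w) Q = C (hy w) * wronskian P Q := by
  simp only [fiberPoly, wronskian, derivative_sub, derivative_C_mul]; ring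

theorem wronskian_fiberPoly_right (w : OnePoint F) :
    wronskian (fiberPoly P Q w) P = C (hx w) * wronskian P Q := by
  simp only [fiberPoly, wronskian, derivative_sub, derivative_C_mul]; ring

theorem GoodPair.gaussN_fiberPoly (h : GoodPair p P Q d) (w : OnePoint F) :
    gaussN p (fiberPoly P Q w) = hnorm p w := by
  refine le_antisymm ((gaussN_sub_le p _ _).trans (max_le ?_ ?_)) ?_
  · rw [gaussN_mul, gaussN_C]
    exact (mul_le_of_le_one_right (absv_nonneg p _) h.gauss_le).trans (absv_hy_le p w)
  · rw [gaussN_mul, gaussN_C]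
    exact (mul_le_of_le_one_right (absv_nonneg p _) h.gauss_le').trans (absv_hx_le p w)
  · -- otherwise `P` and `Q` would be proportional modulo the maximal ideal
    have h1 := gaussN_wronskian_le p (fiberPoly P Q w) Q
    have h2 := gaussN_wronskian_le p (fiberPoly P Q w) P
    rw [wronskian_fiberPoly_left, gaussN_mul, gaussN_C] at h1
    rw [wronskian_fiberPoly_right, gaussN_mul, gaussN_C] at h2
    have h0 := gaussN_nonneg p (fiberPoly P Q w)
    refine max_le ?_ ?_
    · calc absv p (hy w) ≤ absv p (hy w) * gaussN p (wronskian P Q) :=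
          le_mul_of_one_le_right (absv_nonneg p _) h.wronskian_ge
        _ ≤ _ := h1.trans (mul_le_of_le_one_right h0 h.gauss_le')
    · calc absv p (hx w) ≤ absv p (hx w) * gaussN p (wronskian P Q) :=
          le_mul_of_one_le_right (absv_nonneg p _) h.wronskian_ge
        _ ≤ _ := h2.trans (mul_le_of_le_one_right h0 h.gauss_le)

theorem GoodPair.fiberPoly_ne_zero (h : GoodPair p P Q d) (w : OnePoint F) :
    fiberPoly P Q w ≠ 0 := by
  intro h0
  have := h.gaussN_fiberPoly w
  rw [h0] at this
  have h1 : gaussN p (0 : F[X]) = 0 := by simpa [absv_zero] using gaussN_C p (0 : F)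
  rw [h1] at this
  exact (hnorm_pos p w).ne this

/-- The homogeneous coordinates of `homMap d P Q x` are proportional to the values of the forms. -/
theorem GoodPair.exists_homMap_coords (h : GoodPair p P Q d) (x : OnePoint F) : ∃ c : F, c ≠ 0 ∧
    heval d P x = c * hx (homMap d P Q x) ∧ heval d Q x = c * hy (homMap d P Q x) := by
  by_cases h0 : heval d Q x = 0
  · refine ⟨heval d P x, fun h1 => ?_, ?_, ?_⟩
    · have := h.max_heval x
      rw [h0, h1, absv_zero, max_self] at this
      exact (pow_pos (hnorm_pos p x) d).ne this
    · rw [homMap, if_pos h0, hx_infty, mul_one]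
    · rw [homMap, if_pos h0, hy_infty, mul_zero, h0]
  · refine ⟨heval d Q x, h0, ?_, ?_⟩
    · rw [homMap, if_neg h0, hx_some, mul_div_cancel₀ _ h0]
    · rw [homMap, if_neg h0, hy_some, mul_one]

variable [IsAlgClosed F]

theorem GoodPair.sphDist_homMap (h : GoodPair p P Q d) (x w : OnePoint F) :
    sphDist p (homMap d P Q x) w = distProd p (formRoots d (fiberPoly P Q w)) x := by
  obtain ⟨c, hc, h1, h2⟩ := h.exists_homMap_coords x
  have h3 := absv_heval p (h.natDegree_fiberPoly w) x
  have h4 : hnorm p x ^ d = absv p c * hnorm p (homMap d P Q x) := by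
    rw [← h.max_heval x, h1, h2, absv_mul, absv_mul, ← mul_max_of_nonneg _ _ (absv_nonneg p c),
      max_comm]; rfl
  have hc' := absv_pos p hc
  have hw := hnorm_pos p w
  have hm := hnorm_pos p (homMap d P Q x)
  rw [heval_fiberPoly, h.gaussN_fiberPoly, h4, h1, h2,
    show hy w * (c * hx (homMap d P Q x)) - hx w * (c * hy (homMap d P Q x)) =
      c * (hx (homMap d P Q x) * hy w - hx w * hy (homMap d P Q x)) by ring, absv_mul] at h3
  rw [sphDist_eq, div_eq_iff (mul_pos hm hw).ne']
  refine mul_left_cancel₀ hc'.ne' (h3.trans ?_)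
  ring

/-- A map with good reduction is a good map. -/
theorem GoodPair.goodMap (h : GoodPair p P Q d) : GoodMap p (homMap d P Q) d := fun w =>
  ⟨formRoots d (fiberPoly P Q w), card_formRoots (h.natDegree_fiberPoly w),
    fun y => h.sphDist_homMap y w⟩

theorem LocDeg.comp_pinv {f : OnePoint F → OnePoint F} {x : OnePoint F} {e : ℕ}
    (h : LocDeg p f (pinv x) e) : LocDeg p (f ∘ pinv) x e := by
  intro w hw
  obtain ⟨Z, h1, h2, h3⟩ := h w hw
  refine ⟨Z.map pinv, by rw [Multiset.card_map, h1], ?_, fun y hy => ?_⟩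
  · intro z hz
    obtain ⟨z', hz', rfl⟩ := Multiset.mem_map.1 hz
    rw [SameDisc, ← sphDist_pinv_pinv, pinv_pinv]
    exact h2 z' hz'
  · rw [Function.comp_apply, h3 _ (by rw [SameDisc, sphDist_pinv_pinv]; exact hy), distProd,
      distProd, Multiset.map_map]
    refine congrArg Multiset.prod (Multiset.map_congr rfl fun z _ => ?_)
    rw [Function.comp_apply, ← sphDist_pinv_pinv p y, pinv_pinv]

theorem LocDeg.pinv_comp {f : OnePoint F → OnePoint F} {x : OnePoint F} {e : ℕ}
    (h : LocDeg p f x e) : LocDeg p (pinv ∘ f) x e := by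
  intro w hw
  obtain ⟨Z, h1, h2, h3⟩ := h (pinv w) (by
    rw [SameDisc, ← sphDist_pinv_pinv, pinv_pinv]; exact hw)
  refine ⟨Z, h1, h2, fun y hy => ?_⟩
  rw [← h3 y hy, Function.comp_apply, ← sphDist_pinv_pinv p (f y), pinv_pinv]

/-- A residue disc of local degree at least `2` contains a critical point. At the center
`a`, the fibre polynomial of the image vanishes to order `2` modulo the maximal ideal, hence so does
the Wronskian to order `1`; since the Wronskian is not zero modulo the maximal ideal, it has a zero
in the disc. -/
theorem GoodPair.exists_critical_of_integral (h : GoodPair p P Q d) {a : F} (ha : absv p a ≤ 1)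
    {e : ℕ} (he : 2 ≤ e) (hl : LocDeg p (homMap d P Q) (OnePoint.some a) e) :
    ∃ z : F, absv p (z - a) < 1 ∧ (wronskian P Q).eval z = 0 := by
  classical
  set w := homMap d P Q (OnePoint.some a) with hw
  set H := fiberPoly P Q w with hH
  have hfar : ∀ z : F, SameDisc p (OnePoint.some z) (OnePoint.some a) → absv p (z - a) < 1 := by
    intro z hz
    have hz1 : absv p z ≤ 1 := by
      by_contra! h1
      refine not_lt.2 ?_ hz
      have : absv p (z - a) = absv p z := absv_sub_eq_of_lt p (ha.trans_lt h1)
      have e : sphDist p (OnePoint.some z) (OnePoint.some a) =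
        absv p (z - a) / (max 1 (absv p z) * max 1 (absv p a)) := rfl
      rw [e, this, max_eq_right h1.le, max_eq_left ha, mul_one, div_self (one_pos.trans h1).ne']
    rwa [SameDisc, sphDist_some_some p hz1 ha] at hz
  have hinf : ¬ SameDisc p (OnePoint.infty : OnePoint F) (OnePoint.some a) := by
    have e : sphDist p (OnePoint.infty : OnePoint F) (OnePoint.some a) = 1 / max 1 (absv p a) := rfl
    rw [SameDisc, e, max_eq_left ha]; simp
  have hcard := (h.goodMap.locDeg_filter (OnePoint.some a)
    (fun y => h.sphDist_homMap y w)).unique hl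
  -- two roots of `H` in the disc
  have h2 : 2 ≤ (H.roots.filter fun z => SameDisc p (OnePoint.some z) (OnePoint.some a)).card := by
    rw [← hcard, formRoots, Multiset.filter_add, Multiset.filter_map, Multiset.card_add,
      Multiset.card_map] at he
    have : ((Multiset.replicate (d - (fiberPoly P Q w).natDegree)
        (OnePoint.infty : OnePoint F)).filter fun z => SameDisc p z (OnePoint.some a)) = 0 := by
      rw [Multiset.filter_eq_nil]
      intro z hz
      rw [Multiset.eq_of_mem_replicate hz]
      exact hinf
    rw [this, Multiset.card_zero, add_zero] at he
    exact he
  obtain ⟨z₁, z₂, hZ1⟩ : ∃ z₁ z₂, {z₁, z₂} ≤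
      H.roots.filter fun z => SameDisc p (OnePoint.some z) (OnePoint.some a) := by
    obtain ⟨z₁, h₁⟩ := Multiset.card_pos_iff_exists_mem.1 (by omega : 0 <
      (H.roots.filter fun z => SameDisc p (OnePoint.some z) (OnePoint.some a)).card)
    obtain ⟨Z', h₂⟩ := Multiset.exists_cons_of_mem h₁
    rw [h₂, Multiset.card_cons] at h2
    obtain ⟨z₂, h₃⟩ := Multiset.card_pos_iff_exists_mem.1 (by omega : 0 < Z'.card)
    refine ⟨z₁, z₂, ?_⟩
    rw [h₂, Multiset.insert_eq_cons]
    exact Multiset.cons_le_cons _ (Multiset.singleton_le.2 h₃)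
  have hz₁ := (Multiset.mem_filter.1 (Multiset.mem_of_le hZ1 (by simp : z₁ ∈ {z₁, z₂}))).2
  have hz₂ := (Multiset.mem_filter.1 (Multiset.mem_of_le hZ1 (by simp : z₂ ∈ {z₁, z₂}))).2
  have hdvd : (X - C z₁) * (X - C z₂) ∣ H := by
    have := (Multiset.prod_X_sub_C_dvd_iff_le_roots (h.fiberPoly_ne_zero w) {z₁, z₂}).2
      (hZ1.trans (Multiset.filter_le _ _))
    simpa using this
  obtain ⟨S, hS⟩ := hdvd
  replace hz₁ := hfar z₁ hz₁
  replace hz₂ := hfar z₂ hz₂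
  have hn : ∀ z : F, absv p (z - a) < 1 → gaussN p (X - C z) = 1 := by
    intro z hz
    rw [gaussN_X_sub_C, hnorm_some, max_eq_left]
    rw [← sub_add_cancel z a]; exact (absv_add_le p _ _).trans (max_le hz.le ha)
  have hgS : gaussN p S = hnorm p w := by
    rw [← h.gaussN_fiberPoly w, ← hH, hS, gaussN_mul, gaussN_mul, hn z₁ hz₁, hn z₂ hz₂, one_mul,
      one_mul]
  have hwpos := hnorm_pos p w
  have hsmall : ∀ b c : F, absv p b < 1 → absv p c ≤ hnorm p w → absv p (b * c) < hnorm p w := by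
    intro b c hb hc
    rw [absv_mul]
    nlinarith [absv_nonneg p b, absv_nonneg p c]
  have hSa : absv p (S.eval a) ≤ hnorm p w := (absv_eval_le p S ha).trans hgS.le
  have hS'a : absv p ((derivative S).eval a) ≤ hnorm p w :=
    (absv_eval_le p _ ha).trans ((gaussN_derivative_le p S).trans hgS.le)
  rw [absv_sub_comm] at hz₁ hz₂
  -- `H` and its derivative are small at `a`, hence so is the Wronskian
  have hHa : absv p (H.eval a) < hnorm p w := by
    rw [hS]
    simp only [eval_mul, eval_sub, eval_X, eval_C, mul_assoc]
    exact hsmall _ _ hz₁ (hsmall _ _ hz₂ hSa).le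
  have hH'a : absv p ((derivative H).eval a) < hnorm p w := by
    rw [hS]
    simp only [derivative_mul, derivative_sub, derivative_X, derivative_C, sub_zero, one_mul,
      mul_one, eval_mul, eval_add, eval_sub, eval_X, eval_C]
    rw [add_mul]
    refine absv_add_lt p (absv_add_lt p (hsmall _ _ hz₂ hSa) (hsmall _ _ hz₁ hSa)) ?_
    rw [mul_assoc]
    exact hsmall _ _ hz₁ (hsmall _ _ hz₂ hS'a).le
  have hWsmall : ∀ E : F[X], gaussN p E ≤ 1 → absv p ((wronskian H E).eval a) < hnorm p w := by
    intro E hE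
    have e1 := (absv_eval_le p E ha).trans hE
    have e2 := (absv_eval_le p _ ha).trans ((gaussN_derivative_le p E).trans hE)
    rw [wronskian, eval_sub, eval_mul, eval_mul]
    refine absv_sub_lt p ?_ ?_ <;> rw [absv_mul]
    · exact (mul_le_of_le_one_right (absv_nonneg p _) e2).trans_lt hHa
    · exact (mul_le_of_le_one_right (absv_nonneg p _) e1).trans_lt hH'a
  have hWa : absv p ((wronskian P Q).eval a) < 1 := by
    have e1 := hWsmall Q h.gauss_le'
    have e2 := hWsmall P h.gauss_le
    rw [hH, wronskian_fiberPoly_left, eval_mul, eval_C, absv_mul] at e1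
    rw [hH, wronskian_fiberPoly_right, eval_mul, eval_C, absv_mul] at e2
    have e3 := max_lt e1 e2
    rw [← max_mul_of_nonneg _ _ (absv_nonneg p _)] at e3
    change hnorm p w * _ < _ at e3
    by_contra! e4
    exact absurd e3 (not_lt.2 (le_mul_of_one_le_right hwpos.le e4))
  have hW0 : wronskian P Q ≠ 0 := by
    intro h0
    have := h.wronskian_ge
    rw [h0, show gaussN p (0 : F[X]) = 0 by simpa [absv_zero] using gaussN_C p (0 : F)] at this
    linarith
  -- by the product formula the Wronskian would not be small at `a` without a zero in the disc
  have hprod := absv_heval p (le_refl (wronskian P Q).natDegree) (OnePoint.some a)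
  rw [heval_some, hnorm_some, max_eq_left ha, one_pow, mul_one, formRoots, Nat.sub_self,
    Multiset.replicate_zero, add_zero] at hprod
  by_contra! hcon
  refine absurd hWa (not_lt.2 ?_)
  rw [hprod]
  have hone : distProd p ((wronskian P Q).roots.map OnePoint.some) (OnePoint.some a) = 1 := by
    have := distProd_eq_pow p (Z := (wronskian P Q).roots.map OnePoint.some)
      (y := OnePoint.some a) (r := 1) fun z hz => by
      obtain ⟨t, ht, rfl⟩ := Multiset.mem_map.1 hz
      refine sphDist_eq_one_of_not fun hs => hcon t (hfar t hs.symm) ?_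
      exact (mem_roots hW0).1 ht
    rw [this, one_pow]
  rw [hone, mul_one]
  exact h.wronskian_ge

variable (P Q d) in
/-- The critical points of `P / Q`, at infinity in terms of the reflected polynomials. -/
def CritPair : OnePoint F → Prop
  | OnePoint.infty => (wronskian (reflect d P) (reflect d Q)).eval 0 = 0
  | OnePoint.some x => (wronskian P Q).eval x = 0

theorem GoodPair.exists_critical (h : GoodPair p P Q d) {x : OnePoint F} {e : ℕ} (he : 2 ≤ e)
    (hl : LocDeg p (homMap d P Q) x e) : ∃ c, SameDisc p c x ∧ CritPair P Q d c := by
  have hsd : ∀ z a : F, absv p a ≤ 1 → absv p (z - a) < 1 →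
      SameDisc p (OnePoint.some z) (OnePoint.some a) := by
    intro z a ha hz
    have hz1 : absv p z ≤ 1 := by
      rw [← sub_add_cancel z a]; exact (absv_add_le p _ _).trans (max_le hz.le ha)
    rwa [SameDisc, sphDist_some_some p hz1 ha]
  rcases integral_or_pinv_integral p x with ⟨a, ha, rfl⟩ | ⟨a, ha, rfl⟩
  · obtain ⟨z, h1, h2⟩ := h.exists_critical_of_integral ha he hl
    exact ⟨OnePoint.some z, hsd z a ha h1, h2⟩
  · have hl' : LocDeg p (homMap d (reflect d P) (reflect d Q)) (OnePoint.some a) e := by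
      have := hl.comp_pinv
      rwa [show homMap d P Q ∘ pinv = homMap d (reflect d P) (reflect d Q) from
        funext (homMap_pinv h)] at this
    obtain ⟨z, h1, h2⟩ := h.reflected.exists_critical_of_integral ha.le he hl'
    refine ⟨pinv (OnePoint.some z), ?_, ?_⟩
    · rw [SameDisc, sphDist_pinv_pinv]; exact hsd z a ha.le h1
    · by_cases hz : z = 0
      · subst hz; rw [pinv_zero]; exact h2
      · rw [pinv_some hz]
        exact wronskian_eval_inv h.deg_le h.deg_le' hz h2

theorem GoodPair.two_le_ldeg (h : GoodPair p P Q d) {c : OnePoint F} (hc : CritPair P Q d c) :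
    2 ≤ ldeg p (homMap d P Q) c := by
  classical
  have key : ∀ {P Q : F[X]}, GoodPair p P Q d → ∀ t : F, (wronskian P Q).eval t = 0 →
      2 ≤ ldeg p (homMap d P Q) (OnePoint.some t) := by
    intro P Q h t ht
    set w := homMap d P Q (OnePoint.some t) with hw
    obtain ⟨c, hc, h1, h2⟩ := h.exists_homMap_coords (OnePoint.some t)
    rw [heval_some, ← hw] at h1 h2
    have e1 : (fiberPoly P Q w).eval t = 0 := by
      simp only [fiberPoly, eval_sub, eval_mul, eval_C, h1, h2]; ring
    have e2 : (derivative (fiberPoly P Q w)).eval t = 0 := by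
      simp only [fiberPoly, derivative_sub, derivative_C_mul, eval_sub, eval_mul, eval_C]
      rw [wronskian, eval_sub, eval_mul, eval_mul, h1, h2] at ht
      refine mul_left_cancel₀ hc ?_
      linear_combination -ht
    have e3 := (one_lt_rootMultiplicity_iff_isRoot (h.fiberPoly_ne_zero w)).2 ⟨e1, e2⟩
    rw [(h.goodMap.ldeg_spec _).unique
      (h.goodMap.locDeg_filter (OnePoint.some t) (fun y => h.sphDist_homMap y w))]
    calc 2 ≤ (fiberPoly P Q w).roots.count t := by rw [count_roots]; exact e3
      _ ≤ (formRoots d (fiberPoly P Q w)).count (OnePoint.some t) := by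
        rw [formRoots, Multiset.count_add]
        exact (Multiset.count_map_eq_count' OnePoint.some _ (OnePoint.coe_injective) t).ge.trans
          (Nat.le_add_right _ _)
      _ = ((formRoots d (fiberPoly P Q w)).filter fun z =>
          SameDisc p z (OnePoint.some t)).count (OnePoint.some t) :=
        (Multiset.count_filter_of_pos (p := fun z => SameDisc p z (OnePoint.some t))
          (SameDisc.refl _)).symm
      _ ≤ _ := Multiset.count_le_card _ _
  induction c using OnePoint.rec with
  | coe t => exact key h t hc
  | infty =>
    have h1 := key h.reflected 0 hc
    have h2 := (h.reflected.goodMap.ldeg_spec (OnePoint.some 0))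
    have h3 : LocDeg p (homMap d P Q ∘ pinv) (OnePoint.some 0)
        (ldeg p (homMap d P Q) (pinv (OnePoint.some 0))) :=
      (h.goodMap.ldeg_spec _).comp_pinv
    rw [show homMap d P Q ∘ pinv = homMap d (reflect d P) (reflect d Q) from
        funext (homMap_pinv h), pinv_zero] at h3
    rwa [← h2.unique h3]

theorem GoodPair.finite_crit (h : GoodPair p P Q d) : {c | CritPair P Q d c}.Finite := by
  have hW0 : wronskian P Q ≠ 0 := by
    intro h0
    have := h.wronskian_ge
    rw [h0, show gaussN p (0 : F[X]) = 0 by simpa [absv_zero] using gaussN_C p (0 : F)] at this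
    linarith
  classical
  refine Set.Finite.subset (((wronskian P Q).roots.toFinset.image OnePoint.some ∪
    {OnePoint.infty} : Finset (OnePoint F)).finite_toSet) fun c hc => ?_
  induction c using OnePoint.rec with
  | infty => simp
  | coe t =>
    simp only [Finset.coe_union, Finset.coe_image, Finset.coe_singleton]
    refine Or.inl ⟨t, ?_, rfl⟩
    rw [Finset.mem_coe, Multiset.mem_toFinset, mem_roots hW0]
    exact hc

end GoodPair

/-! ### Rational maps over a `p`-adic field -/

section Reduction

variable (p : ℕ) [Fact p.Prime] {K : Type*} [Field K] [Algebra ℚ_[p] K]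
  [FiniteDimensional ℚ_[p] K]

instance isAlgebraic_algebraicClosure : Algebra.IsAlgebraic ℚ_[p] (AlgebraicClosure K) :=
  algebraic_bar p

theorem absv_bar (x : K) : absv p (algebraMap K (AlgebraicClosure K) x) = absv p x :=
  absv_algebraMap p x

theorem gaussN_bar (A : K[X]) :
    gaussN p (A.map (algebraMap K (AlgebraicClosure K))) = gaussN p A := by
  refine le_antisymm ((gaussN_le_iff p).2 fun i => ?_) ((gaussN_le_iff p).2 fun i => ?_)
  · rw [coeff_map, absv_bar]; exact le_gaussN p A i
  · rw [← absv_bar, ← coeff_map]; exact le_gaussN p _ i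

theorem map_residue_eq_zero_iff (A : (intRing p K)[X]) :
    A.map (IsLocalRing.residue (intRing p K)) = 0 ↔ gaussN p (A.map (intRing p K).subtype) < 1 := by
  constructor
  · intro h
    obtain ⟨i, hi⟩ := exists_eq_gaussN p (A.map (intRing p K).subtype)
    rw [hi, coeff_map]
    refine (residue_eq_zero_iff p _).1 ?_
    rw [← coeff_map, h, coeff_zero]
  · intro h
    ext i
    rw [coeff_map, coeff_zero, residue_eq_zero_iff]
    refine lt_of_le_of_lt ?_ h
    have := le_gaussN p (A.map (intRing p K).subtype) i
    rwa [coeff_map] at this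

theorem gaussN_subtype_le (A : (intRing p K)[X]) : gaussN p (A.map (intRing p K).subtype) ≤ 1 := by
  rw [gaussN_le_iff]
  intro i
  rw [coeff_map]
  exact (A.coeff i).2

/-- In degree less than `p` the reduction is separable, because coprime polynomials with vanishing
Wronskian have vanishing derivatives. -/
theorem goodPair_of_residue {P Q : (intRing p K)[X]} {d : ℕ} (hd : 1 ≤ d) (hdp : d < p)
    (hP : P.natDegree ≤ d) (hQ : Q.natDegree ≤ d)
    (hco : IsCoprime (P.map (IsLocalRing.residue (intRing p K)))
      (Q.map (IsLocalRing.residue (intRing p K))))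
    (hmax : max (P.map (IsLocalRing.residue (intRing p K))).natDegree
      (Q.map (IsLocalRing.residue (intRing p K))).natDegree = d) :
    GoodPair p ((P.map (intRing p K).subtype).map (algebraMap K (AlgebraicClosure K)))
      ((Q.map (intRing p K).subtype).map (algebraMap K (AlgebraicClosure K))) d where
  deg_le := natDegree_map_le.trans (natDegree_map_le.trans hP)
  deg_le' := natDegree_map_le.trans (natDegree_map_le.trans hQ)
  gauss_le := (gaussN_bar p _).trans_le (gaussN_subtype_le p P)
  gauss_le' := (gaussN_bar p _).trans_le (gaussN_subtype_le p Q)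
  eval_ge := by
    intro a ha
    obtain ⟨s, t, hst⟩ := hco
    obtain ⟨S, rfl⟩ := map_surjective _ IsLocalRing.residue_surjective s
    obtain ⟨T, rfl⟩ := map_surjective _ IsLocalRing.residue_surjective t
    have h1 : gaussN p ((S * P + T * Q - 1).map (intRing p K).subtype) < 1 := by
      rw [← map_residue_eq_zero_iff, Polynomial.map_sub, Polynomial.map_add, Polynomial.map_mul,
        Polynomial.map_mul, hst, Polynomial.map_one, sub_self]
    rw [← gaussN_bar] at h1
    have h2 := (absv_eval_le p _ ha).trans_lt h1
    simp only [Polynomial.map_sub, Polynomial.map_add, Polynomial.map_mul, Polynomial.map_one,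
      eval_sub, eval_add, eval_mul, eval_one] at h2
    have hle : ∀ A : (intRing p K)[X], absv p (((A.map (intRing p K).subtype).map
        (algebraMap K (AlgebraicClosure K))).eval a) ≤ 1 := fun A =>
      (absv_eval_le p _ ha).trans ((gaussN_bar p _).trans_le (gaussN_subtype_le p A))
    have hS := hle S
    have hT := hle T
    by_contra! h3
    obtain ⟨h4, h5⟩ := max_lt_iff.1 h3
    have h6 : ∀ b c : AlgebraicClosure K, absv p b ≤ 1 → absv p c < 1 → absv p (b * c) < 1 := by
      intro b c hb hc
      rw [absv_mul]
      nlinarith [absv_nonneg p b, absv_nonneg p c]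
    have h7 := absv_sub_lt p (absv_add_lt p (h6 _ _ hS h4) (h6 _ _ hT h5)) h2
    rw [sub_sub_cancel, absv_one] at h7
    exact lt_irrefl _ h7
  top_ge := by
    have key : ∀ A : (intRing p K)[X],
        (A.map (IsLocalRing.residue (intRing p K))).natDegree = d →
        1 ≤ absv p (((A.map (intRing p K).subtype).map
          (algebraMap K (AlgebraicClosure K))).coeff d) := by
      intro A hA
      rw [coeff_map, absv_bar, coeff_map]
      by_contra! h
      have h1 := (residue_eq_zero_iff p (A.coeff d)).2 h
      rw [← coeff_map] at h1
      have h2 : A.map (IsLocalRing.residue (intRing p K)) ≠ 0 := by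
        intro h0
        rw [h0, natDegree_zero] at hA
        omega
      refine h2 (leadingCoeff_eq_zero.1 ?_)
      rw [leadingCoeff, hA, h1]
    rcases max_choice (P.map (IsLocalRing.residue (intRing p K))).natDegree
      (Q.map (IsLocalRing.residue (intRing p K))).natDegree with h | h
    · exact (key P (h ▸ hmax)).trans (le_max_left _ _)
    · exact (key Q (h ▸ hmax)).trans (le_max_right _ _)
  wronskian_ge := by
    have hw : ∀ {R S : Type _} [CommRing R] [CommRing S] (φ : R →+* S) (A B : R[X]),
        wronskian (A.map φ) (B.map φ) = (wronskian A B).map φ := by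
      intro R S _ _ φ A B
      simp [wronskian, derivative_map]
    rw [hw, hw, gaussN_bar]
    by_contra! h
    rw [← map_residue_eq_zero_iff, ← hw, hco.wronskian_eq_zero_iff] at h
    have key : ∀ A : (IsLocalRing.ResidueField (intRing p K))[X], A.natDegree ≤ d →
        derivative A = 0 → A.natDegree = 0 := by
      intro A hA h0
      by_contra hne
      have h1 := congrArg (coeff · (A.natDegree - 1)) h0
      have hpos : 1 ≤ A.natDegree := Nat.one_le_iff_ne_zero.2 hne
      simp only [coeff_derivative, coeff_zero, Nat.sub_add_cancel hpos] at h1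
      rcases mul_eq_zero.1 h1 with h2 | h2
      · rw [coeff_natDegree, leadingCoeff_eq_zero] at h2
        rw [h2, natDegree_zero] at hne
        exact hne rfl
      · have h3 : IsLocalRing.residue (intRing p K) (A.natDegree : intRing p K) = 0 := by
          rw [map_natCast, ← h2]
          exact_mod_cast congrArg (Nat.cast : ℕ → IsLocalRing.ResidueField (intRing p K))
            (Nat.sub_add_cancel hpos).symm
        rw [residue_eq_zero_iff] at h3
        have hcop : A.natDegree.Coprime p :=
          (((Fact.out : p.Prime).coprime_iff_not_dvd).2 fun hdvd =>
            absurd (Nat.le_of_dvd hpos hdvd) (by omega)).symm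
        have h4 := absv_natCast_eq_one (F := K) p hcop
        push_cast at h3
        exact absurd h4 h3.ne
    have h1 := key _ (natDegree_map_le.trans hP) h.1
    have h2 := key _ (natDegree_map_le.trans hQ) h.2
    rw [h1, h2, max_self] at hmax
    omega

end Reduction

section RationalMap

variable {K : Type*} [Field K] {f : RatFunc K}

open Classical in
theorem mapBar_infty (f : RatFunc K) : mapBar f OnePoint.infty =
    if algebraMap K (AlgebraicClosure K) (f.denom.coeff (ratDegree f)) = 0 then OnePoint.infty
    else OnePoint.some (algebraMap K (AlgebraicClosure K) (f.num.coeff (ratDegree f)) /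
      algebraMap K (AlgebraicClosure K) (f.denom.coeff (ratDegree f))) := rfl

open Classical in
theorem mapBar_some (f : RatFunc K) (t : AlgebraicClosure K) : mapBar f (OnePoint.some t) =
    if aeval t f.denom = 0 then OnePoint.infty
    else OnePoint.some (aeval t f.num / aeval t f.denom) := rfl

theorem mapBar_eq_homMap_of_scale {P Q : (AlgebraicClosure K)[X]} {a : AlgebraicClosure K}
    (ha : a ≠ 0) (hP : P = C a * f.num.map (algebraMap K (AlgebraicClosure K)))
    (hQ : Q = C a * f.denom.map (algebraMap K (AlgebraicClosure K))) :
    mapBar f = homMap (ratDegree f) P Q := by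
  funext x
  induction x using OnePoint.rec with
  | infty =>
    have e : ∀ A : K[X], (C a * A.map (algebraMap K (AlgebraicClosure K))).coeff (ratDegree f) =
        a * algebraMap K (AlgebraicClosure K) (A.coeff (ratDegree f)) := fun A => by
      rw [coeff_C_mul, coeff_map]
    rw [mapBar_infty, homMap, heval_infty, heval_infty, hP, hQ, e, e, mul_div_mul_left _ _ ha]
    by_cases h : algebraMap K (AlgebraicClosure K) (f.denom.coeff (ratDegree f)) = 0
    · rw [if_pos h, if_pos (by rw [h, mul_zero])]
    · rw [if_neg h, if_neg (mul_ne_zero ha h)]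
  | coe t =>
    have e : ∀ A : K[X], (C a * A.map (algebraMap K (AlgebraicClosure K))).eval t =
        a * aeval t A := fun A => by
      rw [eval_mul, eval_C, eval_map_algebraMap]
    change mapBar f (OnePoint.some t) = homMap _ _ _ (OnePoint.some t)
    rw [mapBar_some, homMap, heval_some, heval_some, hP, hQ, e, e, mul_div_mul_left _ _ ha]
    by_cases h : aeval t f.denom = 0
    · rw [if_pos h, if_pos (by rw [h, mul_zero])]
    · rw [if_neg h, if_neg (mul_ne_zero ha h)]

theorem isCrit_iff_critPair {P Q : (AlgebraicClosure K)[X]} {a : AlgebraicClosure K}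
    (ha : a ≠ 0) (hP : P = C a * f.num.map (algebraMap K (AlgebraicClosure K)))
    (hQ : Q = C a * f.denom.map (algebraMap K (AlgebraicClosure K))) (x : P1bar K) :
    IsCrit f x ↔ CritPair P Q (ratDegree f) x := by
  have hw : ∀ A B : K[X], wronskian (C a * A.map (algebraMap K (AlgebraicClosure K)))
      (C a * B.map (algebraMap K (AlgebraicClosure K))) =
      C (a * a) * (wronskian A B).map (algebraMap K (AlgebraicClosure K)) := by
    intro A B
    simp only [wronskian, derivative_C_mul, derivative_map, Polynomial.map_sub, Polynomial.map_mul,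
      map_mul]
    ring
  have hr : ∀ A : K[X], ∀ N, reflect N (C a * A.map (algebraMap K (AlgebraicClosure K))) =
      C a * (reflect N A).map (algebraMap K (AlgebraicClosure K)) := by
    intro A N
    rw [reflect_C_mul, reflect_map]
  induction x using OnePoint.rec with
  | infty =>
    change aeval (0 : AlgebraicClosure K) _ = 0 ↔ eval 0 _ = 0
    rw [hP, hQ, hr, hr, hw, eval_mul, eval_C, eval_map_algebraMap, mul_eq_zero]
    simp [ha]
  | coe t =>
    change aeval t _ = 0 ↔ eval t _ = 0
    rw [hP, hQ, hw, eval_mul, eval_C, eval_map_algebraMap, mul_eq_zero]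
    simp [ha]

/-! ### The Galois action -/

theorem toBar_injective : Function.Injective (toBar : OnePoint K → P1bar K) := by
  intro x y h
  induction x using OnePoint.rec <;> induction y using OnePoint.rec
  · rfl
  · exact absurd h.symm (OnePoint.coe_ne_infty _)
  · exact absurd h (OnePoint.coe_ne_infty _)
  · exact congrArg OnePoint.some ((algebraMap K (AlgebraicClosure K)).injective
      (OnePoint.coe_injective h))

theorem gal_toBar (σ : GalBar K) (x : OnePoint K) : gal σ (toBar x) = toBar x := by
  induction x using OnePoint.rec with
  | infty => rfl
  | coe x => exact congrArg OnePoint.some (σ.commutes x)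

theorem gal_infty (σ : GalBar K) : gal σ (OnePoint.infty : P1bar K) = OnePoint.infty := rfl
theorem gal_some (σ : GalBar K) (x : AlgebraicClosure K) :
    gal σ (OnePoint.some x) = OnePoint.some (σ x) := rfl

theorem mapBar_gal (f : RatFunc K) (σ : GalBar K) (x : P1bar K) :
    mapBar f (gal σ x) = gal σ (mapBar f x) := by
  induction x using OnePoint.rec with
  | infty =>
    rw [gal_infty, mapBar_infty]
    split_ifs
    · rfl
    · rw [gal_some, map_div₀, σ.commutes, σ.commutes]
  | coe t =>
    change mapBar f (OnePoint.some (σ t)) = gal σ (mapBar f (OnePoint.some t))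
    have h : ∀ A : K[X], aeval (σ t) A = σ (aeval t A) := fun A => aeval_algHom_apply σ.toAlgHom t A
    rw [mapBar_some, mapBar_some, h, h]
    by_cases h0 : aeval t f.denom = 0
    · rw [if_pos h0, if_pos (by rw [h0, map_zero])]; rfl
    · rw [if_neg h0, if_neg (by rwa [map_eq_zero]), gal_some, map_div₀]

theorem mapBar_iterate_gal (f : RatFunc K) (σ : GalBar K) (n : ℕ) (x : P1bar K) :
    (mapBar f)^[n] (gal σ x) = gal σ ((mapBar f)^[n] x) := by
  induction n generalizing x with
  | zero => rfl
  | succ n ih => rw [Function.iterate_succ_apply, mapBar_gal, ih, Function.iterate_succ_apply]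

/-- A point fixed by the absolute Galois group is rational. -/
theorem exists_toBar_of_fixed [CharZero K] {x : P1bar K} (h : ∀ σ : GalBar K, gal σ x = x) :
    ∃ y : OnePoint K, toBar y = x := by
  induction x using OnePoint.rec with
  | infty => exact ⟨OnePoint.infty, rfl⟩
  | coe t =>
    have : ∀ σ : GalBar K, σ t = t := fun σ => OnePoint.coe_injective (h σ)
    obtain ⟨y, hy⟩ := (InfiniteGalois.mem_bot_iff_fixed t).2 this
    exact ⟨OnePoint.some y, congrArg OnePoint.some hy⟩

theorem exists_toBar_mapBar [CharZero K] (f : RatFunc K) (n : ℕ) (x : OnePoint K) :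
    ∃ y : OnePoint K, toBar y = (mapBar f)^[n] (toBar x) :=
  exists_toBar_of_fixed fun σ => by rw [← mapBar_iterate_gal, gal_toBar]

end RationalMap

section GoodReduction

variable (p : ℕ) [Fact p.Prime] {K : Type*} [Field K] [Algebra ℚ_[p] K]
  [FiniteDimensional ℚ_[p] K] {f : RatFunc K}

theorem absv_gal (σ : GalBar K) (x : AlgebraicClosure K) : absv p (σ x) = absv p x :=
  absv_algEquiv p (σ.restrictScalars ℚ_[p]) x

theorem sphDist_gal (σ : GalBar K) (x y : P1bar K) :
    sphDist p (gal σ x) (gal σ y) = sphDist p x y := by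
  have h1 : ∀ x : P1bar K, hx (gal σ x) = σ (hx x) ∧ hy (gal σ x) = σ (hy x) := by
    intro x
    induction x using OnePoint.rec with
    | infty => exact ⟨(map_one σ).symm, (map_zero σ).symm⟩
    | coe x => exact ⟨rfl, (map_one σ).symm⟩
  rw [sphDist_eq, sphDist_eq, hnorm, hnorm, hnorm, hnorm, (h1 x).1, (h1 x).2, (h1 y).1, (h1 y).2,
    ← map_mul, ← map_mul, ← map_sub]
  simp only [absv_gal]

theorem sphDist_toBar (x y : OnePoint K) : sphDist p (toBar x) (toBar y) = sphDist p x y := by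
  have h1 : ∀ x : OnePoint K, hx (toBar x) = algebraMap K (AlgebraicClosure K) (hx x) ∧
      hy (toBar x) = algebraMap K (AlgebraicClosure K) (hy x) := by
    intro x
    induction x using OnePoint.rec with
    | infty => exact ⟨(map_one _).symm, (map_zero _).symm⟩
    | coe x => exact ⟨rfl, (map_one _).symm⟩
  rw [sphDist_eq, sphDist_eq, hnorm, hnorm, hnorm, hnorm, (h1 x).1, (h1 x).2, (h1 y).1, (h1 y).2,
    ← map_mul, ← map_mul, ← map_sub]
  simp only [absv_bar]

variable {p}

theorem SameDisc.gal {x y : P1bar K} (σ : GalBar K) (h : SameDisc p x y) :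
    SameDisc p (Arboreal.gal σ x) (Arboreal.gal σ y) := by
  rwa [SameDisc, sphDist_gal]

theorem redBar_eq_iff {x y : P1bar K} : redBar p x = redBar p y ↔ SameDisc p x y :=
  red_eq_iff p x y

variable (p) in
/-- The part of the theory of a map with good reduction that the dynamical arguments use. -/
structure TameMap (f : RatFunc K) : Prop where
  goodMap : GoodMap p (mapBar f) (ratDegree f)
  exists_crit : ∀ x, 2 ≤ ldeg p (mapBar f) x → ∃ c, SameDisc p c x ∧ IsCrit f c
  two_le_ldeg : ∀ c, IsCrit f c → 2 ≤ ldeg p (mapBar f) c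
  finite_crit : {c | IsCrit f c}.Finite

theorem HasGoodReduction.exists_goodPair (hd : 1 ≤ ratDegree f) (hdp : ratDegree f < p)
    (hf : HasGoodReduction p f) :
    ∃ (P Q : (AlgebraicClosure K)[X]) (a : AlgebraicClosure K), a ≠ 0 ∧
      P = C a * f.num.map (algebraMap K (AlgebraicClosure K)) ∧
      Q = C a * f.denom.map (algebraMap K (AlgebraicClosure K)) ∧
      GoodPair p P Q (ratDegree f) := by
  obtain ⟨P, Q, a, ha, hP, hQ, hco, hmax⟩ := hf
  have hinj : Function.Injective (intRing p K).subtype := Subtype.coe_injective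
  refine ⟨_, _, algebraMap K (AlgebraicClosure K) a, by simpa using ha, ?_, ?_,
    goodPair_of_residue p hd hdp ?_ ?_ hco hmax⟩
  · rw [hP, Polynomial.map_mul, map_C]
  · rw [hQ, Polynomial.map_mul, map_C]
  · rw [← natDegree_map_eq_of_injective hinj, hP, natDegree_C_mul ha]; exact le_max_left _ _
  · rw [← natDegree_map_eq_of_injective hinj, hQ, natDegree_C_mul ha]; exact le_max_right _ _

theorem HasGoodReduction.tameMap (hd : 1 ≤ ratDegree f) (hdp : ratDegree f < p)
    (hf : HasGoodReduction p f) : TameMap p f := by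
  obtain ⟨P, Q, a, ha, hP, hQ, h⟩ := hf.exists_goodPair hd hdp
  have e1 := mapBar_eq_homMap_of_scale ha hP hQ
  have e2 := isCrit_iff_critPair ha hP hQ
  refine ⟨e1 ▸ h.goodMap, fun x hx => ?_, fun c hc => ?_, ?_⟩
  · obtain ⟨c, h1, h2⟩ := h.exists_critical hx (by rw [e1]; exact h.goodMap.ldeg_spec x)
    exact ⟨c, h1, (e2 c).2 h2⟩
  · rw [e1]; exact h.two_le_ldeg ((e2 c).1 hc)
  · simpa only [e2] using h.finite_crit

end GoodReduction

/-! ### Value groups -/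

section ValueGroup

variable (p : ℕ) [Fact p.Prime] {F : Type*} [Field F] [Algebra ℚ_[p] F]
  [Algebra.IsAlgebraic ℚ_[p] F]

theorem absv_sum_eq_of_lt {ι : Type*} [DecidableEq ι] (s : Finset ι) (g : ι → F) {k : ι}
    (hk : k ∈ s) (h0 : 0 < absv p (g k))
    (h : ∀ i ∈ s, i ≠ k → absv p (g i) < absv p (g k)) :
    absv p (∑ i ∈ s, g i) = absv p (g k) := by
  rw [← Finset.add_sum_erase s g hk]
  exact absv_add_eq_of_lt p (absv_sum_lt p _ _ h0 fun i hi =>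
    h i (Finset.mem_of_mem_erase hi) (Finset.ne_of_mem_erase hi))

/-- Elements of a vector space whose absolute values lie in different cosets of the value group of
the scalars are linearly independent. The additive maps `φ` and `ν` embed the vector space and the
scalars in `F`. -/
theorem relIndex_le_finrank {A W : Type*} [Field A] [AddCommGroup W] [Module A W]
    [FiniteDimensional A W] (ν : A → F) (φ : W →+ F) (hφ : ∀ c w, φ (c • w) = ν c * φ w)
    {V' V : Subgroup ℝˣ} (h' : ∀ c, c ≠ 0 → ∃ u ∈ V', absv p (ν c) = (u : ℝ))
    (h : ∀ u ∈ V, ∃ w, absv p (φ w) = (u : ℝ)) :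
    V'.relIndex V ≠ 0 ∧ V'.relIndex V ≤ Module.finrank A W := by
  classical
  choose! w hw using h
  set v : V ⧸ V'.subgroupOf V → W := fun q => w (q.out : V) with hv
  have hvq : ∀ q, absv p (φ (v q)) = ((q.out : V) : ℝˣ) := fun q => hw _ (q.out : V).2
  have hli : LinearIndependent A v := by
    rw [linearIndependent_iff']
    intro s g hsum i hi
    by_contra hgi
    -- the terms of a linear relation have different absolute values, so the largest one survives
    set s' := s.filter (fun j => g j ≠ 0) with hs'
    have hsum' : ∑ j ∈ s', φ (g j • v j) = 0 := by
      rw [← map_sum, ← map_zero φ, ← hsum]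
      congr 1
      refine Finset.sum_subset (Finset.filter_subset _ _) fun j _ hj' => ?_
      have : g j = 0 := by
        by_contra hg
        exact hj' (Finset.mem_filter.2 ⟨‹_›, hg⟩)
      rw [this, zero_smul]
    have hpos : ∀ j ∈ s', 0 < absv p (φ (g j • v j)) := by
      intro j hj
      obtain ⟨u, -, hu⟩ := h' (g j) (Finset.mem_filter.1 hj).2
      have hne : absv p (φ (g j • v j)) ≠ 0 := by
        rw [hφ, absv_mul, hu, hvq]
        exact mul_ne_zero u.ne_zero (Units.ne_zero _)
      exact lt_of_le_of_ne (absv_nonneg p _) hne.symm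
    have hdist : ∀ j ∈ s', ∀ k ∈ s', j ≠ k →
        absv p (φ (g j • v j)) ≠ absv p (φ (g k • v k)) := by
      intro j hj k hk hjk heq
      obtain ⟨u, hu, hu'⟩ := h' (g j) (Finset.mem_filter.1 hj).2
      obtain ⟨u₁, hu₁, hu₁'⟩ := h' (g k) (Finset.mem_filter.1 hk).2
      rw [hφ, hφ, absv_mul, absv_mul, hu', hu₁', hvq, hvq] at heq
      have heq' : u * ((j.out : V) : ℝˣ) = u₁ * ((k.out : V) : ℝˣ) := Units.ext (by simpa using heq)
      apply hjk
      rw [← QuotientGroup.out_eq' j, ← QuotientGroup.out_eq' k, QuotientGroup.eq,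
        Subgroup.mem_subgroupOf]
      have : (((j.out : V)⁻¹ * (k.out : V) : V) : ℝˣ) = u₁⁻¹ * u := by
        push_cast
        rw [inv_mul_eq_iff_eq_mul, mul_left_comm, mul_comm _ u, heq', inv_mul_cancel_left]
      rw [this]
      exact V'.mul_mem (V'.inv_mem hu₁) hu
    obtain ⟨k, hk, hmax⟩ := Finset.exists_max_image s' (fun j => absv p (φ (g j • v j)))
      ⟨i, Finset.mem_filter.2 ⟨hi, hgi⟩⟩
    have := absv_sum_eq_of_lt p s' (fun j => φ (g j • v j)) hk (hpos k hk) fun j hj hjk =>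
      lt_of_le_of_ne (hmax j hj) (hdist j hj k hk hjk)
    rw [hsum', absv_zero] at this
    exact absurd this (hpos k hk).ne
  have hfin : Finite (V ⧸ V'.subgroupOf V) := hli.finite_of_isNoetherian
  have := Fintype.ofFinite (V ⧸ V'.subgroupOf V)
  have hc : V'.relIndex V = Fintype.card (V ⧸ V'.subgroupOf V) := by
    rw [Subgroup.relIndex, Subgroup.index, Nat.card_eq_fintype_card]
  rw [hc]
  exact ⟨Fintype.card_ne_zero, hli.fintype_card_le_finrank⟩

theorem injective_zpow_of_pos {g : ℝˣ} (hg : 0 < (g : ℝ)) (hg1 : g ≠ 1) :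
    Function.Injective fun n : ℤ => g ^ n := by
  intro a b hab
  have h1 : (g : ℝ) ≠ 1 := fun h => hg1 (Units.ext h)
  refine zpow_right_injective₀ hg h1 ?_
  have := congrArg (Units.val) hab
  simpa using this

theorem relIndex_zpowers_zpow {g : ℝˣ} (hg : 0 < (g : ℝ)) (hg1 : g ≠ 1) (n : ℤ) :
    (Subgroup.zpowers (g ^ n)).relIndex (Subgroup.zpowers g) = n.natAbs := by
  have hinj := injective_zpow_of_pos hg hg1
  have h1 : Subgroup.zpowers (g ^ n) =
      (Subgroup.zpowers (Multiplicative.ofAdd n)).map (zpowersHom ℝˣ g) := by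
    rw [MonoidHom.map_zpowers]; rfl
  have h2 : Subgroup.zpowers g = (⊤ : Subgroup (Multiplicative ℤ)).map (zpowersHom ℝˣ g) := by
    rw [← MonoidHom.range_eq_map]; rfl
  rw [h1, h2, Subgroup.relIndex_map_map_of_injective _ _ (by
    intro a b hab; exact hinj hab), Subgroup.relIndex_top_right]
  exact Int.index_zmultiples n

end ValueGroup

section Ramification

variable (p : ℕ) [Fact p.Prime] {K : Type*} [Field K] [Algebra ℚ_[p] K]
  [FiniteDimensional ℚ_[p] K]

theorem pos_of_mem_valueGroup {L : IntermediateField K (AlgebraicClosure K)} {u : ℝˣ}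
    (hu : u ∈ valueGroup p L) : 0 < (u : ℝ) := by
  obtain ⟨x, -, h⟩ := hu
  exact lt_of_le_of_ne (h ▸ absv_nonneg p x) u.ne_zero.symm

theorem valueGroup_mono {L M : IntermediateField K (AlgebraicClosure K)} (h : L ≤ M) :
    valueGroup p L ≤ valueGroup p M := fun _ ⟨x, hx, hu⟩ => ⟨x, h hx, hu⟩

theorem ramIndex_le_relfinrank {L M : IntermediateField K (AlgebraicClosure K)} (h : L ≤ M)
    [FiniteDimensional K M] : ramIndex p L M ≠ 0 ∧ ramIndex p L M ≤ L.relfinrank M := by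
  rw [IntermediateField.relfinrank_eq_finrank_of_le h]
  have : FiniteDimensional K (IntermediateField.extendScalars h) :=
    inferInstanceAs (FiniteDimensional K M)
  have : FiniteDimensional L (IntermediateField.extendScalars h) :=
    Module.Finite.of_restrictScalars_finite K L _
  refine relIndex_le_finrank p (fun c : L => (c : AlgebraicClosure K))
    (AddMonoidHomClass.toAddMonoidHom (IntermediateField.extendScalars h).val) (fun c w => ?_)
    (fun c hc => ?_) fun u hu => ?_
  · simp [Algebra.smul_def]
  · exact ⟨Units.mk0 (absv p (c : AlgebraicClosure K)) (absv_pos p (by simpa using hc)).ne',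
      ⟨c, c.2, rfl⟩, rfl⟩
  · obtain ⟨x, hx, hu⟩ := hu
    exact ⟨⟨x, hx⟩, hu⟩

/-- Value groups of finite extensions are discrete: every nontrivial element generates a subgroup
of finite index. -/
theorem relIndex_zpowers_valueGroup_ne_zero (L : IntermediateField K (AlgebraicClosure K))
    [FiniteDimensional K L] {g : ℝˣ} (hg : g ∈ valueGroup p L) (hg1 : g ≠ 1) :
    (Subgroup.zpowers g).relIndex (valueGroup p L) ≠ 0 := by
  have : IsScalarTower ℚ_[p] K L := by infer_instance
  have : FiniteDimensional ℚ_[p] L := FiniteDimensional.trans ℚ_[p] K L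
  have hp0 := absv_prime_pos (F := AlgebraicClosure K) p
  have hp1 := absv_prime_lt_one (F := AlgebraicClosure K) p
  -- the value group of `ℚ_[p]`, generated by `π`, has finite index, so that some power of `g` is a
  -- power `π ^ j`
  set π : ℝˣ := Units.mk0 _ hp0.ne' with hπ
  have hπ1 : π ≠ 1 := fun h => hp1.ne (congrArg Units.val h)
  have hπV : (Subgroup.zpowers π).relIndex (valueGroup p L) ≠ 0 := by
    refine (relIndex_le_finrank p (A := ℚ_[p]) (W := L)
      (fun c => algebraMap ℚ_[p] (AlgebraicClosure K) c)
      (AddMonoidHomClass.toAddMonoidHom L.val) (fun c w => ?_) (fun c hc => ?_) fun u hu => ?_).1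
    · change ((c • w : L) : AlgebraicClosure K) = _ * (w : AlgebraicClosure K)
      rw [← Algebra.smul_def]; rfl
    · refine ⟨π ^ c.valuation, ⟨_, rfl⟩, ?_⟩
      rw [absv_padic, Padic.norm_eq_zpow_neg_valuation hc]
      have : absv p (p : AlgebraicClosure K) = (p : ℝ)⁻¹ := by
        have := absv_padic (F := AlgebraicClosure K) p (p : ℚ_[p])
        rw [map_natCast] at this
        rw [this, Padic.norm_p]
      simp [hπ, this]
    · obtain ⟨x, hx, hu⟩ := hu
      exact ⟨⟨x, hx⟩, hu⟩
  obtain ⟨k, hk, -, hkm, -⟩ := Subgroup.exists_pow_mem_of_relIndex_ne_zero hπV hg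
  obtain ⟨j, hj⟩ := Subgroup.mem_zpowers_iff.1 hkm
  have hgp := pos_of_mem_valueGroup p hg
  have hj0 : j ≠ 0 := by
    rintro rfl
    have : g ^ (0 : ℤ) = g ^ (k : ℤ) := by simpa using hj
    have := injective_zpow_of_pos hgp hg1 this
    omega
  have h1 : (Subgroup.zpowers (π ^ j)).relIndex (Subgroup.zpowers π) ≠ 0 := by
    rw [relIndex_zpowers_zpow (by exact hp0) hπ1]
    simpa using hj0
  have h2 : Subgroup.zpowers (π ^ j) ≤ Subgroup.zpowers g := by
    rw [Subgroup.zpowers_le]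
    exact ⟨k, by simpa using hj.symm⟩
  intro h0
  exact Subgroup.relIndex_ne_zero_trans h1 hπV (Subgroup.relIndex_eq_zero_of_le_left h2 h0)

end Ramification

/-! ### Roots of unity of order prime to `p` -/

section RootsOfUnity

variable (p : ℕ) [Fact p.Prime] {F : Type*} [Field F] [Algebra ℚ_[p] F]
  [Algebra.IsAlgebraic ℚ_[p] F]

theorem residue_eq_iff (x y : intRing p F) :
    IsLocalRing.residue (intRing p F) x = IsLocalRing.residue (intRing p F) y ↔
      absv p ((x : F) - y) < 1 := by
  rw [← sub_eq_zero, ← map_sub, residue_eq_zero_iff]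
  rfl

theorem charP_residueField : CharP (IsLocalRing.ResidueField (intRing p F)) p := by
  refine ringChar.of_eq (CharP.ringChar_of_prime_eq_zero Fact.out ?_)
  have := (residue_eq_zero_iff (F := F) p (p : intRing p F)).2 (by
    push_cast
    exact absv_prime_lt_one p)
  rwa [map_natCast] at this

/-- Every integral element is, modulo elements of absolute value less than `1`, a zero of a monic
polynomial with integer coefficients. -/
theorem exists_monic_absv_eval_lt {u : F} (hu : absv p u ≤ 1) :
    ∃ Q : ℤ[X], Q.Monic ∧ absv p (aeval u Q) < 1 := by
  have hint : IsIntegral ℚ_[p] u := (Algebra.IsAlgebraic.isAlgebraic u).isIntegral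
  set P := minpoly ℚ_[p] u with hP
  have hmon : P.Monic := minpoly.monic hint
  have hc : ∀ n, ‖P.coeff n‖ ≤ 1 := (spectralValue_le_one_iff hmon).1 hu
  have hz : ∀ n, ∃ z : ℤ, ‖P.coeff n - z‖ < 1 := fun n => by
    set y : ℤ_[p] := ⟨P.coeff n, hc n⟩ with hy
    refine ⟨(PadicInt.zmodRepr y : ℤ), ?_⟩
    have := PadicInt.norm_sub_zmodRepr_lt_one y
    rw [PadicInt.norm_def] at this
    push_cast at this ⊢
    exact this
  choose z hz using hz
  set Q : ℤ[X] := X ^ P.natDegree + ∑ i ∈ Finset.range P.natDegree, C (z i) * X ^ i with hQ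
  refine ⟨Q, ?_, ?_⟩
  · refine monic_X_pow_add ?_
    refine (degree_sum_le _ _).trans_lt ?_
    rw [Finset.sup_lt_iff (WithBot.bot_lt_coe _)]
    intro i hi
    exact (degree_C_mul_X_pow_le _ _).trans_lt (by exact_mod_cast Finset.mem_range.1 hi)
  · have h1 : aeval u Q = -(aeval u P - aeval u Q) := by rw [hP, minpoly.aeval]; ring
    have h2 : aeval u P - aeval u Q =
        ∑ i ∈ Finset.range P.natDegree, algebraMap ℚ_[p] F (P.coeff i - z i) * u ^ i := by
      have h3 : aeval u P = u ^ P.natDegree +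
          ∑ i ∈ Finset.range P.natDegree, algebraMap ℚ_[p] F (P.coeff i) * u ^ i := by
        conv_lhs => rw [hmon.as_sum]
        simp
      rw [h3, hQ]
      simp [sub_mul, Finset.sum_sub_distrib]
    rw [h1, absv_neg, h2]
    refine absv_sum_lt p _ _ one_pos fun i _ => ?_
    rw [absv_mul, absv_padic, absv_pow]
    exact mul_lt_one_of_nonneg_of_lt_one_left (norm_nonneg _) (hz i)
      (pow_le_one₀ (absv_nonneg p u) hu)

/-- The residue field is algebraic over the prime field, so its nonzero elements are roots of
unity. -/
theorem exists_absv_pow_sub_one_lt {u : F} (hu : absv p u = 1) :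
    ∃ n : ℕ, n.Coprime p ∧ absv p (u ^ n - 1) < 1 := by
  obtain ⟨Q, hQ, hQu⟩ := exists_monic_absv_eval_lt p hu.le
  set k := IsLocalRing.ResidueField (intRing p F) with hk
  set v : intRing p F := ⟨u, hu.le⟩ with hv
  set w : k := IsLocalRing.residue (intRing p F) v with hw
  have hw0 : w ≠ 0 := by
    rw [hw, Ne, residue_eq_zero_iff]
    exact not_lt.2 hu.ge
  have : CharP k p := charP_residueField p
  let : Algebra (ZMod p) k := ZMod.algebra k p
  have hwQ : aeval w Q = 0 := by
    have h1 : w = algebraMap (intRing p F) k v := rfl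
    rw [h1, aeval_algebraMap_apply]
    refine (residue_eq_zero_iff p _).2 ?_
    have : ((aeval v Q : intRing p F) : F) = aeval u Q := by
      change algebraMap (intRing p F) F (aeval v Q) = _
      rw [← aeval_algebraMap_apply]
      rfl
    rwa [this]
  have hint : IsIntegral (ZMod p) w := by
    refine ⟨Q.map (Int.castRingHom (ZMod p)), hQ.map _, ?_⟩
    rw [eval₂_map, ← hwQ, aeval_def]
    congr 1
    exact Subsingleton.elim _ _
  let E := IntermediateField.adjoin (ZMod p) {w}
  have : FiniteDimensional (ZMod p) E := IntermediateField.adjoin.finiteDimensional hint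
  have : Finite E := Module.finite_of_finite (ZMod p)
  have := Fintype.ofFinite E
  set g : E := IntermediateField.AdjoinSimple.gen (ZMod p) w with hg
  have hg1 : g ^ (Fintype.card E - 1) = 1 := FiniteField.pow_card_sub_one_eq_one g (by
    intro h
    exact hw0 (by simpa [hg] using congrArg (algebraMap E k) h))
  refine ⟨Fintype.card E - 1, ?_, ?_⟩
  · have : CharP E p := charP_of_injective_algebraMap (algebraMap (ZMod p) E).injective p
    obtain ⟨m, -, hm⟩ := FiniteField.card E p
    rw [hm]
    refine Nat.Coprime.symm ((Fact.out : p.Prime).coprime_iff_not_dvd.2 fun hdvd => ?_)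
    have h1 : p ∣ p ^ (m : ℕ) := dvd_pow_self p m.ne_zero
    have h2 := (Nat.dvd_sub h1 hdvd)
    rw [Nat.sub_sub_self (Nat.one_le_pow _ _ (Fact.out : p.Prime).pos)] at h2
    exact (Fact.out : p.Prime).one_lt.ne' (Nat.dvd_one.1 h2)
  · have h1 : w ^ (Fintype.card E - 1) = 1 := by
      have := congrArg (algebraMap E k) hg1
      rwa [map_pow, map_one, hg, IntermediateField.AdjoinSimple.algebraMap_gen] at this
    rw [hw, ← map_pow, ← map_one (IsLocalRing.residue (intRing p F)), residue_eq_iff] at h1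
    exact h1

theorem absv_eq_one_of_pow_eq_one {ζ : F} {n : ℕ} (hn : n ≠ 0) (h : ζ ^ n = 1) : absv p ζ = 1 := by
  have h1 : absv p ζ ^ n = 1 := by rw [← absv_pow, h, absv_one]
  exact (pow_eq_one_iff_of_nonneg (absv_nonneg p ζ) hn).1 h1

/-- Every residue class of units contains a root of unity of order prime to `p`. -/
theorem exists_root_of_unity_near [IsAlgClosed F] {u : F} (hu : absv p u = 1) :
    ∃ n : ℕ, n.Coprime p ∧ ∃ ζ : F, ζ ^ n = 1 ∧ absv p (u - ζ) < 1 := by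
  obtain ⟨n, hn, h⟩ := exists_absv_pow_sub_one_lt p hu
  refine ⟨n, hn, ?_⟩
  have hn0 : n ≠ 0 := by
    rintro rfl
    exact (Fact.out : p.Prime).one_lt.ne' (by simpa using hn)
  have hm : (X ^ n - C (1 : F)).Monic := monic_X_pow_sub_C 1 hn0
  -- `u ^ n - 1` is the product of the differences of `u` with the `n`-th roots of unity
  have h1 := (IsAlgClosed.splits (X ^ n - C (1 : F))).eval_eq_prod_roots_of_monic hm u
  have h2 : absv p ((X ^ n - C (1 : F)).eval u) =
      (((X ^ n - C (1 : F)).roots).map fun ζ => absv p (u - ζ)).prod := by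
    rw [h1]
    change (absVal p F) _ = _
    rw [map_multiset_prod, Multiset.map_map]
    rfl
  simp only [eval_sub, eval_pow, eval_X, eval_C] at h2
  by_contra! hcon
  rw [h2] at h
  refine absurd h (not_lt.2 ?_)
  have key : ∀ s : Multiset ℝ, (∀ x ∈ s, 1 ≤ x) → 1 ≤ s.prod := fun s => by
    induction s using Multiset.induction_on with
    | empty => simp
    | cons a s ih =>
      intro hs
      rw [Multiset.prod_cons]
      exact one_le_mul_of_one_le_of_one_le (hs a (Multiset.mem_cons_self a s))
        (ih fun x hx => hs x (Multiset.mem_cons_of_mem hx))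
  refine key _ fun x hx => ?_
  obtain ⟨ζ, hζ, rfl⟩ := Multiset.mem_map.1 hx
  refine hcon ζ ?_
  have := (mem_roots hm.ne_zero).1 hζ
  simpa [sub_eq_zero] using this

/-- Roots of unity of order prime to `p` are determined by their residue classes. -/
theorem eq_of_root_of_unity {n : ℕ} (hn : n.Coprime p) {ζ ω : F} (hζ : ζ ^ n = 1) (hω : ω ^ n = 1)
    (h : absv p (ζ - ω) < 1) : ζ = ω := by
  have hn0 : n ≠ 0 := by
    rintro rfl
    exact (Fact.out : p.Prime).one_lt.ne' (by simpa using hn)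
  have hω1 := absv_eq_one_of_pow_eq_one p hn0 hω
  have hω0 : ω ≠ 0 := by
    rintro rfl
    rw [absv_zero] at hω1
    exact zero_ne_one hω1
  set t := ζ / ω with ht
  have htn : t ^ n = 1 := by rw [ht, div_pow, hζ, hω, div_one]
  have ht1 : absv p (t - 1) < 1 := by
    have : t - 1 = (ζ - ω) / ω := by rw [ht]; field_simp
    rwa [this, absv_div, hω1, div_one]
  have hta := absv_eq_one_of_pow_eq_one p hn0 htn
  have hpow : ∀ i, absv p (t ^ i - 1) < 1 := by
    intro i
    rw [← geom_sum_mul, absv_mul]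
    refine mul_lt_one_of_nonneg_of_lt_one_right ?_ (absv_nonneg p _) ht1
    exact absv_sum_le p _ _ zero_le_one fun j _ => by rw [absv_pow, hta, one_pow]
  -- the quotient `1 + t + ⋯ + t ^ (n - 1)` of `t ^ n - 1` by `t - 1` is close to `n`
  have hsum : absv p (∑ i ∈ Finset.range n, t ^ i) = 1 := by
    have h1 : ∑ i ∈ Finset.range n, t ^ i = (n : F) + ∑ i ∈ Finset.range n, (t ^ i - 1) := by
      simp
    have h2 := absv_natCast_eq_one (F := F) p hn
    rw [h1, absv_add_eq_of_lt p, h2]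
    rw [h2]
    exact absv_sum_lt p _ _ one_pos fun i _ => hpow i
  have h0 := geom_sum_mul t n
  rw [htn, sub_self] at h0
  rcases mul_eq_zero.1 h0 with h1 | h1
  · rw [h1, absv_zero] at hsum
    exact absurd hsum zero_ne_one
  · rwa [sub_eq_zero, ht, div_eq_one_iff_eq hω0] at h1

end RootsOfUnity

/-! ### Absolute values of elements fixed by inertia -/

section Inertia

/-- Characters that stay distinct modulo elements of absolute value less than `1` are linearly
independent there. -/
theorem exists_one_le_absv_sum (p : ℕ) [Fact p.Prime] {F : Type*} [Field F] [Algebra ℚ_[p] F]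
    [Algebra.IsAlgebraic ℚ_[p] F] {G ι : Type*} [Group G] [Fintype ι] (χ : ι → G →* F)
    (h1 : ∀ i g, absv p (χ i g) = 1) (h2 : ∀ i j, i ≠ j → ∃ g, 1 ≤ absv p (χ i g - χ j g))
    (y : ι → F) (hy : ∀ i, absv p (y i) ≤ 1) (k : ι) (hk : absv p (y k) = 1) :
    ∃ g, 1 ≤ absv p (∑ i, y i * χ i g) := by
  let ψ : ι → (G →* IsLocalRing.ResidueField (intRing p F)) := fun i =>
    { toFun := fun g => IsLocalRing.residue _ ⟨χ i g, (h1 i g).le⟩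
      map_one' := by
        rw [← map_one (IsLocalRing.residue (intRing p F))]
        congr 1
        exact Subtype.ext (map_one (χ i))
      map_mul' := fun g g' => by
        rw [← map_mul]
        congr 1
        exact Subtype.ext (map_mul (χ i) _ _) }
  have hψa : ∀ i g, ψ i g = IsLocalRing.residue (intRing p F) ⟨χ i g, (h1 i g).le⟩ :=
    fun _ _ => rfl
  have hψ : Function.Injective ψ := by
    intro i j hij
    by_contra hne
    obtain ⟨g, hg⟩ := h2 i j hne
    have h3 : ψ i g = ψ j g := by rw [hij]
    rw [hψa, hψa, residue_eq_iff] at h3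
    exact absurd hg (not_le.2 h3)
  have hli := (linearIndependent_monoidHom G
    (IsLocalRing.ResidueField (intRing p F))).comp ψ hψ
  by_contra! hcon
  have h3 := Fintype.linearIndependent_iff.1 hli
    (fun i => IsLocalRing.residue (intRing p F) ⟨y i, hy i⟩) (by
      funext g
      have h4 := (residue_eq_zero_iff p (∑ i, (⟨y i, hy i⟩ : intRing p F) *
        (⟨χ i g, (h1 i g).le⟩ : intRing p F))).2 (by push_cast; exact hcon g)
      rw [map_sum] at h4
      simp only [map_mul] at h4
      rw [Finset.sum_apply]
      simp only [Function.comp_apply, Pi.smul_apply, smul_eq_mul, hψa, Pi.zero_apply]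
      exact h4) k
  rw [residue_eq_zero_iff] at h3
  exact absurd hk h3.ne

variable (p : ℕ) [Fact p.Prime] {K : Type*} [Field K] [Algebra ℚ_[p] K]
  [FiniteDimensional ℚ_[p] K]

include p in
theorem charZero_of_padic : CharZero K :=
  charZero_of_injective_algebraMap (algebraMap ℚ_[p] K).injective

/-- An automorphism that fixes the roots of unity of order prime to `p` acts trivially on the
residue field. -/
theorem isInertial_of_fixes_roots {L : IntermediateField K (AlgebraicClosure K)} {σ : GalBar K}
    (hσ : σ ∈ L.fixingSubgroup)
    (h : ∀ n : ℕ, n.Coprime p → ∀ ζ : AlgebraicClosure K, ζ ^ n = 1 → σ ζ = ζ) :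
    IsInertial p L σ := by
  refine ⟨hσ, fun x hx => ?_⟩
  rcases hx.lt_or_eq with hx | hx
  · exact absv_sub_lt p (by rwa [absv_gal]) hx
  · obtain ⟨n, hn, ζ, hζ, hxζ⟩ := exists_root_of_unity_near p hx
    have : σ x - x = σ (x - ζ) - (x - ζ) := by rw [map_sub, h n hn ζ hζ]; ring
    rw [this]
    exact absv_sub_lt p (by rwa [absv_gal]) hxζ

/-- An element fixed by the inertia group of `L` is contained in a cyclotomic extension of `L` of
order prime to `p`. -/
theorem exists_mem_adjoin_roots_of_fixed (L : IntermediateField K (AlgebraicClosure K))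
    {x : AlgebraicClosure K} (hx : ∀ σ, IsInertial p L σ → σ x = x) :
    ∃ n : ℕ, n.Coprime p ∧ x ∈ IntermediateField.adjoin L {ζ : AlgebraicClosure K | ζ ^ n = 1} := by
  have := charZero_of_padic (K := K) p
  set S : Set (AlgebraicClosure K) := L ∪ {ζ | ∃ n : ℕ, n.Coprime p ∧ ζ ^ n = 1} with hS
  -- `x` is fixed by the automorphisms that fix `S`, as these are inertial
  have hxU : x ∈ IntermediateField.adjoin K S := by
    rw [← InfiniteGalois.fixedField_fixingSubgroup (IntermediateField.adjoin K S)]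
    rw [IntermediateField.mem_fixedField_iff]
    intro σ hσ
    have hfix : ∀ y ∈ S, σ y = y := fun y hy =>
      (IntermediateField.mem_fixingSubgroup_iff _ _).1 hσ y (IntermediateField.subset_adjoin K S hy)
    refine hx σ (isInertial_of_fixes_roots p ?_ fun n hn ζ hζ => hfix ζ (Or.inr ⟨n, hn, hζ⟩))
    exact (IntermediateField.mem_fixingSubgroup_iff _ _).2 fun y hy => hfix y (Or.inl hy)
  obtain ⟨T, hTS, hxT⟩ := IntermediateField.exists_finset_of_mem_adjoin hxU
  -- finitely many roots of unity have a common order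
  have hT : ∀ T : Finset (AlgebraicClosure K), (T : Set (AlgebraicClosure K)) ⊆ S →
      ∃ n : ℕ, n.Coprime p ∧ ∀ y ∈ T, y ∈ L ∨ y ^ n = 1 := by
    classical
    intro T
    induction T using Finset.induction_on with
    | empty => exact fun _ => ⟨1, Nat.coprime_one_left p, by simp⟩
    | insert a T ha ih =>
      intro hT
      rw [Finset.coe_insert, Set.insert_subset_iff] at hT
      obtain ⟨n, hn, h⟩ := ih hT.2
      rcases hT.1 with haL | ⟨k, hk, hak⟩
      · refine ⟨n, hn, fun y hy => ?_⟩
        rcases Finset.mem_insert.1 hy with rfl | hy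
        · exact Or.inl haL
        · exact h y hy
      · refine ⟨k * n, hk.mul_left hn, fun y hy => ?_⟩
        rcases Finset.mem_insert.1 hy with rfl | hy
        · exact Or.inr (by rw [pow_mul, hak, one_pow])
        · exact (h y hy).imp_right fun h => by rw [mul_comm, pow_mul, h, one_pow]
  obtain ⟨n, hn, h⟩ := hT T hTS
  refine ⟨n, hn, ?_⟩
  have hle : IntermediateField.adjoin K (T : Set (AlgebraicClosure K)) ≤
      (IntermediateField.adjoin L {ζ : AlgebraicClosure K | ζ ^ n = 1}).restrictScalars K := by
    rw [IntermediateField.adjoin_le_iff]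
    intro y hy
    rcases h y hy with hyL | hy
    · exact (IntermediateField.adjoin L _).algebraMap_mem ⟨y, hyL⟩
    · exact IntermediateField.subset_adjoin L _ hy
  exact hle hxT

theorem absv_algHom {L : IntermediateField K (AlgebraicClosure K)}
    {M : IntermediateField L (AlgebraicClosure K)} (σ : M →ₐ[L] AlgebraicClosure K) (x : M) :
    absv p (σ x) = absv p (x : AlgebraicClosure K) := by
  have := charZero_of_padic (K := K) p
  have : Normal L (AlgebraicClosure K) := inferInstance
  let τ : AlgebraicClosure K →ₐ[L] AlgebraicClosure K := σ.liftNormal (AlgebraicClosure K)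
  let τ' : GalBar K := (AlgEquiv.ofBijective τ
    (Algebra.IsAlgebraic.algHom_bijective τ)).restrictScalars K
  have h : τ' (x : AlgebraicClosure K) = σ x := σ.liftNormal_commutes (AlgebraicClosure K) x
  rw [← h, absv_gal]

/-- In a cyclotomic extension of order prime to `p` every element `x` has a multiple by a root of
unity whose trace has the same absolute value as `x`. For otherwise the conjugates of `x`, divided
by `x`, would give a linear relation between characters with values in the residue field. -/
theorem exists_absv_eq_of_mem_adjoin_roots (L : IntermediateField K (AlgebraicClosure K)) {n : ℕ}
    (hn : n.Coprime p) {x : AlgebraicClosure K}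
    (hx : x ∈ IntermediateField.adjoin L {ζ : AlgebraicClosure K | ζ ^ n = 1}) :
    ∃ y ∈ L, absv p y = absv p x := by
  classical
  rcases eq_or_ne x 0 with rfl | hx0
  · exact ⟨0, L.zero_mem, rfl⟩
  have := charZero_of_padic (K := K) p
  have hn0 : n ≠ 0 := by
    rintro rfl
    exact (Fact.out : p.Prime).one_lt.ne' (by simpa using hn)
  set M := IntermediateField.adjoin L {ζ : AlgebraicClosure K | ζ ^ n = 1} with hM
  have hfin : Finite {ζ : AlgebraicClosure K | ζ ^ n = 1} := by
    refine Set.Finite.to_subtype (Set.Finite.subset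
      (Multiset.finite_toSet (nthRoots n (1 : AlgebraicClosure K))) fun ζ hζ => ?_)
    exact (mem_nthRoots (Nat.pos_of_ne_zero hn0)).2 hζ
  have : FiniteDimensional L M := IntermediateField.finiteDimensional_adjoin fun ζ _ =>
    (Algebra.IsAlgebraic.isAlgebraic ζ).isIntegral
  set x' : M := ⟨x, hx⟩ with hx'
  have hx0' : absv p x ≠ 0 := (absv_pos p hx0).ne'
  have hroot : ∀ (σ : M →ₐ[L] AlgebraicClosure K) (ζ : rootsOfUnity n M),
      absv p (σ ((ζ : Mˣ) : M)) = 1 := fun σ ζ => by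
    refine absv_eq_one_of_pow_eq_one p hn0 ?_
    rw [← map_pow, ← Units.val_pow_eq_pow_val, (mem_rootsOfUnity n _).1 ζ.2, Units.val_one, map_one]
  have hratio : ∀ σ : M →ₐ[L] AlgebraicClosure K, absv p (σ x' / x) = 1 := fun σ => by
    rw [absv_div, absv_algHom]
    exact div_self hx0'
  let χ : (M →ₐ[L] AlgebraicClosure K) → (rootsOfUnity n M →* AlgebraicClosure K) := fun σ =>
    (σ : M →* AlgebraicClosure K).comp ((Units.coeHom M).comp (rootsOfUnity n M).subtype)
  have hχ : ∀ σ τ, σ ≠ τ → ∃ ζ, 1 ≤ absv p (χ σ ζ - χ τ ζ) := by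
    intro σ τ hστ
    by_contra! hcon
    refine hστ (IntermediateField.adjoin_algHom_ext L fun ζ hζ => ?_)
    have hζn : (⟨ζ, IntermediateField.subset_adjoin L _ hζ⟩ : M) ^ n = 1 := Subtype.ext hζ
    have : NeZero n := ⟨hn0⟩
    refine eq_of_root_of_unity p hn ?_ ?_ (hcon (rootsOfUnity.mkOfPowEq _ hζn))
    · rw [← map_pow, hζn, map_one]
    · rw [← map_pow, hζn, map_one]
  obtain ⟨ζ, hζ⟩ := exists_one_le_absv_sum p χ hroot hχ (fun σ => σ x' / x)
    (fun σ => (hratio σ).le) M.val (hratio M.val)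
  refine ⟨(Algebra.trace L M (x' * ((ζ : Mˣ) : M)) : L), SetLike.coe_mem _, ?_⟩
  have htr : ((Algebra.trace L M (x' * ((ζ : Mˣ) : M)) : L) : AlgebraicClosure K) =
      x * ∑ σ : M →ₐ[L] AlgebraicClosure K, σ x' / x * σ ((ζ : Mˣ) : M) := by
    have h3 := trace_eq_sum_embeddings (K := L) (AlgebraicClosure K) (x := x' * ((ζ : Mˣ) : M))
    refine h3.trans ?_
    rw [Finset.mul_sum]
    refine Finset.sum_congr rfl fun σ _ => ?_
    rw [map_mul]
    field_simp
  have h1 : absv p (∑ σ : M →ₐ[L] AlgebraicClosure K, σ x' / x * σ ((ζ : Mˣ) : M)) = 1 :=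
    le_antisymm ?_ hζ
  · rw [htr, absv_mul, h1, mul_one]
  refine absv_sum_le p _ _ zero_le_one fun σ _ => ?_
  rw [absv_mul, hratio, hroot, one_mul]

/-- Extensions generated by elements fixed by inertia have ramification index `1`. -/
theorem exists_absv_eq_of_fixed (L : IntermediateField K (AlgebraicClosure K))
    {x : AlgebraicClosure K} (hx : ∀ σ, IsInertial p L σ → σ x = x) :
    ∃ y ∈ L, absv p y = absv p x := by
  obtain ⟨n, hn, h⟩ := exists_mem_adjoin_roots_of_fixed p L hx
  exact exists_absv_eq_of_mem_adjoin_roots p L hn h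

end Inertia

/-! ### Fields of definition -/

section FieldOf

variable {K : Type*} [Field K] {f : RatFunc K}

theorem hx_mem_fieldOf (x : P1bar K) : hx x ∈ fieldOf x := by
  induction x using OnePoint.rec with
  | infty => exact (⊥ : IntermediateField K (AlgebraicClosure K)).one_mem
  | coe x => exact IntermediateField.mem_adjoin_simple_self K x

theorem hy_mem_fieldOf (x : P1bar K) : hy x ∈ fieldOf x := by
  induction x using OnePoint.rec with
  | infty => exact (⊥ : IntermediateField K (AlgebraicClosure K)).zero_mem
  | coe x => exact IntermediateField.one_mem _

theorem mem_fixingSubgroup_fieldOf {σ : GalBar K} {x : P1bar K} :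
    σ ∈ (fieldOf x).fixingSubgroup ↔ gal σ x = x := by
  induction x using OnePoint.rec with
  | infty => simp [fieldOf, gal_infty]
  | coe x =>
    constructor
    · intro h
      exact congrArg OnePoint.some ((IntermediateField.mem_fixingSubgroup_iff _ _).1 h x
        (IntermediateField.mem_adjoin_simple_self K x))
    · intro h
      have h1 : σ x = x := OnePoint.coe_injective h
      have h2 : fieldOf (OnePoint.some x) ≤
          IntermediateField.fixedField (Subgroup.zpowers σ) := by
        refine IntermediateField.adjoin_simple_le_iff.2 ?_
        rw [IntermediateField.mem_fixedField_iff]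
        intro τ hτ
        have h3 : σ ∈ MulAction.stabilizer (GalBar K) x := h1
        have h4 : Subgroup.zpowers σ ≤ MulAction.stabilizer (GalBar K) x := by
          rwa [Subgroup.zpowers_le]
        exact h4 hτ
      exact (IntermediateField.le_iff_le _ _).1 h2 (Subgroup.mem_zpowers σ)

instance finiteDimensional_fieldOf (x : P1bar K) : FiniteDimensional K (fieldOf x) := by
  induction x using OnePoint.rec with
  | infty => exact inferInstanceAs (FiniteDimensional K (⊥ : IntermediateField K _))
  | coe x =>
    exact IntermediateField.adjoin.finiteDimensional
      (Algebra.IsAlgebraic.isAlgebraic x).isIntegral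

theorem fieldOf_toBar (x : OnePoint K) : fieldOf (toBar x) = ⊥ := by
  induction x using OnePoint.rec with
  | infty => rfl
  | coe x =>
    exact IntermediateField.adjoin_simple_eq_bot_iff.2 (IntermediateField.algebraMap_mem ⊥ x)

theorem fieldOf_le_iff [CharZero K] {x y : P1bar K} :
    fieldOf x ≤ fieldOf y ↔ ∀ σ : GalBar K, gal σ y = y → gal σ x = x := by
  have h1 : fieldOf x ≤ fieldOf y ↔ (fieldOf y).fixingSubgroup ≤ (fieldOf x).fixingSubgroup := by
    rw [← IntermediateField.le_iff_le, InfiniteGalois.fixedField_fixingSubgroup]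
  rw [h1]
  exact forall_congr' fun σ => by rw [mem_fixingSubgroup_fieldOf, mem_fixingSubgroup_fieldOf]

theorem fieldOf_mapBar_iterate_le [CharZero K] (f : RatFunc K) (n : ℕ) (x : P1bar K) :
    fieldOf ((mapBar f)^[n] x) ≤ fieldOf x :=
  fieldOf_le_iff.2 fun σ hσ => by rw [← mapBar_iterate_gal, hσ]

theorem relfinrank_eq_relIndex [CharZero K] {L M : IntermediateField K (AlgebraicClosure K)}
    (h : L ≤ M) [FiniteDimensional K M] :
    L.relfinrank M = M.fixingSubgroup.relIndex L.fixingSubgroup := by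
  have h1 := IntermediateField.finrank_bot_mul_relfinrank h
  have h2 := Subgroup.relIndex_mul_index (IntermediateField.fixingSubgroup_le h)
  rw [← IntermediateField.finrank_eq_fixingSubgroup_index,
    ← IntermediateField.finrank_eq_fixingSubgroup_index, ← h1, mul_comm] at h2
  have hpos : 0 < Module.finrank K M := Module.finrank_pos
  have h3 : Module.finrank K L ≠ 0 := by
    intro h0
    rw [← h1, h0, zero_mul] at hpos
    exact lt_irrefl _ hpos
  exact (mul_left_cancel₀ h3 h2).symm

/-- The degree of `K(x) / L` is at most the number of conjugates of `x` over `L`. -/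
theorem relfinrank_fieldOf_le [CharZero K] {L : IntermediateField K (AlgebraicClosure K)}
    {x : P1bar K} (h : L ≤ fieldOf x) (Z : Multiset (P1bar K))
    (hZ : ∀ σ ∈ L.fixingSubgroup, gal σ x ∈ Z) : L.relfinrank (fieldOf x) ≤ Z.card := by
  classical
  rw [relfinrank_eq_relIndex h, Subgroup.relIndex, Subgroup.index]
  have hmem : ∀ q : L.fixingSubgroup ⧸ (fieldOf x).fixingSubgroup.subgroupOf L.fixingSubgroup,
      gal (q.out : GalBar K) x ∈ Z.toFinset := fun q =>
    Multiset.mem_toFinset.2 (hZ _ q.out.2)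
  refine (Nat.card_le_card_of_injective (fun q => (⟨_, hmem q⟩ : Z.toFinset)) ?_).trans ?_
  · intro q q' hqq
    have h1 : gal (q.out : GalBar K) x = gal (q'.out : GalBar K) x := congrArg Subtype.val hqq
    rw [← QuotientGroup.out_eq' q, ← QuotientGroup.out_eq' q', QuotientGroup.eq,
      Subgroup.mem_subgroupOf, mem_fixingSubgroup_fieldOf]
    push_cast
    rw [gal_mul, ← h1, gal_inv_gal]
  · rw [Nat.card_eq_fintype_card, Fintype.card_coe]
    exact Multiset.toFinset_card_le Z

end FieldOf

/-! ### Distances and value groups -/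

section Distance

variable (p : ℕ) [Fact p.Prime] {K : Type*} [Field K] [Algebra ℚ_[p] K]
  [FiniteDimensional ℚ_[p] K]

theorem sphDist_mem_valueGroup {L : IntermediateField K (AlgebraicClosure K)} {x y : P1bar K}
    (hxL : fieldOf x ≤ L) (hyL : fieldOf y ≤ L) (hne : x ≠ y) :
    ∃ u ∈ valueGroup p L, (u : ℝ) = sphDist p x y := by
  have hnorm_mem : ∀ x : P1bar K, fieldOf x ≤ L → ∃ c ∈ L, absv p c = hnorm p x := by
    intro x hx
    rcases max_choice (absv p (hy x)) (absv p (Arboreal.hx x)) with h | h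
    · exact ⟨hy x, hx (hy_mem_fieldOf x), h.symm⟩
    · exact ⟨Arboreal.hx x, hx (hx_mem_fieldOf x), h.symm⟩
  obtain ⟨c, hc, hc'⟩ := hnorm_mem x hxL
  obtain ⟨d, hd, hd'⟩ := hnorm_mem y hyL
  refine ⟨Units.mk0 _ (sphDist_pos p hne).ne', ⟨(hx x * hy y - hx y * hy x) / (c * d), ?_, ?_⟩, rfl⟩
  · exact L.div_mem (L.sub_mem (L.mul_mem (hxL (hx_mem_fieldOf x)) (hyL (hy_mem_fieldOf y)))
      (L.mul_mem (hyL (hx_mem_fieldOf y)) (hxL (hy_mem_fieldOf x)))) (L.mul_mem hc hd)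
  · rw [Units.val_mk0, sphDist_eq, absv_div, absv_mul, hc', hd']

/-- The distance of a rational point to a point fixed by the inertia group of `L` lies in the value
group of `L`. -/
theorem sphDist_mem_valueGroup_of_inertia {L : IntermediateField K (AlgebraicClosure K)}
    {x : P1bar K} {b : OnePoint K} (h : ∀ σ, IsInertial p L σ → gal σ x = x)
    (hne : x ≠ toBar b) : ∃ u ∈ valueGroup p L, (u : ℝ) = sphDist p x (toBar b) := by
  have hH : Subgroup.closure {σ | IsInertial p L σ} ≤ (fieldOf x).fixingSubgroup := by
    rw [Subgroup.closure_le]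
    exact fun σ hσ => mem_fixingSubgroup_fieldOf.2 (h σ hσ)
  obtain ⟨u, ⟨c, hc, hcu⟩, hu⟩ := sphDist_mem_valueGroup p
    ((IntermediateField.le_iff_le _ _).2 hH) (by rw [fieldOf_toBar]; exact bot_le) hne
  obtain ⟨y, hy, hyc⟩ := exists_absv_eq_of_fixed p L (x := c) fun σ hσ =>
    (IntermediateField.mem_fixedField_iff _ _).1 hc σ (Subgroup.subset_closure hσ)
  exact ⟨u, ⟨y, hy, by rw [hyc, hcu]⟩, hu⟩

theorem gal_eq_of_isUnramifiedOver {L : IntermediateField K (AlgebraicClosure K)}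
    {a : ℕ → P1bar K} (h : IsUnramifiedOver p L a) {σ : GalBar K} (hσ : IsInertial p L σ) (n : ℕ) :
    gal σ (a n) = a n := by
  have h1 := DFunLike.congr_fun (h σ hσ) (⟨(n, a n), 1, (gal_one _).symm⟩ : TreeNode a)
  exact congrArg (fun v : TreeNode a => v.1.2) h1

theorem branchRep_eq_one {a : ℕ → P1bar K} {σ : GalBar K}
    (h : ∀ (τ : GalBar K) n, gal σ (gal τ (a n)) = gal τ (a n)) : branchRep a σ = 1 := by
  apply RelIso.ext
  rintro ⟨⟨n, x⟩, τ, hτ⟩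
  apply Subtype.ext
  change (n, gal σ x) = (n, x)
  simp only at hτ
  rw [hτ, h]

theorem not_isInfinitelyRamified_of_fixed {a : ℕ → P1bar K}
    (h : ∀ (σ : GalBar K) n, gal σ (a n) = a n) : ¬ IsInfinitelyRamified p a := fun hinf =>
  hinf ⟨⊥, inferInstance, fun σ _ => branchRep_eq_one fun τ n => by rw [h τ, h σ]⟩

theorem relIndex_zpowers_pow {L : IntermediateField K (AlgebraicClosure K)} {g h : ℝˣ} {e : ℕ}
    (hg : g ∈ valueGroup p L) (hg1 : (g : ℝ) < 1) (hgh : (h : ℝ) = (g : ℝ) ^ e) :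
    (Subgroup.zpowers h).relIndex (valueGroup p L) =
      e * (Subgroup.zpowers g).relIndex (valueGroup p L) := by
  have hg1' : g ≠ 1 := fun h => hg1.ne (congrArg Units.val h)
  have hh : h = g ^ (e : ℤ) := Units.ext (by simpa using hgh)
  rw [hh, ← Subgroup.relIndex_mul_relIndex (Subgroup.zpowers (g ^ (e : ℤ))) (Subgroup.zpowers g)
    (valueGroup p L) (by rw [Subgroup.zpowers_le]; exact ⟨e, rfl⟩)
    (by rwa [Subgroup.zpowers_le]), relIndex_zpowers_zpow (pos_of_mem_valueGroup p hg) hg1',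
    Int.natAbs_natCast]

/-- A branch is infinitely ramified if along a subsequence the distances to a rational point are
successive `e`-th roots of each other, because the value group of a finite extension is discrete. -/
theorem isInfinitelyRamified_of_roots {a : ℕ → P1bar K} {b : OnePoint K} {e s N : ℕ} (he : 2 ≤ e)
    (h : ∀ n, N ≤ n → 0 < sphDist p (a (n * s)) (toBar b) ∧ sphDist p (a (n * s)) (toBar b) < 1 ∧
      sphDist p (a (n * s)) (toBar b) = sphDist p (a ((n + 1) * s)) (toBar b) ^ e) :
    IsInfinitelyRamified p a := by
  rintro ⟨L, hL, hun⟩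
  have hval : ∀ k, ∃ u ∈ valueGroup p L, (u : ℝ) = sphDist p (a ((N + k) * s)) (toBar b) := by
    intro k
    refine sphDist_mem_valueGroup_of_inertia p
      (fun σ hσ => gal_eq_of_isUnramifiedOver p hun hσ _) fun heq => ?_
    have := (h (N + k) (by omega)).1
    rw [heq, sphDist_self] at this
    exact lt_irrefl _ this
  choose u hu hu' using hval
  have hu1 : ∀ k, (u k : ℝ) < 1 := fun k => by rw [hu']; exact (h (N + k) (by omega)).2.1
  have hidx : ∀ k, (Subgroup.zpowers (u 0)).relIndex (valueGroup p L) =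
      e ^ k * (Subgroup.zpowers (u k)).relIndex (valueGroup p L) := by
    intro k
    induction k with
    | zero => simp
    | succ k ih =>
      rw [ih, relIndex_zpowers_pow p (hu (k + 1)) (hu1 (k + 1)) (e := e), pow_succ, mul_assoc]
      rw [hu', hu']
      exact (h (N + k) (by omega)).2.2
  have hne : ∀ k, (Subgroup.zpowers (u k)).relIndex (valueGroup p L) ≠ 0 := fun k =>
    relIndex_zpowers_valueGroup_ne_zero p L (hu k) fun h => (hu1 k).ne (congrArg Units.val h)
  set I := (Subgroup.zpowers (u 0)).relIndex (valueGroup p L) with hI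
  have h1 := hidx I
  have h2 : I < e ^ I := Nat.lt_pow_self (by omega)
  have h3 := Nat.le_mul_of_pos_right (e ^ I) (Nat.pos_of_ne_zero (hne I))
  omega

end Distance

/-! ### Unramified branches -/

section Unramified

variable {p : ℕ} [Fact p.Prime] {K : Type*} [Field K] [Algebra ℚ_[p] K]
  [FiniteDimensional ℚ_[p] K] {f : RatFunc K}

theorem gal_pinv (σ : GalBar K) (x : P1bar K) : gal σ (pinv x) = pinv (gal σ x) := by
  induction x using OnePoint.rec with
  | infty => exact congrArg OnePoint.some (map_zero σ)
  | coe x =>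
    change gal σ (pinv (OnePoint.some x)) = pinv (OnePoint.some (σ x))
    rcases eq_or_ne x 0 with rfl | h
    · rw [pinv_zero, map_zero, pinv_zero, gal_infty]
    · rw [pinv_some h, pinv_some (by simpa using h), gal_some, map_inv₀]

theorem IsInertial.sameDisc {L : IntermediateField K (AlgebraicClosure K)} {σ : GalBar K}
    (hσ : IsInertial p L σ) (x : P1bar K) : SameDisc p (gal σ x) x := by
  have key : ∀ a : AlgebraicClosure K, absv p a ≤ 1 →
      SameDisc p (gal σ (OnePoint.some a)) (OnePoint.some a) := fun a ha => by
    rw [SameDisc, gal_some, sphDist_some_some p (by rwa [absv_gal]) ha]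
    exact hσ.2 a ha
  rcases integral_or_pinv_integral p x with ⟨a, ha, rfl⟩ | ⟨a, ha, rfl⟩
  · exact key a ha
  · rw [gal_pinv, SameDisc, sphDist_pinv_pinv]
    exact key a ha.le

theorem IsInertial.conj {L : IntermediateField K (AlgebraicClosure K)} [Normal K L] {σ : GalBar K}
    (hσ : IsInertial p L σ) (τ : GalBar K) : IsInertial p L (τ⁻¹ * σ * τ) := by
  constructor
  · refine (IntermediateField.mem_fixingSubgroup_iff _ _).2 fun x hx => ?_
    have h1 : τ x ∈ L := IntermediateField.normal_iff_forall_map_le'.1 inferInstance τ ⟨x, hx, rfl⟩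
    have h2 := (IntermediateField.mem_fixingSubgroup_iff _ _).1 hσ.1 _ h1
    rw [AlgEquiv.mul_apply, AlgEquiv.mul_apply, h2]
    exact τ.symm_apply_apply x
  · intro x hx
    have h1 : (τ⁻¹ * σ * τ) x - x = τ⁻¹ (σ (τ x) - τ x) := by
      rw [map_sub]
      congr 1
      exact (τ.symm_apply_apply x).symm
    rw [h1, absv_gal]
    exact hσ.2 _ (by rwa [absv_gal])

theorem IsBackwardOrbit.iterate {a : ℕ → P1bar K} (ha : IsBackwardOrbit f a) (k n : ℕ) :
    (mapBar f)^[k] (a (n + k)) = a n := by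
  induction k generalizing n with
  | zero => rfl
  | succ k ih => rw [Function.iterate_succ_apply, ← add_assoc, ha, ih]

/-- A branch along which the local degree is eventually `1` is not infinitely ramified: an element
of inertia that fixes `a N` moves each further point inside its residue disc, on which `f` is
injective. -/
theorem frequently_two_le_ldeg {d : ℕ} (hf : GoodMap p (mapBar f) d) {a : ℕ → P1bar K}
    (ha : IsBackwardOrbit f a) (hinf : IsInfinitelyRamified p a) (N : ℕ) :
    ∃ n, N ≤ n ∧ 2 ≤ ldeg p (mapBar f) (a n) := by
  by_contra! hcon
  have hone : ∀ n, N ≤ n → LocDeg p (mapBar f) (a n) 1 := fun n hn => by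
    have h1 := hf.ldeg_spec (a n)
    have h2 := hcon n hn
    have h3 := h1.pos
    rwa [show ldeg p (mapBar f) (a n) = 1 by omega] at h1
  -- over a normal extension inertia is stable under conjugation, and so fixes the conjugates of the
  -- branch along with the branch
  let L := IntermediateField.normalClosure K (fieldOf (a N)) (AlgebraicClosure K)
  have hfix : ∀ σ, IsInertial p L σ → ∀ n, gal σ (a n) = a n := by
    intro σ hσ
    have h0 : gal σ (a N) = a N := mem_fixingSubgroup_fieldOf.1
      (IntermediateField.fixingSubgroup_le (IntermediateField.le_normalClosure _) hσ.1)
    have h1 : ∀ n, N ≤ n → gal σ (a n) = a n := by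
      intro n hn
      induction n, hn using Nat.le_induction with
      | base => exact h0
      | succ n hn ih =>
        refine (hone (n + 1) (by omega)).injective_of_one (hσ.sameDisc _) (SameDisc.refl _) ?_
        rw [mapBar_gal, ha n, ih]
    intro n
    rw [← ha.iterate N n, ← mapBar_iterate_gal, h1 _ (by omega)]
  refine hinf ⟨L, inferInstance, fun σ hσ => branchRep_eq_one fun τ n => ?_⟩
  have h2 := hfix _ (hσ.conj τ) n
  rw [gal_mul, gal_mul] at h2
  have h3 := congrArg (gal τ) h2
  rwa [← gal_mul, mul_inv_cancel, gal_one] at h3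

end Unramified

/-! ### Polynomials and rational functions on the open unit disc -/

section UnitDisc

variable (p : ℕ) [Fact p.Prime] {F : Type*} [Field F] [Algebra ℚ_[p] F]
  [Algebra.IsAlgebraic ℚ_[p] F]

/-- The product of the distances from `t` to the elements of `S`. -/
def rootProd (S : Multiset F) (t : F) : ℝ := (S.map fun z => absv p (t - z)).prod

theorem rootProd_cons (z : F) (S : Multiset F) (t : F) :
    rootProd p (z ::ₘ S) t = absv p (t - z) * rootProd p S t := by
  simp [rootProd]

theorem rootProd_zero (t : F) : rootProd p 0 t = 1 := by simp [rootProd]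

theorem rootProd_nonneg (S : Multiset F) (t : F) : 0 ≤ rootProd p S t := by
  refine Multiset.prod_nonneg fun x hx => ?_
  obtain ⟨z, -, rfl⟩ := Multiset.mem_map.1 hx
  exact absv_nonneg p _

theorem rootProd_add (S T : Multiset F) (t : F) :
    rootProd p (S + T) t = rootProd p S t * rootProd p T t := by
  simp [rootProd]

theorem rootProd_eq_pow {S : Multiset F} {t : F} (h : ∀ z ∈ S, absv p z < absv p t) :
    rootProd p S t = absv p t ^ S.card := by
  induction S using Multiset.induction_on with
  | empty => simp [rootProd_zero]
  | cons z S ih =>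
    rw [rootProd_cons, ih fun w hw => h w (Multiset.mem_cons_of_mem hw), Multiset.card_cons,
      pow_succ', absv_sub_eq_of_lt p (h z (Multiset.mem_cons_self z S))]

/-- `A` behaves on the open unit disc like the polynomial with the roots `S` and leading
coefficient of absolute value `c`. -/
structure DiscForm (A : F[X]) (S : Multiset F) (c : ℝ) : Prop where
  pos : 0 < c
  lt_one : ∀ z ∈ S, absv p z < 1
  eval_eq : ∀ t, absv p t < 1 → absv p (A.eval t) = c * rootProd p S t
  coeff_le : ∀ i, absv p (A.coeff i) ≤ c
  coeff_lt : ∀ i < S.card, absv p (A.coeff i) < c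
  coeff_eq : absv p (A.coeff S.card) = c

theorem DiscForm.mul_X_sub_C {A : F[X]} {S : Multiset F} {c : ℝ} (h : DiscForm p A S c) (z : F) :
    ∃ S c, DiscForm p ((X - C z) * A) S c := by
  have hc : ∀ i, ((X - C z) * A).coeff (i + 1) = A.coeff i - z * A.coeff (i + 1) := fun i => by
    rw [sub_mul, coeff_sub, coeff_X_mul, coeff_C_mul]
  have hc0 : ((X - C z) * A).coeff 0 = -(z * A.coeff 0) := by
    simp [sub_mul]
  have hpos := h.pos
  rcases lt_or_ge (absv p z) 1 with hz | hz
  · have hlt : ∀ i, absv p (z * A.coeff i) < c := fun i => by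
      rw [absv_mul]
      nlinarith [h.coeff_le i, absv_nonneg p z, absv_nonneg p (A.coeff i)]
    refine ⟨z ::ₘ S, c, h.pos, ?_, fun t ht => ?_, fun i => ?_, fun i hi => ?_, ?_⟩
    · intro w hw
      rcases Multiset.mem_cons.1 hw with rfl | hw
      exacts [hz, h.lt_one w hw]
    · rw [eval_mul, absv_mul, h.eval_eq t ht, rootProd_cons]
      simp only [eval_sub, eval_X, eval_C]
      ring
    · cases i with
      | zero => rw [hc0, absv_neg]; exact (hlt 0).le
      | succ i => rw [hc]; exact (absv_sub_le p _ _).trans (max_le (h.coeff_le i) (hlt _).le)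
    · rw [Multiset.card_cons] at hi
      cases i with
      | zero => rw [hc0, absv_neg]; exact hlt 0
      | succ i => rw [hc]; exact absv_sub_lt p (h.coeff_lt i (by omega)) (hlt _)
    · rw [Multiset.card_cons, hc, absv_sub_eq_of_lt p, h.coeff_eq]
      rw [h.coeff_eq]
      exact hlt _
  · have hz0 : 0 < absv p z := one_pos.trans_le hz
    have hcz : c ≤ c * absv p z := le_mul_of_one_le_right hpos.le hz
    have hle : ∀ i, absv p (z * A.coeff i) ≤ c * absv p z := fun i => by
      rw [absv_mul, mul_comm]
      exact mul_le_mul_of_nonneg_right (h.coeff_le i) hz0.le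
    have hlt : ∀ i < S.card, absv p (z * A.coeff i) < c * absv p z := fun i hi => by
      rw [absv_mul, mul_comm]
      exact mul_lt_mul_of_pos_right (h.coeff_lt i hi) hz0
    have heq : absv p (z * A.coeff S.card) = c * absv p z := by
      rw [absv_mul, h.coeff_eq, mul_comm]
    refine ⟨S, c * absv p z, mul_pos hpos hz0, h.lt_one, fun t ht => ?_, fun i => ?_,
      fun i hi => ?_, ?_⟩
    · rw [eval_mul, absv_mul, h.eval_eq t ht]
      simp only [eval_sub, eval_X, eval_C]
      rw [absv_sub_comm, absv_sub_eq_of_lt p (ht.trans_le hz)]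
      ring
    · cases i with
      | zero => rw [hc0, absv_neg]; exact hle 0
      | succ i =>
        rw [hc]
        exact (absv_sub_le p _ _).trans (max_le ((h.coeff_le i).trans hcz) (hle _))
    · cases i with
      | zero => rw [hc0, absv_neg]; exact hlt 0 hi
      | succ i =>
        rw [hc]
        exact absv_sub_lt p ((h.coeff_lt i (by omega)).trans_le hcz) (hlt _ hi)
    · rcases hk : S.card with _ | k
      · rw [hc0, absv_neg, ← hk, heq]
      · rw [hc, absv_sub_comm, ← hk, absv_sub_eq_of_lt p, heq]
        rw [heq]
        exact (h.coeff_lt k (by omega)).trans_le hcz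

theorem exists_discForm [IsAlgClosed F] {A : F[X]} (hA : A ≠ 0) : ∃ S c, DiscForm p A S c := by
  have key : ∀ R : Multiset F, ∃ S c,
      DiscForm p ((R.map fun z => X - C z).prod * C A.leadingCoeff) S c := by
    intro R
    induction R using Multiset.induction_on with
    | empty =>
      refine ⟨0, absv p A.leadingCoeff, absv_pos p (leadingCoeff_ne_zero.2 hA), by simp,
        fun t _ => by simp [rootProd_zero], fun i => ?_, by simp, by simp⟩
      rw [Multiset.map_zero, Multiset.prod_zero, one_mul, coeff_C]
      split_ifs
      · exact le_rfl
      · rw [absv_zero]; exact absv_nonneg p _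
    | cons z R ih =>
      obtain ⟨S, c, h⟩ := ih
      rw [Multiset.map_cons, Multiset.prod_cons, mul_assoc]
      exact h.mul_X_sub_C p z
  obtain ⟨S, c, h⟩ := key A.roots
  refine ⟨S, c, ?_⟩
  rwa [mul_comm, ← (IsAlgClosed.splits A).eq_prod_roots] at h

/-- If `|A / B|` is on the open unit disc, up to finitely many points, the absolute value of a monic
polynomial with `e` roots in the disc, then `B` has no roots there and `A` has `e`. -/
theorem exists_discForm_of_eval [IsAlgClosed F] {A B : F[X]} (hco : IsCoprime A B) (hB : B ≠ 0)
    {Z : Multiset F} (hZ : ∀ z ∈ Z, absv p z < 1) (E : Finset F)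
    (h : ∀ t, absv p t < 1 → t ∉ E → absv p (A.eval t) = absv p (B.eval t) * rootProd p Z t) :
    ∃ S c, S.card = Z.card ∧ DiscForm p A S c ∧ DiscForm p B 0 c := by
  classical
  -- the elements of `S` stay away from the boundary of the open unit disc
  have hbd : ∀ (S : Multiset F), (∀ z ∈ S, absv p z < 1) → ∃ r, r < 1 ∧ ∀ z ∈ S, absv p z ≤ r := by
    intro S
    induction S using Multiset.induction_on with
    | empty => exact fun _ => ⟨0, one_pos, by simp⟩
    | cons z S ih =>
      intro hS
      obtain ⟨r, hr, hr'⟩ := ih fun w hw => hS w (Multiset.mem_cons_of_mem hw)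
      refine ⟨max (absv p z) r, max_lt (hS z (Multiset.mem_cons_self z S)) hr, fun w hw => ?_⟩
      rcases Multiset.mem_cons.1 hw with rfl | hw
      exacts [le_max_left _ _, (hr' w hw).trans (le_max_right _ _)]
  have hA : A ≠ 0 := by
    rintro rfl
    obtain ⟨SB, cB, hDB⟩ := exists_discForm p hB
    obtain ⟨r, hr, hr'⟩ := hbd (SB + Z) fun z hz => (Multiset.mem_add.1 hz).elim
      (hDB.lt_one z) (hZ z)
    obtain ⟨t, h1, h2, h3⟩ := exists_absv_between_notMem (F := F) p (E.image (absv p))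
      (max_lt hr one_pos)
    have h4 := h t h2 fun ht => h3 (Finset.mem_image_of_mem _ ht)
    have h5 : ∀ z ∈ SB + Z, absv p z < absv p t := fun z hz =>
      (hr' z hz).trans_lt ((le_max_left _ _).trans_lt h1)
    rw [hDB.eval_eq t h2, mul_assoc, ← rootProd_add, rootProd_eq_pow p h5, eval_zero,
      absv_zero] at h4
    have : 0 < absv p t := (le_max_right r 0).trans_lt h1
    exact absurd h4 (mul_pos hDB.pos (pow_pos this (SB + Z).card)).ne
  obtain ⟨SA, cA, hDA⟩ := exists_discForm p hA
  obtain ⟨SB, cB, hDB⟩ := exists_discForm p hB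
  have hform : ∀ t : F, absv p t < 1 → t ∉ E →
      cA * rootProd p SA t = cB * rootProd p (SB + Z) t := fun t ht htE => by
    rw [← hDA.eval_eq t ht, h t ht htE, hDB.eval_eq t ht, rootProd_add, mul_assoc]
  -- comparison near the boundary
  have hcmp : SA.card = (SB + Z).card ∧ cA = cB := by
    obtain ⟨r, hr, hr'⟩ := hbd (SA + (SB + Z)) fun z hz => by
      rcases Multiset.mem_add.1 hz with hz | hz
      · exact hDA.lt_one z hz
      · rcases Multiset.mem_add.1 hz with hz | hz
        exacts [hDB.lt_one z hz, hZ z hz]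
    have hval : ∀ t : F, max r 0 < absv p t → absv p t < 1 → absv p t ∉ E.image (absv p) →
        cA * absv p t ^ SA.card = cB * absv p t ^ (SB + Z).card := by
      intro t h1 h2 h3
      have h4 := hform t h2 fun ht => h3 (Finset.mem_image_of_mem _ ht)
      have h5 : ∀ z ∈ SA + (SB + Z), absv p z < absv p t := fun z hz =>
        (hr' z hz).trans_lt ((le_max_left _ _).trans_lt h1)
      rwa [rootProd_eq_pow p fun z hz => h5 z (Multiset.mem_add.2 (Or.inl hz)),
        rootProd_eq_pow p fun z hz => h5 z (Multiset.mem_add.2 (Or.inr hz))] at h4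
    obtain ⟨t, h1, h2, h3⟩ := exists_absv_between_notMem (F := F) p (E.image (absv p))
      (max_lt hr one_pos)
    obtain ⟨u, g1, g2, g3⟩ := exists_absv_between_notMem (F := F) p (E.image (absv p)) h2
    have e1 := hval t h1 h2 h3
    have e2 := hval u (h1.trans g1) g2 g3
    have ht0 : 0 < absv p t := (le_max_right r 0).trans_lt h1
    have hu0 : 0 < absv p u := ht0.trans g1
    set k := SA.card
    set l := (SB + Z).card
    have e3 : (absv p u / absv p t) ^ k = (absv p u / absv p t) ^ l := by
      have hcA := hDA.pos
      have hcB := hDB.pos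
      rw [div_pow, div_pow, div_eq_div_iff (pow_pos ht0 _).ne' (pow_pos ht0 _).ne']
      refine mul_left_cancel₀ (mul_pos hcA hcB).ne' ?_
      calc cA * cB * (absv p u ^ k * absv p t ^ l)
          = (cA * absv p u ^ k) * (cB * absv p t ^ l) := by ring
        _ = (cB * absv p u ^ l) * (cA * absv p t ^ k) := by rw [e2, ← e1]
        _ = _ := by ring
    have hkl : k = l := by
      have h1u : 1 < absv p u / absv p t := (one_lt_div ht0).2 g1
      exact pow_right_injective₀ (one_pos.trans h1u) h1u.ne' e3
    refine ⟨hkl, ?_⟩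
    rw [hkl] at e1
    exact mul_right_cancel₀ (pow_pos ht0 _).ne' e1
  -- a root of `B` would be a pole
  have hSB : SB = 0 := by
    refine Multiset.eq_zero_of_forall_notMem fun b hb => ?_
    have hb1 := hDB.lt_one b hb
    have hBb : B.eval b = 0 := by
      rw [← absv_eq_zero p, hDB.eval_eq b hb1]
      obtain ⟨S', rfl⟩ := Multiset.exists_cons_of_mem hb
      rw [rootProd_cons, sub_self, absv_zero]
      ring
    have hAb : A.eval b ≠ 0 := by
      intro h0
      obtain ⟨u, v, huv⟩ := hco
      have := congrArg (eval b) huv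
      simp [h0, hBb] at this
    have hAb' : 0 < rootProd p SA b := by
      have h1 := absv_pos p hAb
      rw [hDA.eval_eq b hb1] at h1
      exact pos_of_mul_pos_right h1 hDA.pos.le
    -- near `b` the product over `SA` is constant
    have hnear : ∀ S : Multiset F, 0 < rootProd p S b → ∃ δ > 0, ∀ t, absv p (t - b) < δ →
        rootProd p S t = rootProd p S b := by
      intro S
      induction S using Multiset.induction_on with
      | empty => exact fun _ => ⟨1, one_pos, by simp [rootProd_zero]⟩
      | cons z S ih =>
        intro hS
        rw [rootProd_cons] at hS
        have hS' : 0 < rootProd p S b := pos_of_mul_pos_right hS (absv_nonneg p _)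
        have hz : 0 < absv p (b - z) := pos_of_mul_pos_left hS (rootProd_nonneg p S b)
        obtain ⟨δ, hδ, hδ'⟩ := ih hS'
        refine ⟨min δ (absv p (b - z)), lt_min hδ hz, fun t ht => ?_⟩
        rw [rootProd_cons, rootProd_cons, hδ' t (ht.trans_le (min_le_left _ _))]
        congr 1
        have : t - z = (b - z) + (t - b) := by ring
        rw [this, absv_add_eq_of_lt p (ht.trans_le (min_le_right _ _))]
    obtain ⟨δ, hδ, hδ'⟩ := hnear SA hAb'
    have hle : ∀ t : F, absv p t < 1 → rootProd p (SB + Z) t ≤ absv p (t - b) := by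
      intro t ht
      obtain ⟨S', rfl⟩ := Multiset.exists_cons_of_mem hb
      rw [Multiset.cons_add, rootProd_cons]
      refine mul_le_of_le_one_right (absv_nonneg p _) ?_
      have hone : ∀ S : Multiset F, (∀ z ∈ S, absv p z < 1) → rootProd p S t ≤ 1 := by
        intro S
        induction S using Multiset.induction_on with
        | empty => exact fun _ => (rootProd_zero p t).le
        | cons z S ih =>
          intro hS
          rw [rootProd_cons]
          exact mul_le_one₀ (absv_sub_lt p ht (hS z (Multiset.mem_cons_self z S))).le
            (rootProd_nonneg p S t) (ih fun w hw => hS w (Multiset.mem_cons_of_mem hw))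
      refine hone _ fun z hz => (Multiset.mem_add.1 hz).elim
        (fun hz => hDB.lt_one z (Multiset.mem_cons_of_mem hz)) (hZ z)
    -- points `b + p ^ n` close to `b`
    have hp0 := absv_prime_pos (F := F) p
    have hp1 := absv_prime_lt_one (F := F) p
    have hsmall : ∀ᶠ n : ℕ in atTop, absv p ((p : F) ^ n) < min (min δ 1) (rootProd p SA b) := by
      simp only [absv_pow]
      exact (tendsto_pow_atTop_nhds_zero_of_lt_one (absv_nonneg p _) hp1).eventually_lt_const
        (lt_min (lt_min hδ one_pos) hAb')
    have hinj : Function.Injective fun n : ℕ => b + (p : F) ^ n := by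
      intro m n hmn
      have h1 : (p : F) ^ m = (p : F) ^ n := add_left_cancel hmn
      have h2 := congrArg (absv p) h1
      rw [absv_pow, absv_pow] at h2
      exact pow_eq_pow_of_lt_one hp0 hp1 h2
    have havoid : ∀ᶠ n : ℕ in atTop, b + (p : F) ^ n ∉ E := by
      rw [← Nat.cofinite_eq_atTop]
      exact hinj.tendsto_cofinite.eventually (E.finite_toSet.eventually_cofinite_notMem)
    obtain ⟨n, hn1, hn2⟩ := (hsmall.and havoid).exists
    have ht : absv p (b + (p : F) ^ n) < 1 :=
      absv_add_lt p hb1 (hn1.trans_le ((min_le_left _ _).trans (min_le_right _ _)))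
    have hd : b + (p : F) ^ n - b = (p : F) ^ n := by ring
    have h1 := hform _ ht hn2
    rw [hcmp.2, hδ' _ (by rw [hd]; exact hn1.trans_le ((min_le_left _ _).trans (min_le_left _ _)))]
      at h1
    have h2 := mul_left_cancel₀ hDB.pos.ne' h1
    have h3 := hle _ ht
    rw [hd, ← h2] at h3
    exact absurd (hn1.trans_le (min_le_right _ _)) (not_lt.2 h3)
  subst hSB
  rw [zero_add] at hcmp
  exact ⟨SA, cA, hcmp.1, hDA, hcmp.2 ▸ hDB⟩

end UnitDisc

/-! ### Weierstrass degrees -/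

section Weierstrass

variable (p : ℕ) [Fact p.Prime] {K : Type*} [Field K] [Algebra ℚ_[p] K]
  [FiniteDimensional ℚ_[p] K]

/-- The power series of `A / B` has Weierstrass degree `e` if the first coefficient of `A` of
maximal absolute value has index `e`, and that of `B` is the constant one and of the same absolute
value. -/
theorem hasWeierstrassDegree_of_coeff {A B : K[X]} {e : ℕ} {c : ℝ} (hc : 0 < c)
    (hA : ∀ i, absv p (A.coeff i) ≤ c) (hA' : ∀ i < e, absv p (A.coeff i) < c)
    (hAe : absv p (A.coeff e) = c) (hB : ∀ i, absv p (B.coeff i) ≤ c)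
    (hB0 : absv p (B.coeff 0) = c) {R : RatFunc K}
    (hR : R = algebraMap K[X] (RatFunc K) A / algebraMap K[X] (RatFunc K) B) :
    HasWeierstrassDegree p (R : LaurentSeries K) e := by
  have hB00 : B.coeff 0 ≠ 0 := fun h => by
    rw [h, absv_zero] at hB0
    exact hc.ne hB0
  set q : PowerSeries K := (A : PowerSeries K) * (B : PowerSeries K)⁻¹ with hq
  have hqB : (B : PowerSeries K) * q = A := by
    rw [hq, mul_left_comm, PowerSeries.mul_inv_cancel _ (by simpa using hB00), mul_one]
  have hRq : (R : LaurentSeries K) = (q : LaurentSeries K) := by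
    have h1 : (algebraMap K[X] (LaurentSeries K)) B ≠ 0 := by
      intro h
      have h2 := FaithfulSMul.algebraMap_injective K[X] (LaurentSeries K)
        (h.trans (map_zero _).symm)
      rw [h2] at hB00
      exact hB00 (coeff_zero 0)
    rw [hR, RatFunc.algebraMap_apply_div, div_eq_iff h1]
    have h2 : ∀ P : K[X], algebraMap K[X] (LaurentSeries K) P =
        ((P : PowerSeries K) : LaurentSeries K) := by
      intro P
      rw [RatFunc.coe_coe, RatFunc.coePolynomial_eq_algebraMap,
        ← IsScalarTower.algebraMap_apply]
    rw [h2, h2, ← PowerSeries.coe_mul, mul_comm, hqB]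
  -- the recursion for the coefficients of `q`
  have hrec : ∀ n, B.coeff 0 * PowerSeries.coeff n q =
      A.coeff n - ∑ i ∈ Finset.range n, B.coeff (i + 1) * PowerSeries.coeff (n - (i + 1)) q := by
    intro n
    have h1 := congrArg (PowerSeries.coeff n) hqB
    rw [PowerSeries.coeff_mul, Finset.Nat.sum_antidiagonal_eq_sum_range_succ
      (fun i j => PowerSeries.coeff i (B : PowerSeries K) * PowerSeries.coeff j q),
      Finset.sum_range_succ'] at h1
    simp only [Polynomial.coeff_coe, Nat.sub_zero] at h1
    rw [← h1]
    ring
  have hle : ∀ n, absv p (PowerSeries.coeff n q) ≤ 1 := by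
    intro n
    induction n using Nat.strong_induction_on with
    | _ n ih =>
      have h1 : absv p (B.coeff 0 * PowerSeries.coeff n q) ≤ c := by
        rw [hrec]
        refine (absv_sub_le p _ _).trans (max_le (hA n) (absv_sum_le p _ _ hc.le fun i hi => ?_))
        rw [Finset.mem_range] at hi
        rw [absv_mul]
        exact (mul_le_of_le_one_right (absv_nonneg p _) (ih _ (by omega))).trans (hB _)
      rw [absv_mul, hB0] at h1
      exact le_of_mul_le_mul_left (by linarith) hc
  have hlt : ∀ n < e, absv p (PowerSeries.coeff n q) < 1 := by
    intro n
    induction n using Nat.strong_induction_on with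
    | _ n ih =>
      intro hn
      have h1 : absv p (B.coeff 0 * PowerSeries.coeff n q) < c := by
        rw [hrec]
        refine absv_sub_lt p (hA' n hn) (absv_sum_lt p _ _ hc fun i hi => ?_)
        rw [Finset.mem_range] at hi
        rw [absv_mul]
        have h2 := ih (n - (i + 1)) (by omega) (by omega)
        nlinarith [hB (i + 1), absv_nonneg p (B.coeff (i + 1)),
          absv_nonneg p (PowerSeries.coeff (n - (i + 1)) q)]
      rw [absv_mul, hB0] at h1
      exact lt_of_mul_lt_mul_left (by linarith) hc.le
  have heq : absv p (PowerSeries.coeff e q) = 1 := by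
    have h1 : absv p (B.coeff 0 * PowerSeries.coeff e q) = c := by
      rw [hrec, absv_sub_eq_of_lt p, hAe]
      rw [hAe]
      refine absv_sum_lt p _ _ hc fun i hi => ?_
      rw [Finset.mem_range] at hi
      rw [absv_mul]
      have h2 := hlt (e - (i + 1)) (by omega)
      nlinarith [hB (i + 1), absv_nonneg p (B.coeff (i + 1)),
          absv_nonneg p (PowerSeries.coeff (e - (i + 1)) q)]
    rw [absv_mul, hB0] at h1
    exact mul_left_cancel₀ hc.ne' (by rw [h1, mul_one])
  rw [hRq]
  refine ⟨fun i hi => ?_, fun i => ?_, fun i hi => ?_, ?_⟩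
  · rw [PowerSeries.coeff_coe, if_pos hi]
  · rw [PowerSeries.coeff_coe]
    split_ifs
    · rw [absv_zero]; exact zero_le_one
    · exact hle _
  · rw [PowerSeries.coeff_coe]
    split_ifs
    · rw [absv_zero]; exact one_pos
    · exact hlt _ (by omega)
  · rw [PowerSeries.coeff_coe, if_neg (by omega), Int.natAbs_natCast]
    exact heq

/-- The value of a rational function at a geometric point. It is `0` at a pole, so evaluation is
compatible with the field operations and with composition only outside a finite set. -/
def evalBar (R : RatFunc K) (t : AlgebraicClosure K) : AlgebraicClosure K :=
  RatFunc.eval (algebraMap K (AlgebraicClosure K)) t R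

theorem evalBar_eq (R : RatFunc K) (t : AlgebraicClosure K) :
    evalBar R t = aeval t R.num / aeval t R.denom := rfl

theorem eventually_aeval_ne_zero {B : K[X]} (hB : B ≠ 0) :
    ∀ᶠ t : AlgebraicClosure K in cofinite, aeval t B ≠ 0 := by
  have h1 : (B.map (algebraMap K (AlgebraicClosure K))) ≠ 0 :=
    (Polynomial.map_ne_zero_iff (algebraMap K (AlgebraicClosure K)).injective).2 hB
  refine ((Multiset.finite_toSet (B.map (algebraMap K (AlgebraicClosure K))).roots).subset
    fun t ht => ?_)
  simp only [Set.mem_compl_iff, Set.mem_ofPred_eq, not_not] at ht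
  exact (mem_roots h1).2 (by rw [IsRoot, eval_map_algebraMap, ht])

/-- The Weierstrass degree can be read off from the absolute values on the open unit disc. -/
theorem hasWeierstrassDegree_of_eval {R : RatFunc K} {Z : Multiset (AlgebraicClosure K)}
    (hZ : ∀ z ∈ Z, absv p z < 1)
    (h : ∀ᶠ t in cofinite, absv p t < 1 → absv p (evalBar R t) = rootProd p Z t) :
    HasWeierstrassDegree p (R : LaurentSeries K) Z.card := by
  have h1 : ∀ᶠ t in cofinite, absv p t < 1 →
      absv p ((R.num.map (algebraMap K (AlgebraicClosure K))).eval t) =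
      absv p ((R.denom.map (algebraMap K (AlgebraicClosure K))).eval t) * rootProd p Z t := by
    filter_upwards [h, eventually_aeval_ne_zero R.denom_ne_zero] with t ht ht' h1
    rw [← ht h1, evalBar_eq, absv_div, eval_map_algebraMap, eval_map_algebraMap,
      mul_div_cancel₀ _ (absv_pos p ht').ne']
  have h2 := eventually_cofinite.1 h1
  obtain ⟨S, c, hS, hA, hB⟩ := exists_discForm_of_eval p
    (R.isCoprime_num_denom.map (mapRingHom (algebraMap K (AlgebraicClosure K))))
    ((Polynomial.map_ne_zero_iff (algebraMap K (AlgebraicClosure K)).injective).2 R.denom_ne_zero)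
    hZ h2.toFinset (fun t ht ht' => by
      rw [Set.Finite.mem_toFinset] at ht'
      exact not_not.1 ht' ht)
  have hcoe : ∀ (A : K[X]) i, absv p ((mapRingHom (algebraMap K (AlgebraicClosure K)) A).coeff i) =
      absv p (A.coeff i) := fun A i => by
    rw [coe_mapRingHom, coeff_map, absv_bar]
  rw [← hS]
  refine hasWeierstrassDegree_of_coeff p hA.pos (A := R.num) (B := R.denom) (fun i => ?_)
    (fun i hi => ?_) ?_ (fun i => ?_) ?_ (R.num_div_denom).symm
  · rw [← hcoe]; exact hA.coeff_le i
  · rw [← hcoe]; exact hA.coeff_lt i hi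
  · rw [← hcoe]; exact hA.coeff_eq
  · rw [← hcoe]; exact hB.coeff_le i
  · rw [← hcoe]; exact hB.coeff_eq

end Weierstrass

/-! ### Evaluation of compositions -/

section Evaluation

variable {K : Type*} [Field K]

theorem evalBar_add (R S : RatFunc K) :
    ∀ᶠ t in cofinite, evalBar (R + S) t = evalBar R t + evalBar S t := by
  filter_upwards [eventually_aeval_ne_zero R.denom_ne_zero,
    eventually_aeval_ne_zero S.denom_ne_zero] with t h1 h2
  exact RatFunc.eval_add _ _ h1 h2

theorem evalBar_mul (R S : RatFunc K) :
    ∀ᶠ t in cofinite, evalBar (R * S) t = evalBar R t * evalBar S t := by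
  filter_upwards [eventually_aeval_ne_zero R.denom_ne_zero,
    eventually_aeval_ne_zero S.denom_ne_zero] with t h1 h2
  exact RatFunc.eval_mul _ _ h1 h2

theorem evalBar_C (c : K) (t : AlgebraicClosure K) :
    evalBar (RatFunc.C c) t = algebraMap K (AlgebraicClosure K) c := RatFunc.eval_C _ _

theorem evalBar_X (t : AlgebraicClosure K) : evalBar (RatFunc.X : RatFunc K) t = t :=
  RatFunc.eval_X _ _

theorem evalBar_sub_C (R : RatFunc K) (c : K) : ∀ᶠ t in cofinite,
    evalBar (R - RatFunc.C c) t = evalBar R t - algebraMap K (AlgebraicClosure K) c := by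
  rw [sub_eq_add_neg, ← map_neg]
  filter_upwards [evalBar_add R (RatFunc.C (-c))] with t ht
  rw [ht, evalBar_C, map_neg, sub_eq_add_neg]

theorem evalBar_inv (R : RatFunc K) : ∀ᶠ t in cofinite, evalBar R⁻¹ t = (evalBar R t)⁻¹ := by
  rcases eq_or_ne R 0 with rfl | hR
  · refine Eventually.of_forall fun t => ?_
    simp [evalBar]
  · filter_upwards [evalBar_mul R⁻¹ R] with t ht
    rw [inv_mul_cancel₀ hR, evalBar, RatFunc.eval_one] at ht
    exact eq_inv_of_mul_eq_one_left ht.symm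

theorem evalBar_eval₂ (P : K[X]) (g : RatFunc K) :
    ∀ᶠ t in cofinite, evalBar (P.eval₂ RatFunc.C g) t = aeval (evalBar g t) P := by
  induction P using Polynomial.induction_on' with
  | add P Q hP hQ =>
    filter_upwards [hP, hQ, evalBar_add (P.eval₂ RatFunc.C g) (Q.eval₂ RatFunc.C g)] with t h1 h2 h3
    rw [eval₂_add, h3, h1, h2, map_add]
  | monomial n a =>
    induction n with
    | zero => exact Eventually.of_forall fun t => by simp [evalBar_C]
    | succ n ih =>
      filter_upwards [ih, evalBar_mul ((monomial n a).eval₂ RatFunc.C g) g] with t h1 h2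
      have e : monomial (n + 1) a = monomial n a * X := by rw [monomial_mul_X]
      rw [e, eval₂_mul, eval₂_X, h2, h1, map_mul, aeval_X]

theorem evalBar_ratComp (f g : RatFunc K) :
    ∀ᶠ t in cofinite, evalBar (ratComp f g) t = evalBar f (evalBar g t) := by
  have e : ratComp f g = f.num.eval₂ RatFunc.C g * (f.denom.eval₂ RatFunc.C g)⁻¹ :=
    div_eq_mul_inv _ _
  rw [e]
  filter_upwards [evalBar_mul (f.num.eval₂ RatFunc.C g) (f.denom.eval₂ RatFunc.C g)⁻¹,
    evalBar_inv (f.denom.eval₂ RatFunc.C g), evalBar_eval₂ f.num g, evalBar_eval₂ f.denom g]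
    with t h1 h2 h3 h4
  rw [h1, h2, h3, h4, evalBar_eq f, div_eq_mul_inv]

/-- The rational function `R` represents the self-map `H` of the projective line, up to finitely
many points. -/
def Represents (R : RatFunc K) (H : P1bar K → P1bar K) : Prop :=
  ∀ᶠ t in cofinite, H (OnePoint.some t) = OnePoint.some (evalBar R t)

/-- The fibres of `H` over the projective line are finite. -/
def FiniteFibres (H : P1bar K → P1bar K) : Prop := ∀ w, {x | H x = w}.Finite

theorem FiniteFibres.comp {G H : P1bar K → P1bar K} (hG : FiniteFibres G) (hH : FiniteFibres H) :
    FiniteFibres (H ∘ G) := fun w =>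
  ((hH w).biUnion fun x _ => hG x).subset fun y hy => Set.mem_biUnion (x := G y) hy rfl

theorem FiniteFibres.iterate {H : P1bar K → P1bar K} (hH : FiniteFibres H) (m : ℕ) :
    FiniteFibres H^[m] := by
  induction m with
  | zero => exact fun w => (Set.finite_singleton w).subset fun x hx => hx
  | succ m ih => rw [Function.iterate_succ]; exact hH.comp ih

theorem FiniteFibres.eventually {H : P1bar K → P1bar K} (hH : FiniteFibres H) {E : Set (P1bar K)}
    (hE : E.Finite) : ∀ᶠ t : AlgebraicClosure K in cofinite, H (OnePoint.some t) ∉ E := by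
  have h1 : {x | H x ∈ E}.Finite := (hE.biUnion fun w _ => hH w).subset fun x hx =>
    Set.mem_biUnion (x := H x) hx rfl
  refine (h1.preimage (OnePoint.coe_injective.injOn)).subset fun t ht => ?_
  exact not_not.1 ht

theorem Represents.comp {f g : RatFunc K} {G H : P1bar K → P1bar K} (hf : Represents f H)
    (hg : Represents g G) (hG : FiniteFibres G) : Represents (ratComp f g) (H ∘ G) := by
  have hE := hG.eventually (hf.image OnePoint.some)
  filter_upwards [hg, evalBar_ratComp f g, hE] with t h1 h2 h3
  rw [Function.comp_apply, h1, h2]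
  by_contra h4
  exact h3 ⟨evalBar g t, h4, h1.symm⟩

theorem Represents.ratIter {f : RatFunc K} {H : P1bar K → P1bar K} (hf : Represents f H)
    (hH : FiniteFibres H) (m : ℕ) : Represents (ratIter f m) H^[m] := by
  induction m with
  | zero => exact Eventually.of_forall fun t => congrArg OnePoint.some (evalBar_X t).symm
  | succ m ih =>
    rw [Function.iterate_succ']
    exact hf.comp ih (hH.iterate m)

theorem represents_mapBar {f : RatFunc K} : Represents f (mapBar f) := by
  filter_upwards [eventually_aeval_ne_zero f.denom_ne_zero] with t ht
  rw [mapBar_some, if_neg ht, evalBar_eq]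

theorem represents_inv {f : RatFunc K} {H : P1bar K → P1bar K} (hf : Represents f H)
    (hH : FiniteFibres H) : Represents f⁻¹ (pinv ∘ H) := by
  filter_upwards [hf, evalBar_inv f, hH.eventually (Set.finite_singleton (OnePoint.some 0))]
    with t h1 h2 h3
  rw [h1] at h3
  have h4 : evalBar f t ≠ 0 := fun h => h3 (by rw [h]; exact Set.mem_singleton _)
  rw [Function.comp_apply, h1, pinv_some h4, h2]

theorem finiteFibres_pinv : FiniteFibres (pinv : P1bar K → P1bar K) := fun w =>
  (Set.finite_singleton (pinv w)).subset fun x hx => by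
    rw [Set.mem_singleton_iff, ← (hx : pinv x = w), pinv_pinv]

theorem represents_ratFlip {f : RatFunc K} (hf : FiniteFibres (mapBar f)) :
    Represents (ratFlip f) (pinv ∘ mapBar f ∘ pinv) := by
  have h1 : Represents (RatFunc.X⁻¹ : RatFunc K) pinv :=
    represents_inv (f := RatFunc.X) (H := id)
      (Eventually.of_forall fun t => congrArg OnePoint.some (evalBar_X t).symm)
      (fun w => Set.finite_singleton w)
  exact represents_inv (represents_mapBar.comp h1 finiteFibres_pinv) (finiteFibres_pinv.comp hf)

end Evaluation

section LocalWeierstrass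

variable {p : ℕ} [Fact p.Prime] {K : Type*} [Field K] [Algebra ℚ_[p] K]
  [FiniteDimensional ℚ_[p] K]

theorem GoodMap.finiteFibres {H : P1bar K → P1bar K} {d : ℕ} (hH : GoodMap p H d) :
    FiniteFibres H := fun w => by
  obtain ⟨Z, -, hZ⟩ := hH w
  refine (Multiset.finite_toSet Z).subset fun x hx => ?_
  change x ∈ Z
  rw [← distProd_eq_zero_iff p, ← hZ, (hx : H x = w), sphDist_self]

theorem eventually_cofinite_add {a : AlgebraicClosure K} {P : AlgebraicClosure K → Prop}
    (h : ∀ᶠ t in cofinite, P t) : ∀ᶠ t in cofinite, P (t + a) :=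
  (add_left_injective a).tendsto_cofinite.eventually h

theorem exists_some_of_sameDisc {a : AlgebraicClosure K} (ha : absv p a ≤ 1) {z : P1bar K}
    (hz : SameDisc p z (OnePoint.some a)) :
    ∃ s, z = OnePoint.some s ∧ absv p s ≤ 1 ∧ absv p (s - a) < 1 := by
  rcases integral_or_pinv_integral p z with ⟨s, hs, rfl⟩ | ⟨s, hs, rfl⟩
  · exact ⟨s, rfl, hs, by rwa [SameDisc, sphDist_some_some p hs ha] at hz⟩
  · exfalso
    have h1 : SameDisc p (pinv (OnePoint.some a)) (OnePoint.some s) := by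
      rw [SameDisc, ← sphDist_pinv_pinv, pinv_pinv]
      exact hz.symm
    rcases eq_or_ne a 0 with rfl | h0
    · rw [pinv_zero] at h1
      change 1 / max 1 (absv p s) < 1 at h1
      rw [max_eq_left hs.le, div_one] at h1
      exact lt_irrefl _ h1
    · rw [pinv_some h0] at h1
      have h2 : 1 ≤ absv p a⁻¹ := by
        rw [absv_inv]
        exact (one_le_inv₀ (absv_pos p h0)).2 ha
      change absv p (a⁻¹ - s) / (max 1 (absv p a⁻¹) * max 1 (absv p s)) < 1 at h1
      rw [max_eq_right h2, max_eq_left hs.le, mul_one,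
        absv_sub_eq_of_lt p (hs.trans_le h2), div_self (one_pos.trans_le h2).ne'] at h1
      exact lt_irrefl _ h1

/-- The Weierstrass degree at an integral point is the local degree. -/
theorem LocDeg.hasWeierstrassDegree {H : P1bar K → P1bar K} {g : RatFunc K} {a : K} {e : ℕ}
    (ha : absv p a ≤ 1) (hg : Represents g H) (hl : LocDeg p H (toBar (OnePoint.some a)) e)
    (hs : SameDisc p (H (toBar (OnePoint.some a))) (toBar (OnePoint.some a))) :
    HasWeierstrassDegree p (expandAt g a) e := by
  set b : AlgebraicClosure K := algebraMap K (AlgebraicClosure K) a with hb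
  have hbar : toBar (OnePoint.some a) = OnePoint.some b := rfl
  rw [hbar] at hl hs
  have hb1 : absv p b ≤ 1 := by rwa [hb, absv_bar]
  obtain ⟨Z, z1, z2, z3⟩ := hl _ hs.symm
  set Y : Multiset (AlgebraicClosure K) := Z.map fun z => hx z - b with hY
  have hYcard : Y.card = e := by rw [hY, Multiset.card_map, z1]
  have hzz : ∀ z ∈ Z, z = OnePoint.some (hx z) ∧ absv p (hx z) ≤ 1 ∧ absv p (hx z - b) < 1 := by
    intro z hz
    obtain ⟨s, rfl, h1, h2⟩ := exists_some_of_sameDisc hb1 (z2 z hz)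
    exact ⟨rfl, h1, h2⟩
  rw [← hYcard]
  refine hasWeierstrassDegree_of_eval p (fun y hy => ?_) ?_
  · obtain ⟨z, hz, rfl⟩ := Multiset.mem_map.1 hy
    exact (hzz z hz).2.2
  have e1 : ∀ᶠ t in cofinite, evalBar (RatFunc.X + RatFunc.C a) t = t + b := by
    filter_upwards [evalBar_add RatFunc.X (RatFunc.C a)] with t ht
    rw [ht, evalBar_X, evalBar_C]
  filter_upwards [e1, evalBar_sub_C (ratComp g (RatFunc.X + RatFunc.C a)) a,
    evalBar_ratComp g (RatFunc.X + RatFunc.C a), eventually_cofinite_add (a := b) hg]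
    with t h1 h2 h3 h4 ht
  rw [h2, h3, h1]
  have htb : absv p (t + b) ≤ 1 := (absv_add_le p _ _).trans (max_le ht.le hb1)
  have hd : SameDisc p (OnePoint.some (t + b)) (OnePoint.some b) := by
    rwa [SameDisc, sphDist_some_some p htb hb1, add_sub_cancel_right]
  have h5 := z3 _ hd
  obtain ⟨s, hs1, hs2, -⟩ := exists_some_of_sameDisc hb1 ((hl.sameDisc hd).trans hs)
  have hs3 : evalBar g (t + b) = s := OnePoint.coe_injective (h4.symm.trans hs1)
  rw [hs1, sphDist_some_some p hs2 hb1] at h5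
  rw [hs3, h5, hY, distProd, rootProd, Multiset.map_map]
  refine congrArg Multiset.prod (Multiset.map_congr rfl fun z hz => ?_)
  obtain ⟨g1, g2, -⟩ := hzz z hz
  conv_lhs => rw [g1]
  rw [sphDist_some_some p htb g2, Function.comp_apply]
  congr 1
  ring

theorem pinv_comp_iterate (H : P1bar K → P1bar K) (m : ℕ) :
    (pinv ∘ H ∘ pinv)^[m] = pinv ∘ H^[m] ∘ pinv := by
  induction m with
  | zero => funext x; exact (pinv_pinv x).symm
  | succ m ih =>
    rw [Function.iterate_succ', Function.iterate_succ', ih]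
    funext x
    simp only [Function.comp_apply, pinv_pinv]

theorem toBar_pinv (x : OnePoint K) : toBar (pinv x) = pinv (toBar x) := by
  induction x using OnePoint.rec with
  | infty => exact congrArg OnePoint.some (map_zero _)
  | coe x =>
    change toBar (pinv (OnePoint.some x)) =
      pinv (OnePoint.some (algebraMap K (AlgebraicClosure K) x))
    rcases eq_or_ne x 0 with rfl | h
    · rw [pinv_zero, map_zero, pinv_zero]; rfl
    · rw [pinv_some h, pinv_some (by simpa using h), ← map_inv₀]; rfl

/-- The Weierstrass degree of `f ^ m` at a point with periodic reduction is the local degree. -/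
theorem TameMap.hasLocalWeierstrassDegree {f : RatFunc K} (hf : TameMap p f) {m e : ℕ}
    {x : OnePoint K} (hl : LocDeg p (mapBar f)^[m] (toBar x) e)
    (hs : SameDisc p ((mapBar f)^[m] (toBar x)) (toBar x)) :
    HasLocalWeierstrassDegree p f m x e := by
  have hff := hf.goodMap.finiteFibres
  have hflip : ∀ a : K, absv p a ≤ 1 → x = pinv (OnePoint.some a) →
      HasWeierstrassDegree p (expandAt (ratIter (ratFlip f) m) a) e := by
    intro a ha hxa
    have hx' : toBar x = pinv (toBar (OnePoint.some a)) := by rw [hxa, toBar_pinv]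
    refine LocDeg.hasWeierstrassDegree ha ((represents_ratFlip hff).ratIter
      (finiteFibres_pinv.comp (hff.comp finiteFibres_pinv)) m) ?_ ?_
    · rw [pinv_comp_iterate]
      rw [hx'] at hl
      exact LocDeg.pinv_comp (LocDeg.comp_pinv hl)
    · rw [pinv_comp_iterate, Function.comp_apply, Function.comp_apply, ← hx', SameDisc,
        ← sphDist_pinv_pinv, pinv_pinv, ← hx']
      exact hs
  induction x using OnePoint.rec with
  | infty => exact hflip 0 (by rw [absv_zero]; exact zero_le_one) pinv_zero.symm
  | coe a =>
    refine ⟨fun ha => LocDeg.hasWeierstrassDegree ha (represents_mapBar.ratIter hff m) hl hs,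
      fun ha => hflip a⁻¹ ?_ ?_⟩
    · rw [absv_inv]
      exact inv_le_one_of_one_le₀ ha.le
    · have h0 : a ≠ 0 := by
        rintro rfl
        rw [absv_zero] at ha
        exact absurd ha (by norm_num)
      rw [pinv_some (inv_ne_zero h0), inv_inv]

end LocalWeierstrass

/-! ### Infinitely ramified branches: residual period -/

section Period

variable {p : ℕ} [Fact p.Prime] {K : Type*} [Field K] [Algebra ℚ_[p] K]
  [FiniteDimensional ℚ_[p] K] {f : RatFunc K} {a : ℕ → P1bar K} {x : OnePoint K} {m e : ℕ}

/-- Infinitely many points of an infinitely ramified branch share their residue disc with the same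
critical point. -/
theorem TameMap.exists_crit_frequently (hf : TameMap p f) (ha : IsBackwardOrbit f a)
    (hinf : IsInfinitelyRamified p a) :
    ∃ c, IsCrit f c ∧ ∀ N, ∃ n, N ≤ n ∧ SameDisc p (a n) c := by
  have h1 : ∃ᶠ n in atTop, ∃ c ∈ {c | IsCrit f c}, SameDisc p (a n) c := by
    rw [frequently_atTop]
    intro N
    obtain ⟨n, hn, h2⟩ := frequently_two_le_ldeg hf.goodMap ha hinf N
    obtain ⟨c, hc, hc'⟩ := hf.exists_crit _ h2
    exact ⟨n, hn, c, hc', hc.symm⟩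
  by_contra! hcon
  choose! N hN using hcon
  obtain ⟨B, hB⟩ := (hf.finite_crit.image N).bddAbove
  obtain ⟨n, hn, c, hc, hcn⟩ := (frequently_atTop.1 h1) B
  exact hN c hc n ((hB (Set.mem_image_of_mem N hc)).trans hn) hcn

/-- The reduction of an infinitely ramified branch is periodic, and around the cycle the map has
local degree at least `2`. -/
theorem TameMap.exists_residualPeriod (hf : TameMap p f) (ha : IsBackwardOrbit f a)
    (hinf : IsInfinitelyRamified p a) : ∃ m e, HasExactResidualPeriod p a m ∧ 0 < m ∧
      (∀ n, SameDisc p (a (n + m)) (a n)) ∧ 2 ≤ e ∧ ∀ n, LocDeg p (mapBar f)^[m] (a n) e := by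
  classical
  obtain ⟨c, -, hc⟩ := hf.exists_crit_frequently ha hinf
  have hex : ∃ k, 0 < k ∧ ∀ n, redBar p (a (n + k)) = redBar p (a n) := by
    obtain ⟨n₁, -, h1⟩ := hc 0
    obtain ⟨n₂, hn, h2⟩ := hc (n₁ + 1)
    obtain ⟨k, rfl⟩ := Nat.exists_eq_add_of_lt (show n₁ < n₂ by omega)
    -- two visits to the disc of `c` make it periodic, and every `a n` is an iterated image of a
    -- later point in it
    refine ⟨k + 1, by omega, fun n => redBar_eq_iff.2 ?_⟩
    have hkc : SameDisc p ((mapBar f)^[k + 1] c) c := by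
      refine (hf.goodMap.sameDisc_iterate (k + 1) h2.symm).trans ?_
      rw [add_assoc, ha.iterate]
      exact h1
    obtain ⟨j, hj, h3⟩ := hc (n + (k + 1))
    obtain ⟨i, rfl⟩ := Nat.exists_eq_add_of_le hj
    have h4 : SameDisc p (a (n + i)) (a (n + (k + 1) + i)) := by
      have h5 := hf.goodMap.sameDisc_iterate (k + 1) h3
      rw [show n + (k + 1) + i = n + i + (k + 1) by omega, ha.iterate] at h5
      exact (h5.trans hkc).trans h3.symm
    have h6 := hf.goodMap.sameDisc_iterate i h4
    rw [ha.iterate, ha.iterate] at h6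
    exact h6.symm
  set m := Nat.find hex with hm
  obtain ⟨hm0, hper⟩ := Nat.find_spec hex
  have hsd : ∀ n, SameDisc p (a (n + m)) (a n) := fun n => redBar_eq_iff.1 (hper n)
  have hback : ∀ n, SameDisc p ((mapBar f)^[m] (a n)) (a n) := fun n => by
    have := hf.goodMap.sameDisc_iterate m (hsd n).symm
    rwa [ha.iterate] at this
  have hE : ∀ n, iterDeg p (mapBar f) m (a n) = iterDeg p (mapBar f) m (a 0) := by
    intro n
    induction n with
    | zero => rfl
    | succ n ih => rw [← ih, ← ha n, hf.goodMap.iterDeg_apply (hback _)]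
  refine ⟨m, iterDeg p (mapBar f) m (a 0), ⟨⟨hm0, hper⟩, fun k hk => Nat.find_min' hex hk⟩, hm0,
    hsd, ?_, fun n => hE n ▸ hf.goodMap.locDeg_iterate m (a n)⟩
  obtain ⟨n, -, h2⟩ := frequently_two_le_ldeg hf.goodMap ha hinf 0
  rw [← hE n]
  exact h2.trans (hf.goodMap.ldeg_le_iterDeg (x := a n) hm0)

/-- All residue discs of a branch with periodic reduction contain rational points, namely forward
images of the base point. -/
theorem TameMap.exists_rational (hf : TameMap p f) (hb : IsBranchOver f x a) (hm : 0 < m)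
    (hsd : ∀ n, SameDisc p (a (n + m)) (a n)) (n : ℕ) :
    ∃ b : OnePoint K, SameDisc p (a n) (toBar b) := by
  have := charZero_of_padic (K := K) p
  have h1 : ∀ k, SameDisc p (a (k * m)) (a 0) := by
    intro k
    induction k with
    | zero => rw [zero_mul]; exact SameDisc.refl _
    | succ k ih => rw [add_mul, one_mul]; exact (hsd _).trans ih
  obtain ⟨b, hb'⟩ := exists_toBar_mapBar f (n * (m - 1)) x
  refine ⟨b, ?_⟩
  have h2 := hf.goodMap.sameDisc_iterate (n * (m - 1)) (h1 n)
  obtain ⟨j, rfl⟩ := Nat.exists_eq_add_of_lt hm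
  rw [hb', ← hb.1]
  rw [show n * (0 + j + 1) = n + n * (0 + j + 1 - 1) by rw [Nat.add_sub_cancel]; ring,
    hb.2.iterate] at h2
  exact h2

/-- Along an infinitely ramified branch the distances to suitable rational points are eventually
successive `e`-th roots of each other: otherwise the branch would stay within the radius where the
first-return map is contracting, and would be determined by the residue discs, hence rational. -/
theorem TameMap.exists_roots (hf : TameMap p f) (hb : IsBranchOver f x a)
    (hinf : IsInfinitelyRamified p a) (hm : 0 < m) (hsd : ∀ n, SameDisc p (a (n + m)) (a n))
    (he : 2 ≤ e) (hl : ∀ n, LocDeg p (mapBar f)^[m] (a n) e) :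
    ∃ (b : ℕ → OnePoint K) (N : ℕ), (∀ n, b (n + m) = b n) ∧
      (∀ n, SameDisc p (a n) (toBar (b n))) ∧ ∀ n, N ≤ n → a n ≠ toBar (b n) ∧
        sphDist p (a n) (toBar (b n)) = sphDist p (a (n + m)) (toBar (b n)) ^ e := by
  have hsdk : ∀ k n, SameDisc p (a (n + k * m)) (a n) := by
    intro k n
    induction k with
    | zero => rw [zero_mul]; exact SameDisc.refl _
    | succ k ih => rw [add_mul, one_mul, ← add_assoc]; exact (hsd _).trans ih
  have hstep : ∀ i n, (mapBar f)^[m] (a (i + (n + 1) * m)) = a (i + n * m) := fun i n => by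
    rw [add_mul, one_mul, ← add_assoc, hb.2.iterate]
  have key : ∀ i, ∃ (b : OnePoint K) (N : ℕ), SameDisc p (a i) (toBar b) ∧ ∀ n, N ≤ n →
      a (i + n * m) ≠ toBar b ∧ sphDist p (a (i + n * m)) (toBar b) =
        sphDist p (a (i + (n + 1) * m)) (toBar b) ^ e := by
    intro i
    obtain ⟨b, hbi⟩ := hf.exists_rational hb hm hsd i
    have hlb := (hl i).congr hbi.symm
    have hbb : SameDisc p ((mapBar f)^[m] (toBar b)) (toBar b) := by
      have h1 := hf.goodMap.sameDisc_iterate m (hbi.symm.trans (hsd i).symm)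
      rw [hb.2.iterate] at h1
      exact h1.trans hbi
    obtain ⟨r, hr⟩ := hlb.exists_escapeRadius he hbb
    rcases hr.dichotomy (c := fun n => a (i + n * m)) (hstep i) (fun n => (hsdk n i).trans hbi)
      with hin | ⟨N, hN⟩
    -- the conjugates of the branch stay inside as well, so they agree with it
    · exfalso
      refine not_isInfinitelyRamified_of_fixed p (fun σ n => ?_) hinf
      have h1 := hr.eq_of_backward (c := fun n => gal σ (a (i + n * m)))
        (c' := fun n => a (i + n * m)) (fun n => by rw [mapBar_iterate_gal, hstep]) (hstep i)
        (fun n => by rw [← gal_toBar σ b, sphDist_gal]; exact hin n) hin n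
      obtain ⟨k, hk⟩ := Nat.exists_eq_add_of_le (show n ≤ i + n * m by nlinarith)
      rw [← hb.2.iterate k n, ← mapBar_iterate_gal, ← hk]
      exact congrArg _ h1
    · refine ⟨b, N, hbi, fun n hn => ⟨fun h => ?_, (hN n hn).2⟩⟩
      have h2 := (hN n hn).1
      simp only [h, sphDist_self] at h2
      exact absurd h2 (not_lt.2 hr.nonneg)
  choose B N hB hN using key
  have hdm : ∀ n, n % m + n / m * m = n := fun n => by rw [mul_comm]; exact Nat.mod_add_div n m
  refine ⟨fun n => B (n % m), (∑ i ∈ Finset.range m, N i) * m + m, fun n => by simp, fun n => ?_,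
    fun n hn => ?_⟩
  · have h1 := hsdk (n / m) (n % m)
    rw [hdm] at h1
    exact h1.trans (hB _)
  · have h1 : N (n % m) ≤ n / m := by
      have h2 : N (n % m) ≤ ∑ i ∈ Finset.range m, N i :=
        Finset.single_le_sum (fun _ _ => Nat.zero_le _) (Finset.mem_range.2 (Nat.mod_lt n hm))
      refine h2.trans ((Nat.le_div_iff_mul_le hm).2 (by omega))
    have h2 := hN (n % m) (n / m) h1
    rw [add_mul, one_mul, ← add_assoc, hdm] at h2
    exact h2

end Period

/-! ### Infinitely ramified branches: ramification -/

section Growth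

/-- A sequence of natural numbers with `k (n + m) ≤ k n` eventually has period `m`. -/
theorem eventually_periodic_of_le {k : ℕ → ℕ} {m N : ℕ} (h : ∀ n, N ≤ n → k (n + m) ≤ k n) :
    ∃ N', N ≤ N' ∧ ∀ n, N' ≤ n → k (n + m) = k n := by
  -- the sums over `m` successive terms decrease, and are constant once the least one is reached
  set S : ℕ → ℕ := fun n => ∑ i ∈ Finset.range m, k (n + i) with hS
  have hstep : ∀ n, S (n + 1) + k n = S n + k (n + m) := by
    intro n
    have h1 := Finset.sum_range_succ (fun i => k (n + i)) m
    have h2 := Finset.sum_range_succ' (fun i => k (n + i)) m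
    rw [h1] at h2
    simp only [add_zero] at h2
    rw [hS]
    simp only
    rw [h2]
    congr 1
    exact Finset.sum_congr rfl fun i _ => by congr 1; ring
  have hanti : ∀ n, N ≤ n → ∀ j, S (n + j) ≤ S n := by
    intro n hn j
    induction j with
    | zero => exact le_rfl
    | succ j ih =>
      have h1 := hstep (n + j)
      have h2 := h (n + j) (by omega)
      rw [← add_assoc]
      omega
  obtain ⟨v, ⟨N', hN', rfl⟩, hv⟩ : ∃ v, (∃ n, N ≤ n ∧ S n = v) ∧ ∀ n, N ≤ n → v ≤ S n := by
    classical
    have hex : ∃ v n, N ≤ n ∧ S n = v := ⟨_, N, le_rfl, rfl⟩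
    exact ⟨Nat.find hex, Nat.find_spec hex, fun n hn => Nat.find_min' hex ⟨n, hn, rfl⟩⟩
  refine ⟨N', hN', fun n hn => ?_⟩
  obtain ⟨j, rfl⟩ := Nat.exists_eq_add_of_le hn
  have h1 := hstep (N' + j)
  have h2 := hanti N' hN' j
  have h3 := hv (N' + j) (by omega)
  have h4 := hanti N' hN' (j + 1)
  have h5 := hv (N' + (j + 1)) (by omega)
  rw [← add_assoc] at h4 h5
  omega

theorem isTheta_of_recurrence {R : ℕ → ℕ} {m e N : ℕ} (hm : 0 < m) (he : 0 < e)
    (hR : ∀ n, 0 < R n) (h : ∀ n, N ≤ n → R (n + m) = R n * e) :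
    (fun n : ℕ => (R n : ℝ)) =Θ[atTop] fun n : ℕ => (e : ℝ) ^ ((n : ℝ) / (m : ℝ)) := by
  have he' : (0 : ℝ) < e := by exact_mod_cast he
  have hm' : (m : ℝ) ≠ 0 := by exact_mod_cast hm.ne'
  set E : ℕ → ℝ := fun n => (e : ℝ) ^ ((n : ℝ) / (m : ℝ)) with hE
  have hEpos : ∀ n, 0 < E n := fun n => Real.rpow_pos_of_pos he' _
  have hEstep : ∀ n, E (n + m) = E n * e := by
    intro n
    simp only [hE]
    rw [Nat.cast_add, add_div, div_self hm', Real.rpow_add he', Real.rpow_one]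
  -- the quotient is eventually periodic
  set g : ℕ → ℝ := fun n => R n / E n with hg
  have hgpos : ∀ n, 0 < g n := fun n => div_pos (by exact_mod_cast hR n) (hEpos n)
  have hgstep : ∀ n, N ≤ n → g (n + m) = g n := by
    intro n hn
    simp only [hg]
    rw [h n hn, hEstep, Nat.cast_mul, mul_div_mul_right _ _ he'.ne']
  have hgper : ∀ n, ∃ i ∈ Finset.range m, g (N + n) = g (N + i) := by
    intro n
    induction n using Nat.strong_induction_on with
    | _ n ih =>
      rcases lt_or_ge n m with hn | hn
      · exact ⟨n, Finset.mem_range.2 hn, rfl⟩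
      · obtain ⟨j, rfl⟩ := Nat.exists_eq_add_of_le' hn
        obtain ⟨i, hi, h1⟩ := ih j (by omega)
        exact ⟨i, hi, by rw [← add_assoc, hgstep _ (by omega), h1]⟩
  have hRE : ∀ n, (R n : ℝ) = g n * E n := fun n => (div_mul_cancel₀ _ (hEpos n).ne').symm
  constructor
  · refine Asymptotics.IsBigO.of_bound (∑ i ∈ Finset.range m, g (N + i)) ?_
    filter_upwards [eventually_ge_atTop N] with n hn
    obtain ⟨j, rfl⟩ := Nat.exists_eq_add_of_le hn
    obtain ⟨i, hi, h1⟩ := hgper j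
    rw [Real.norm_of_nonneg (Nat.cast_nonneg _), Real.norm_of_nonneg (hEpos _).le, hRE, h1]
    exact mul_le_mul_of_nonneg_right (Finset.single_le_sum (f := fun i => g (N + i))
      (fun _ _ => (hgpos _).le) hi) (hEpos _).le
  · refine Asymptotics.IsBigO.of_bound (∑ i ∈ Finset.range m, (g (N + i))⁻¹) ?_
    filter_upwards [eventually_ge_atTop N] with n hn
    obtain ⟨j, rfl⟩ := Nat.exists_eq_add_of_le hn
    obtain ⟨i, hi, h1⟩ := hgper j
    rw [Real.norm_of_nonneg (Nat.cast_nonneg _), Real.norm_of_nonneg (hEpos _).le, hRE, ← mul_assoc]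
    refine le_mul_of_one_le_left (hEpos _).le ?_
    have h2 : (g (N + i))⁻¹ ≤ ∑ i ∈ Finset.range m, (g (N + i))⁻¹ :=
      Finset.single_le_sum (f := fun i => (g (N + i))⁻¹)
        (fun _ _ => (inv_pos.2 (hgpos _)).le) hi
    rw [h1]
    calc 1 = (g (N + i))⁻¹ * g (N + i) := (inv_mul_cancel₀ (hgpos _).ne').symm
      _ ≤ _ := mul_le_mul_of_nonneg_right h2 (hgpos _).le

variable {p : ℕ} [Fact p.Prime] {K : Type*} [Field K] [Algebra ℚ_[p] K]
  [FiniteDimensional ℚ_[p] K] {f : RatFunc K} {a : ℕ → P1bar K} {x : OnePoint K} {m e : ℕ}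

/-- The distance of `a n` to a rational point generates a subgroup of the value group of `K(a n)`,
whose index can only decrease when `n` increases by `m`, because the ramification index of
`K(a (n + m)) / K(a n)` is at most `e`. When the index is stationary, the ramification is total. -/
theorem TameMap.ramification (hf : TameMap p f) (hb : IsBranchOver f x a)
    (hinf : IsInfinitelyRamified p a) (hm : 0 < m) (hsd : ∀ n, SameDisc p (a (n + m)) (a n))
    (he : 2 ≤ e) (hl : ∀ n, LocDeg p (mapBar f)^[m] (a n) e) :
    (∀ᶠ n in atTop, IsTotallyRamifiedOfDegree p (fieldOf (a n)) (fieldOf (a (n + m))) e) ∧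
    (fun n : ℕ => (ramIndex p ⊥ (fieldOf (a n)) : ℝ)) =Θ[atTop]
      fun n : ℕ => (e : ℝ) ^ ((n : ℝ) / (m : ℝ)) := by
  have := charZero_of_padic (K := K) p
  obtain ⟨b, N, hbm, hbsd, hN⟩ := hf.exists_roots hb hinf hm hsd he hl
  have hle : ∀ n, fieldOf (a n) ≤ fieldOf (a (n + m)) := fun n => by
    have h1 := fieldOf_mapBar_iterate_le f m (a (n + m))
    rwa [hb.2.iterate] at h1
  -- the conjugates of `a (n + m)` over `K(a n)` lie in its residue disc, because this contains the
  -- rational point `b (n + m)`, and they are preimages of `a n`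
  have hdeg : ∀ n, (fieldOf (a n)).relfinrank (fieldOf (a (n + m))) ≤ e := by
    intro n
    obtain ⟨Z, hZ, hZ'⟩ := (hl (n + m)).fiber_subset (w := a n)
      (by rw [hb.2.iterate]; exact SameDisc.refl _)
    rw [← hZ]
    refine relfinrank_fieldOf_le (hle n) Z fun σ hσ => hZ' _ ?_ ?_
    · have h1 := (hbsd (n + m)).gal σ
      rw [gal_toBar] at h1
      exact h1.trans (hbsd (n + m)).symm
    · rw [mapBar_iterate_gal, hb.2.iterate]
      exact mem_fixingSubgroup_fieldOf.1 hσ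
  have hram : ∀ n, ramIndex p (fieldOf (a n)) (fieldOf (a (n + m))) ≤ e := fun n =>
    (ramIndex_le_relfinrank p (hle n)).2.trans (hdeg n)
  have hu : ∀ n, N ≤ n → ∃ u ∈ valueGroup p (fieldOf (a n)),
      (u : ℝ) = sphDist p (a n) (toBar (b n)) := fun n hn =>
    sphDist_mem_valueGroup p le_rfl (by rw [fieldOf_toBar]; exact bot_le) (hN n hn).1
  choose! u hu hu' using hu
  set k : ℕ → ℕ := fun n => (Subgroup.zpowers (u n)).relIndex (valueGroup p (fieldOf (a n))) with hk
  have hu1 : ∀ n, N ≤ n → (u n : ℝ) < 1 := fun n hn => by rw [hu' n hn]; exact hbsd n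
  have hkpos : ∀ n, N ≤ n → k n ≠ 0 := fun n hn =>
    relIndex_zpowers_valueGroup_ne_zero p _ (hu n hn) fun h =>
      (hu1 n hn).ne (congrArg Units.val h)
  have hkstep : ∀ n, N ≤ n →
      k n * ramIndex p (fieldOf (a n)) (fieldOf (a (n + m))) = e * k (n + m) := by
    intro n hn
    have h1 : (u n : ℝ) = (u (n + m) : ℝ) ^ e := by
      rw [hu' n hn, hu' (n + m) (by omega), hbm, (hN n hn).2]
    rw [hk]
    simp only
    rw [← relIndex_zpowers_pow p (hu (n + m) (by omega)) (hu1 (n + m) (by omega)) h1, ramIndex]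
    exact Subgroup.relIndex_mul_relIndex _ _ _ (by rw [Subgroup.zpowers_le]; exact hu n hn)
      (valueGroup_mono p (hle n))
  obtain ⟨N', hNN', hN'⟩ := eventually_periodic_of_le (k := k) (m := m) (N := N) fun n hn => by
    refine Nat.le_of_mul_le_mul_left (?_ : e * k (n + m) ≤ e * k n) (by omega)
    rw [← hkstep n hn, mul_comm e]
    exact Nat.mul_le_mul_left _ (hram n)
  have hrame : ∀ n, N' ≤ n → ramIndex p (fieldOf (a n)) (fieldOf (a (n + m))) = e := by
    intro n hn
    have h1 := hkstep n (by omega)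
    rw [hN' n hn, mul_comm e] at h1
    exact Nat.eq_of_mul_eq_mul_left (Nat.pos_of_ne_zero (hkpos n (by omega))) h1
  refine ⟨?_, isTheta_of_recurrence hm (by omega)
    (fun n => Nat.pos_of_ne_zero (ramIndex_le_relfinrank p bot_le).1) (N := N') fun n hn => ?_⟩
  · filter_upwards [eventually_ge_atTop N'] with n hn
    refine ⟨hle n, by omega, le_antisymm (hdeg n) ?_, hrame n hn⟩
    rw [← hrame n hn]
    exact (ramIndex_le_relfinrank p (hle n)).2
  · rw [← hrame n hn]
    exact (Subgroup.relIndex_mul_relIndex _ _ _ (valueGroup_mono p bot_le)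
      (valueGroup_mono p (hle n))).symm

end Growth

/-! ### Pre-critical points in the residue discs of a branch -/

section Shadow

variable {p : ℕ} [Fact p.Prime] {K : Type*} [Field K] [Algebra ℚ_[p] K]
  [FiniteDimensional ℚ_[p] K] {f : RatFunc K} {a : ℕ → P1bar K} {x : OnePoint K} {m : ℕ}

/-- Preimages can be chosen in prescribed residue discs. -/
theorem TameMap.exists_backwardOrbit (hf : TameMap p f) (ha : IsBackwardOrbit f a) {z : P1bar K}
    (hz : SameDisc p z (a 0)) : ∃ γ : ℕ → P1bar K, γ 0 = z ∧ IsBackwardOrbit f γ ∧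
      ∀ n, SameDisc p (γ n) (a n) := by
  have hstep : ∀ n z, SameDisc p z (a n) → ∃ z', SameDisc p z' (a (n + 1)) ∧ mapBar f z' = z :=
    fun n z hz => (hf.goodMap.ldeg_spec (a (n + 1))).exists_preimage (by rwa [ha])
  choose! g g1 g2 using hstep
  let γ : ℕ → P1bar K := fun n => Nat.rec z (fun n w => g n w) n
  have hγ : ∀ n, SameDisc p (γ n) (a n) := by
    intro n
    induction n with
    | zero => exact hz
    | succ n ih => exact g1 n _ ih
  exact ⟨γ, rfl, fun n => g2 n _ (hγ n), hγ⟩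

/-- The residue disc of the base point contains a pre-critical point: follow the cycle of discs to
the first critical point and return along discs that `f` maps bijectively. -/
theorem TameMap.exists_preCrit (hf : TameMap p f) (hb : IsBranchOver f x a)
    (hinf : IsInfinitelyRamified p a) (hm : 0 < m) (hsd : ∀ n, SameDisc p (a (n + m)) (a n)) :
    ∃ z, SameDisc p z (a 0) ∧ IsPreCrit f z ∧
      (PeriodicCriticalRational p f → ∃ y : OnePoint K, toBar y = z) := by
  classical
  have := charZero_of_padic (K := K) p
  have hex : ∃ j c, IsCrit f c ∧ SameDisc p c ((mapBar f)^[j] (a 0)) := by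
    obtain ⟨c, hc, hc'⟩ := hf.exists_crit_frequently hb.2 hinf
    obtain ⟨n, -, hn⟩ := hc' 0
    have h1 : ∀ k, SameDisc p (a (k * m)) (a 0) := by
      intro k
      induction k with
      | zero => rw [zero_mul]; exact SameDisc.refl _
      | succ k ih => rw [add_mul, one_mul]; exact (hsd _).trans ih
    have h2 := hf.goodMap.sameDisc_iterate (n * (m - 1)) (h1 n)
    rw [show n * m = n + n * (m - 1) by
      obtain ⟨j, rfl⟩ := Nat.exists_eq_add_of_lt hm
      rw [Nat.add_sub_cancel]; ring, hb.2.iterate] at h2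
    exact ⟨n * (m - 1), c, hc, hn.symm.trans h2⟩
  set j := Nat.find hex with hj
  obtain ⟨c, hc, hcj⟩ := Nat.find_spec hex
  have hone : LocDeg p (mapBar f)^[j] (a 0) 1 := by
    have h1 := hf.goodMap.locDeg_iterate j (a 0)
    have h2 : iterDeg p (mapBar f) j (a 0) = 1 := by
      refine Finset.prod_eq_one fun i hi => ?_
      have h3 := hf.goodMap.ldeg_pos ((mapBar f)^[i] (a 0))
      by_contra hne
      obtain ⟨c', h4, h5⟩ := hf.exists_crit _ (show 2 ≤ ldeg p (mapBar f) ((mapBar f)^[i] (a 0)) by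
        omega)
      exact Nat.find_min hex (Finset.mem_range.1 hi) ⟨c', h5, h4⟩
    rwa [h2] at h1
  obtain ⟨z, hz, hzc⟩ := hone.exists_preimage hcj
  refine ⟨z, hz, ⟨j, by rwa [hzc]⟩, fun hR => ?_⟩
  have hper : SameDisc p ((mapBar f)^[m] (a 0)) (a 0) := by
    have h1 := hf.goodMap.sameDisc_iterate m (hsd 0).symm
    rwa [hb.2.iterate] at h1
  obtain ⟨y, hy⟩ := hR c hc ⟨m, hm, redBar_eq_iff.2 (by
    have h1 := hf.goodMap.sameDisc_iterate j hper
    rw [← Function.iterate_add_apply, add_comm, Function.iterate_add_apply] at h1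
    exact ((hf.goodMap.sameDisc_iterate m hcj).trans h1).trans hcj.symm)⟩
  -- `z` is the only preimage in its disc of the rational point `c`
  refine exists_toBar_of_fixed fun σ => hone.injective_of_one ?_ hz ?_
  · have h1 := hz.gal σ
    rwa [hb.1, gal_toBar, ← hb.1] at h1
  · rw [mapBar_iterate_gal, hzc, ← hy, gal_toBar]

theorem TameMap.exists_preCrit_orbit (hf : TameMap p f) (hb : IsBranchOver f x a)
    (hinf : IsInfinitelyRamified p a) (hm : 0 < m) (hsd : ∀ n, SameDisc p (a (n + m)) (a n)) :
    ∃ γ : ℕ → P1bar K, IsBackwardOrbit f γ ∧ (∀ n, IsPreCrit f (γ n)) ∧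
      (∀ n, sphDist p (a n) (γ n) < 1) ∧
      (PeriodicCriticalRational p f → ∃ y : OnePoint K, IsBranchOver f y γ) := by
  obtain ⟨z, hz, ⟨k, hk⟩, hR⟩ := hf.exists_preCrit hb hinf hm hsd
  obtain ⟨γ, rfl, h1, h2⟩ := hf.exists_backwardOrbit hb.2 hz
  refine ⟨γ, h1, fun n => ⟨k + n, ?_⟩, fun n => (h2 n).symm, fun h => ?_⟩
  · have h3 := h1.iterate n 0
    rw [zero_add] at h3
    rwa [Function.iterate_add_apply, h3]
  · obtain ⟨y, hy⟩ := hR h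
    exact ⟨y, hy.symm, h1⟩

end Shadow

/-! ### Directed cycles -/

section Cycle

variable {p : ℕ} [Fact p.Prime] {K : Type*} [Field K] [Algebra ℚ_[p] K]
  [FiniteDimensional ℚ_[p] K] {f : RatFunc K}

theorem closedPt_eq_iff {x y : P1bar K} :
    closedPt x = closedPt y ↔ ∃ σ : GalBar K, gal σ x = y := Quotient.eq (r := galSetoid K)

/-- A path of directed edges that returns to the residue disc where it started contains a directed
cycle: take a shortest part of it whose ends coincide or are joined by an undirected edge. -/
theorem hasDirectedCycle_of_path {v : ℕ → IncidenceVertex f}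
    (hv : ∀ n, DirectedEdge f (v (n + 1)) (v n)) {m : ℕ} (hm : 0 < m)
    (h : v 0 = v m ∨ UndirectedEdge p f (v 0) (v m)) : HasDirectedCycle p f := by
  classical
  have hex : ∃ l, 0 < l ∧ ∃ i, v i = v (i + l) ∨ UndirectedEdge p f (v i) (v (i + l)) :=
    ⟨m, hm, 0, by simpa using h⟩
  obtain ⟨hl, i, hi⟩ := Nat.find_spec hex
  set l := Nat.find hex
  -- no two vertices at a smaller distance coincide
  have hmin : ∀ s t, s < t → t < s + l → v s ≠ v t := by
    intro s t hst htl heq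
    exact Nat.find_min hex (m := t - s) (by omega) ⟨by omega, s, Or.inl (by
      rw [heq]; congr 1; omega)⟩
  have hdir : ∀ t < l, DirectedEdge f (v (i + l - t)) (v (i + l - (t + 1))) := by
    intro t ht
    have h1 := hv (i + l - (t + 1))
    rwa [show i + l - (t + 1) + 1 = i + l - t by omega] at h1
  clear_value l
  by_cases heq : v i = v (i + l)
  · obtain ⟨k, rfl⟩ : ∃ k, l = k + 1 := ⟨l - 1, by omega⟩
    have hedge : ∀ t : Fin (k + 1),
        DirectedEdge f (v (i + (k + 1) - t)) (v (i + (k + 1) - (t + 1 : Fin (k + 1)))) := by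
      intro t
      have h1 := hdir t t.2
      rw [Fin.val_add_one]
      split_ifs with ht
      · subst ht
        rw [Fin.val_last, show i + (k + 1) - (k + 1) = i by omega, heq] at h1
        rwa [Fin.val_last, Nat.sub_zero]
      · exact h1
    refine ⟨k, fun t => v (i + (k + 1) - t), fun s t hst => ?_, fun t => Or.inl (hedge t), 0,
      hedge 0⟩
    by_contra hne
    have hne' : (s : ℕ) ≠ t := fun h => hne (Fin.ext h)
    have hs := s.2
    have ht := t.2
    rcases lt_or_gt_of_ne hne' with h1 | h1
    · exact hmin (i + (k + 1) - t) (i + (k + 1) - s) (by omega) (by omega) hst.symm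
    · exact hmin (i + (k + 1) - s) (i + (k + 1) - t) (by omega) (by omega) hst
  · have hund := hi.resolve_left heq
    refine ⟨l, fun t => v (i + l - t), fun s t hst => ?_, fun t => ?_, 0, ?_⟩
    · by_contra hne
      have hne' : (s : ℕ) ≠ t := fun h => hne (Fin.ext h)
      have hs := s.2
      have ht := t.2
      have key : ∀ s t : ℕ, s < t → t ≤ l → v (i + l - s) ≠ v (i + l - t) := by
        intro s t hst htl h1
        rcases Nat.lt_or_ge (t - s) l with h2 | h2
        · exact hmin (i + l - t) (i + l - s) (by omega) (by omega) h1.symm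
        · obtain rfl : s = 0 := by omega
          obtain rfl : t = l := by omega
          rw [Nat.sub_zero, Nat.add_sub_cancel] at h1
          exact heq h1.symm
      rcases lt_or_gt_of_ne hne' with h1 | h1
      · exact key s t h1 (by omega) hst
      · exact key t s h1 (by omega) hst.symm
    · simp only [Fin.val_add_one]
      split_ifs with ht
      · subst ht
        right
        simpa using hund
      · have ht' : (t : ℕ) ≠ l := fun h => ht (Fin.ext h)
        exact Or.inl (hdir t (by omega))
    · simp only [Fin.val_add_one]
      rw [if_neg (fun h => by
        have := congrArg Fin.val h
        simp at this
        omega)]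
      exact hdir 0 hl

theorem TameMap.hasDirectedCycle (hf : TameMap p f) (h : HasInfRamifiedBranch p f) :
    HasDirectedCycle p f := by
  obtain ⟨x, a, hb, hinf⟩ := h
  obtain ⟨m, e, -, hm, hsd, -, -⟩ := hf.exists_residualPeriod hb.2 hinf
  obtain ⟨γ, h1, h2, h3, -⟩ := hf.exists_preCrit_orbit hb hinf hm hsd
  refine hasDirectedCycle_of_path (v := fun n => ⟨closedPt (γ n), γ n, rfl, h2 n⟩)
    (fun n => ⟨γ (n + 1), rfl, by rw [h1]⟩) hm (or_iff_not_imp_left.2 fun hne => ⟨hne, γ 0, γ m,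
      rfl, rfl, redBar_eq_iff.2 ?_⟩)
  have h4 := hsd 0
  rw [zero_add] at h4
  exact ((SameDisc.symm (h3 0)).trans h4.symm).trans (h3 m)

theorem TameMap.sameDisc_iterate_zero (hf : TameMap p f) {a : ℕ → P1bar K}
    (ha : IsBackwardOrbit f a) {m : ℕ} (hsd : ∀ n, SameDisc p (a (n + m)) (a n)) :
    SameDisc p ((mapBar f)^[m] (a 0)) (a 0) := by
  have h1 := hf.goodMap.sameDisc_iterate m (hsd 0)
  rw [ha.iterate] at h1
  exact h1.symm

open scoped Fin.NatCast in
/-- Walking around a directed cycle returns to a conjugate of the residue disc of the starting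
point, and walking around it repeatedly to the disc itself. Its forward images contain a critical
point. -/
theorem TameMap.exists_crit_periodic (hf : TameMap p f) (h : HasDirectedCycle p f) :
    ∃ c, IsCrit f c ∧ ∃ s, 0 < s ∧ SameDisc p ((mapBar f)^[s] c) c := by
  have := charZero_of_padic (K := K) p
  obtain ⟨k, v, -, hedge, i₀, hi₀⟩ := h
  obtain ⟨x₀, hx₀, hpre⟩ := (v 0).2
  -- after `t` edges the walk is at a conjugate of a point in the disc of `f^[s] x₀`, where `s` is
  -- the number of directed edges among them
  have hwalk : ∀ t : ℕ, ∃ s y, closedPt y = (v (t : Fin (k + 1))).1 ∧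
      SameDisc p ((mapBar f)^[s] x₀) y ∧
      ((∃ i < t, DirectedEdge f (v (i : Fin (k + 1))) (v ((i : Fin (k + 1)) + 1))) → 0 < s) := by
    intro t
    induction t with
    | zero =>
      exact ⟨0, x₀, by simpa using hx₀, SameDisc.refl _, fun ⟨i, hi, _⟩ => by omega⟩
    | succ t ih =>
      obtain ⟨s, y, hy, hsy, hs⟩ := ih
      by_cases hd : DirectedEdge f (v (t : Fin (k + 1))) (v ((t : Fin (k + 1)) + 1))
      · obtain ⟨z, hz, hz'⟩ := hd
        obtain ⟨σ, rfl⟩ := closedPt_eq_iff.1 (hz.trans hy.symm)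
        refine ⟨s + 1, mapBar f (gal σ z), ?_, ?_, fun _ => by omega⟩
        · rw [Nat.cast_succ, ← hz', mapBar_gal]
          exact (closedPt_eq_iff.2 ⟨σ, rfl⟩).symm
        · rw [Function.iterate_succ_apply']
          exact hf.goodMap.sameDisc hsy
      · obtain ⟨-, z, w, hz, hw, hzw⟩ := (hedge (t : Fin (k + 1))).resolve_left hd
        obtain ⟨σ, rfl⟩ := closedPt_eq_iff.1 (hz.trans hy.symm)
        refine ⟨s, gal σ w, ?_, hsy.trans ((redBar_eq_iff.1 hzw).gal σ), ?_⟩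
        · rw [Nat.cast_succ, ← hw]
          exact (closedPt_eq_iff.2 ⟨σ, rfl⟩).symm
        · rintro ⟨i, hi, hi'⟩
          refine hs ⟨i, lt_of_le_of_ne (by omega) fun h => ?_, hi'⟩
          subst h
          exact hd hi'
  obtain ⟨s, y, hy, hsy, hs⟩ := hwalk (k + 1)
  have hs0 : 0 < s := hs ⟨i₀, i₀.2, by simpa using hi₀⟩
  have hy0 : closedPt y = closedPt x₀ := by
    rw [hy, hx₀]
    congr 2
    simp
  obtain ⟨τ, rfl⟩ := closedPt_eq_iff.1 hy0.symm
  -- iterating the walk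
  have hiter : ∀ n : ℕ, SameDisc p ((mapBar f)^[s * n] x₀) (gal (τ ^ n) x₀) := by
    intro n
    induction n with
    | zero => rw [mul_zero, pow_zero, gal_one]; exact SameDisc.refl _
    | succ n ih =>
      have h1 := hf.goodMap.sameDisc_iterate s ih
      rw [← Function.iterate_add_apply, mapBar_iterate_gal] at h1
      rw [show s * (n + 1) = s + s * n by ring, pow_succ, gal_mul]
      exact h1.trans (hsy.gal _)
  -- some power of `τ` fixes `x₀`
  obtain ⟨n, hn, -, hn'⟩ := Subgroup.exists_pow_mem_of_index_ne_zero
    (H := (fieldOf x₀).fixingSubgroup) (by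
      rw [← IntermediateField.finrank_eq_fixingSubgroup_index]
      exact Module.finrank_pos.ne') τ
  have h1 := hiter n
  rw [mem_fixingSubgroup_fieldOf.1 hn'] at h1
  obtain ⟨j, hj⟩ := hpre
  refine ⟨_, hj, s * n, Nat.mul_pos hs0 hn, ?_⟩
  have h2 := hf.goodMap.sameDisc_iterate j h1
  rwa [← Function.iterate_add_apply, add_comm, Function.iterate_add_apply] at h2

end Cycle

/-! ### Construction of infinitely ramified branches -/

section Construction

variable {p : ℕ} [Fact p.Prime] {K : Type*} [Field K] [Algebra ℚ_[p] K]
  [FiniteDimensional ℚ_[p] K] {f : RatFunc K}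

/-- A rational point in a periodic residue disc on which the return map has local degree at least
`2` is the base point of an infinitely ramified branch, unless the return map fixes it. -/
theorem LocDeg.exists_infinitelyRamified {b : OnePoint K} {s e : ℕ}
    (hs : 0 < s) (he : 2 ≤ e) (hl : LocDeg p (mapBar f)^[s] (toBar b) e)
    (hsd : SameDisc p ((mapBar f)^[s] (toBar b)) (toBar b))
    (hne : (mapBar f)^[s] (toBar b) ≠ toBar b) :
    ∃ a, IsBranchOver f b a ∧ IsInfinitelyRamified p a := by
  obtain ⟨r, hr⟩ := hl.exists_escapeRadius he hsd
  obtain ⟨c, hc0, hc, hcd, n₀, hn₀⟩ := hr.exists_escaping hl he hsd hne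
  obtain ⟨N, hN⟩ := (hr.dichotomy hc hcd).resolve_left fun h => absurd (h n₀) (not_le.2 hn₀)
  have hck : ∀ k n, (mapBar f)^[s * k] (c (n + k)) = c n := by
    intro k
    induction k with
    | zero => exact fun n => rfl
    | succ k ih =>
      intro n
      rw [mul_add, mul_one, Function.iterate_add_apply, ← add_assoc, hc, ih]
  -- `c` is a backward orbit of `f^[s]`; with `s = t + 1`, the `n`-th point of the branch is the
  -- image of `c n`, which lies `s * n` steps above `b`, under `f^[n * t]`
  obtain ⟨t, rfl⟩ : ∃ t, s = t + 1 := ⟨s - 1, by omega⟩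
  refine ⟨fun n => (mapBar f)^[n * t] (c n), ⟨by simpa using hc0, fun n => ?_⟩, ?_⟩
  · change mapBar f ((mapBar f)^[(n + 1) * t] (c (n + 1))) = (mapBar f)^[n * t] (c n)
    rw [← Function.iterate_succ_apply' (mapBar f), show ((n + 1) * t).succ = n * t + (t + 1) by
      rw [Nat.succ_eq_add_one]; ring, Function.iterate_add_apply, hc]
  · have hval : ∀ n, (mapBar f)^[n * (t + 1) * t] (c (n * (t + 1))) = c n := fun n => by
      rw [show n * (t + 1) * t = (t + 1) * (n * t) by ring, show n * (t + 1) = n + n * t by ring,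
        hck]
    refine isInfinitelyRamified_of_roots p (b := b) (s := t + 1) (N := N) he fun n hn => ?_
    simp only [hval]
    exact ⟨hr.nonneg.trans_lt (hN n hn).1, hcd n, (hN n hn).2⟩

/-- There are two rational points arbitrarily close to a given one. At least one of them is not
fixed by a return map of local degree at least `2`. -/
theorem exists_two_near (y : OnePoint K) {ε : ℝ} (hε : 0 < ε) : ∃ α β : K, α ≠ β ∧
    sphDist p (OnePoint.some α) y < ε ∧ sphDist p (OnePoint.some β) y < ε := by
  have hp0 := absv_prime_pos (F := K) p
  have hp1 := absv_prime_lt_one (F := K) p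
  obtain ⟨n, hn⟩ := exists_pow_lt_of_lt_one hε hp1
  have hn' : absv p (p : K) ^ (n + 1) < ε :=
    (pow_le_pow_of_le_one hp0.le hp1.le (Nat.le_succ n)).trans_lt hn
  have hne : ((p : K)) ^ n ≠ (p : K) ^ (n + 1) := fun h => by
    have h1 := congrArg (absv p) h
    rw [absv_pow, absv_pow] at h1
    have := pow_eq_pow_of_lt_one hp0 hp1 h1
    omega
  induction y using OnePoint.rec with
  | infty =>
    have key : ∀ k, sphDist p (OnePoint.some ((p : K) ^ k)⁻¹) OnePoint.infty =
        absv p (p : K) ^ k := by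
      intro k
      change 1 / max 1 (absv p ((p : K) ^ k)⁻¹) = _
      rw [absv_inv, absv_pow, max_eq_right, one_div, inv_inv]
      exact (one_le_inv₀ (pow_pos hp0 k)).2 (pow_le_one₀ hp0.le hp1.le)
    refine ⟨((p : K) ^ n)⁻¹, ((p : K) ^ (n + 1))⁻¹, fun h => hne (inv_injective h), ?_, ?_⟩
    · rwa [key]
    · rwa [key]
  | coe y =>
    have key : ∀ k, sphDist p (OnePoint.some (y + (p : K) ^ k)) (OnePoint.some y) ≤
        absv p (p : K) ^ k := by
      intro k
      change absv p (y + (p : K) ^ k - y) / (max 1 (absv p (y + (p : K) ^ k)) *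
        max 1 (absv p y)) ≤ _
      rw [add_sub_cancel_left, absv_pow]
      exact div_le_self (pow_pos hp0 k).le
        (one_le_mul_of_one_le_of_one_le (le_max_left _ _) (le_max_left _ _))
    exact ⟨y + (p : K) ^ n, y + (p : K) ^ (n + 1), fun h => hne (add_left_cancel h),
      (key n).trans_lt hn, (key (n + 1)).trans_lt hn'⟩

theorem TameMap.hasInfRamifiedNearCritical (hf : TameMap p f) (hR : PeriodicCriticalRational p f)
    (h : HasDirectedCycle p f) : HasInfRamifiedNearCritical p f := by
  intro ε hε
  obtain ⟨c, hc, s, hs, hsc⟩ := hf.exists_crit_periodic h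
  obtain ⟨y, rfl⟩ := hR c hc ⟨s, hs, redBar_eq_iff.2 hsc⟩
  set e := iterDeg p (mapBar f) s (toBar y) with he'
  have hl := hf.goodMap.locDeg_iterate s (toBar y)
  have he : 2 ≤ e := (hf.two_le_ldeg _ hc).trans
    (hf.goodMap.ldeg_le_iterDeg (x := toBar y) hs)
  -- every rational point near `c` that is not fixed by `f^[s]` is a base point
  have key : ∀ α : K, sphDist p (OnePoint.some α) y < min ε 1 →
      (mapBar f)^[s] (toBar (OnePoint.some α)) ≠ toBar (OnePoint.some α) →
      ∃ (α : K) (c : P1bar K), IsCrit f c ∧ sphDist p (toBar (OnePoint.some α)) c < ε ∧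
        ∃ a, IsBranchOver f (OnePoint.some α) a ∧ IsInfinitelyRamified p a := by
    intro α hα hne
    rw [← sphDist_toBar] at hα
    have hd : SameDisc p (toBar (OnePoint.some α)) (toBar y) := hα.trans_le (min_le_right _ _)
    exact ⟨α, toBar y, hc, hα.trans_le (min_le_left _ _), (hl.congr hd).exists_infinitelyRamified
      hs he (((hf.goodMap.sameDisc_iterate s hd).trans hsc).trans hd.symm) hne⟩
  obtain ⟨α, β, hαβ, hα, hβ⟩ := exists_two_near (p := p) y (lt_min hε one_pos)
  by_cases hfix : (mapBar f)^[s] (toBar (OnePoint.some α)) = toBar (OnePoint.some α)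
  · refine key β hβ fun hfix' => hαβ ?_
    have hα' : SameDisc p (toBar (OnePoint.some α)) (toBar y) := by
      rw [SameDisc, sphDist_toBar]; exact hα.trans_le (min_le_right _ _)
    have hβ' : SameDisc p (toBar (OnePoint.some β)) (toBar y) := by
      rw [SameDisc, sphDist_toBar]; exact hβ.trans_le (min_le_right _ _)
    obtain ⟨r, hr⟩ := (hl.congr hβ').exists_escapeRadius he (by rw [hfix']; exact SameDisc.refl _)
    exact OnePoint.coe_injective
      (toBar_injective (hr.eq_of_fixed hfix' he (hα'.trans hβ'.symm) hfix))
  · exact key α hα hfix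

end Construction

end Arboreal

end

theorem mainTheorem1 (p : ℕ) [Fact p.Prime] {K : Type*} [Field K] [Algebra ℚ_[p] K]
    [FiniteDimensional ℚ_[p] K] (f : RatFunc K)
    (hd : 1 ≤ Arboreal.ratDegree f) (hdp : Arboreal.ratDegree f < p)
    (hf : Arboreal.HasGoodReduction p f) :
    -- the equivalence of (a), (b) and (c)
    (Arboreal.PeriodicCriticalRational p f →
      List.TFAE [Arboreal.HasDirectedCycle p f, Arboreal.HasInfRamifiedNearCritical p f,
        Arboreal.HasInfRamifiedBranch p f]) ∧
    -- the implications that hold without rationality of critical points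
    (Arboreal.HasInfRamifiedNearCritical p f → Arboreal.HasInfRamifiedBranch p f) ∧
    (Arboreal.HasInfRamifiedBranch p f → Arboreal.HasDirectedCycle p f) ∧
    -- the structure of any infinitely ramified branch
    (∀ (x : OnePoint K) (a : ℕ → Arboreal.P1bar K), Arboreal.IsBranchOver f x a →
      Arboreal.IsInfinitelyRamified p a →
      (∃ γ : ℕ → Arboreal.P1bar K, Arboreal.IsBackwardOrbit f γ ∧
        (∀ n, Arboreal.IsPreCrit f (γ n)) ∧
        (∀ n, Arboreal.sphDist p (a n) (γ n) < 1) ∧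
        (Arboreal.PeriodicCriticalRational p f → ∃ y : OnePoint K, Arboreal.IsBranchOver f y γ)) ∧
      ∃ m e : ℕ, Arboreal.HasExactResidualPeriod p a m ∧
        Arboreal.HasLocalWeierstrassDegree p f m x e ∧
        (∀ᶠ n in Filter.atTop, Arboreal.IsTotallyRamifiedOfDegree p
          (Arboreal.fieldOf (a n)) (Arboreal.fieldOf (a (n + m))) e) ∧
        (fun n : ℕ => (Arboreal.ramIndex p ⊥ (Arboreal.fieldOf (a n)) : ℝ)) =Θ[Filter.atTop]
          fun n : ℕ => (e : ℝ) ^ ((n : ℝ) / (m : ℝ))) ∧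
    -- a critical point as the base point
    (∀ (c α : OnePoint K), Arboreal.IsCrit f (Arboreal.toBar c) →
      Arboreal.sphDist p α c < 1 →
      (∃ a, Arboreal.IsBranchOver f α a ∧ Arboreal.IsInfinitelyRamified p a) →
      (¬ ∃ k : ℕ, 0 < k ∧ (Arboreal.mapBar f)^[k] (Arboreal.toBar c) = Arboreal.toBar c) →
      ∃ a, Arboreal.IsBranchOver f c a ∧ Arboreal.IsInfinitelyRamified p a) := by
  have hT := hf.tameMap hd hdp
  have hbc : Arboreal.HasInfRamifiedNearCritical p f → Arboreal.HasInfRamifiedBranch p f := by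
    intro h
    obtain ⟨α, -, -, -, a, ha, hinf⟩ := h 1 one_pos
    exact ⟨OnePoint.some α, a, ha, hinf⟩
  refine ⟨fun hR => ?_, hbc, hT.hasDirectedCycle, fun x a hb hinf => ?_,
    fun c α _ hcα ⟨a, hb, hinf⟩ hper => ?_⟩
  · tfae_have 1 → 2 := hT.hasInfRamifiedNearCritical hR
    tfae_have 2 → 3 := hbc
    tfae_have 3 → 1 := hT.hasDirectedCycle
    tfae_finish
  · obtain ⟨m, e, hper, hm, hsd, he, hl⟩ := hT.exists_residualPeriod hb.2 hinf
    refine ⟨hT.exists_preCrit_orbit hb hinf hm hsd, m, e, hper,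
      hT.hasLocalWeierstrassDegree ?_ ?_, hT.ramification hb hinf hm hsd he hl⟩
    · rw [← hb.1]
      exact hl 0
    · rw [← hb.1]
      exact hT.sameDisc_iterate_zero hb.2 hsd
  · obtain ⟨m, e, -, hm, hsd, he, hl⟩ := hT.exists_residualPeriod hb.2 hinf
    have hα : Arboreal.SameDisc p (Arboreal.toBar α) (Arboreal.toBar c) := by
      rwa [Arboreal.SameDisc, Arboreal.sphDist_toBar]
    have hl0 := hl 0
    have hsd0 := hT.sameDisc_iterate_zero hb.2 hsd
    rw [hb.1] at hl0 hsd0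
    exact (hl0.congr hα.symm).exists_infinitelyRamified hm he
      (((hT.goodMap.sameDisc_iterate m hα.symm).trans hsd0).trans hα) fun h => hper ⟨m, hm, h⟩
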